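/- **Setting.** Let $d\ge 1$, let $\Omega\subset\mathbb R^d$ be a bounded open set, $T>0$, $Q=\Omega\times(0,T]$, $\bm g\in\mathbb R^d$. Let $\|\cdot\|$ and $(\cdot,\cdot)$ be the norm and inner product of $L^2(\Omega)$, $H^1_0(\Omega)$ the closure of $C_c^\infty(\Omega)$ in the $H^1$ norm, $H^{-1}(\Omega)$ its dual, $[\zeta]_+=\max\{\zeta,0\}$, and $\mathcal W=\{w\in L^2(0,T;H^1_0(\Omega)):\partial_t w\in L^2(0,T;H^{-1}(\Omega))\}\subset C([0,T];L^2(\Omega))$. Assume: 1. $p_c^{(i)},p_c^{(d)}:(0,1]\to\mathbb R$ are continuous, $C^1$ on $(0,1)$ with negative derivatives; $p_c^{(i)}<p_c^{(d)}$ on $(0,1)$; $p_c^{(i)}(1)=p_c^{(d)}(1)=:p_c(1)$; and $p_c^{(j)}(S)\to\infty$ as $S\searrow0$, $-{p_c^{(j)}}'(S)\to\infty$ as $S\nearrow1$ for $j\in\{i,d\}$. 2. $k\in C^1(\mathbb R)$, $k(S)=k(0)\ge0$ for $S\le0$, $k(S)=k(1)$ for $S\ge1$, $k(0)<k(S)<k(1)$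 for $0<S<1$; and either $k(0)>0$, or $k(0)=0$ and $\bm g=0$. 3. $b\in C^1(\mathbb R)$ is nondecreasing, $b'$ is bounded, $b(0)=0$ and $0<b'(p_c^{(j)}(S))<-1/{p_c^{(j)}}'(S)$ for $0<S<1$, $j\in\{i,d\}$. 4. $S_0\in H^1(\Omega)$, $p_0\in H^1_0(\Omega)$, and for some $\epsilon>0$, $\epsilon\le S_0\le1-\epsilon$ and $p_c^{(i)}(S_0)\le p_0\le p_c^{(d)}(S_0)$ a.e. in $\Omega$. Put $U_M=V_m=\lim_{p\to\infty}b(p)$, $U_m=b(p_c(1))$, $V_M=1+U_m$. For $j\in\{i,d\}$ let $\rho^{(j)}$ be, on $(V_m,V_M)$, the inverse of the function $u\mapsto (p_c^{(j)})^{-1}(b^{-1}(u))+u$ on $(U_m,U_M)$ (where $b^{-1}$ takes values in $[p_c(1),\infty)$), and let $\rho^{(j)}(v)=U_M$ for $v\le V_m$, $\rho^{(j)}(v)=U_m$ for $v\ge V_M$. For $\tau>0$ let $$\Phi_\tau(u,v)=\frac1\tau\begin{cases}\rho^{(d)}(v)-u & u>\rho^{(d)}(v),\\ 0 & \rho^{(i)}(v)\le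 u\le\rho^{(d)}(v),\\ \rho^{(i)}(v)-u & u<\rho^{(i)}(v).\end{cases}$$ A pair $(S,p)$ of functions on $Q$ is a *weak EPH solution* for $\tau>0$ if $p\in\mathcal W$, $S-S_0\in\mathcal W$, $S\in[0,1]$ a.e. in $Q$, $p(0)=p_0$, $S(0)=S_0$, $\partial_t(S+b(p))\in L^2(Q)$, and for all $\phi\in L^2(0,T;H_0^1(\Omega))$ and $\xi\in L^2(Q)$ $$\int_0^T\langle\partial_tS,\phi\rangle=\int_0^T(k(S)[\nabla p-\bm g],\nabla\phi),\qquad \int_0^T(\partial_t(S+b(p)),\xi)=\int_0^T(\Phi_\tau(b(p),S+b(p)),\xi).$$ **Proposition (bounds as $\tau\to0$).** (i) There is a constant $C>0$, independent of $\tau$, such that for every $\tau>0$ and every weak EPH solution $(S_\tau,p_\tau)$ for $\tau$, with $u_\tau=b(p_\tau)$ and $v_\tau=S_\tau+u_\tau$, the functions $[u_\tau-\rho^{(d)}(v_\tau)]_+$ and $[\rho^{(i)}(v_\tau)-u_\tau]_+$ belong to $L^2(Q)$ and $$\int_0^T\big\|[u_\tau-\rho^{(d)}(v_\tau)]_+\big\|^2+\int_0^T\big\|[\rho^{(i)}(v_\tau)-u_\tau]_+\big\|^2<C\tau.$$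 (ii) Let $\tau_n>0$, $\tau_n\to0$, and let $(S_n,p_n)$ be weak EPH solutions for $\tau_n$, $u_n=b(p_n)$, $v_n=S_n+u_n$. If $u_n\to u$ and $v_n\to v$ in measure on $Q$, then $\rho^{(i)}(v)\le u\le\rho^{(d)}(v)$ a.e. in $Q$. If $S_n\to S$ and $p_n\to p$ in measure on $Q$, then a.e. in $Q$: $0<S\le1$, $p\le p_c^{(d)}(S)$, and $p_c^{(i)}(S)\le p$ holds wherever $S<1$; wherever $S=1$ one has $b(p)=b(p_c(1))$ (so that $p=p_c(1)$ if $b$ is injective). If $\bm g=0$, then $p_c^{(i)}(S)\le p\le p_c^{(d)}(S)$ a.e. in $Q$. -/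

import Mathlib

open MeasureTheory Set Filter Topology
open scoped ContDiff

namespace EPH

noncomputable section

/-! ### Hysteresis curves -/

/-- Properties of the imbibition curve `pci` and the drainage curve `pcd`, as functions on `(0, 1]`
(values elsewhere are irrelevant). -/
structure CapillaryCurves (pci pcd : ℝ → ℝ) : Prop where
  contDiff_i : ContDiffOn ℝ 1 pci (Ioo 0 1)
  contDiff_d : ContDiffOn ℝ 1 pcd (Ioo 0 1)
  cont_i : ContinuousOn pci (Ioc 0 1)
  cont_d : ContinuousOn pcd (Ioc 0 1)
  deriv_neg_i : ∀ s ∈ Ioo (0 : ℝ) 1, deriv pci s < 0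
  deriv_neg_d : ∀ s ∈ Ioo (0 : ℝ) 1, deriv pcd s < 0
  lt : ∀ s ∈ Ioo (0 : ℝ) 1, pci s < pcd s
  eq_one : pci 1 = pcd 1
  tendsto_i : Tendsto pci (𝓝[>] 0) atTop
  tendsto_d : Tendsto pcd (𝓝[>] 0) atTop
  tendsto_deriv_i : Tendsto (fun s => -deriv pci s) (𝓝[<] 1) atTop
  tendsto_deriv_d : Tendsto (fun s => -deriv pcd s) (𝓝[<] 1) atTop

/-- Properties of the relative permeability. -/
structure Permeability (k : ℝ → ℝ) : Prop where
  contDiff : ContDiff ℝ 1 k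
  nonneg : 0 ≤ k 0
  eq_left : ∀ s ≤ 0, k s = k 0
  eq_right : ∀ s, 1 ≤ s → k s = k 1
  mid : ∀ s ∈ Ioo (0 : ℝ) 1, k 0 < k s ∧ k s < k 1

/-- Properties of the function `b` whose scanning curves are `S + b(p) = constant`. The two-sided
bound only concerns pressures above the common end value `pci 1 = pcd 1`; below that value `b` is
merely nondecreasing (for instance constant). -/
structure ScanningFunction (pci pcd b : ℝ → ℝ) : Prop where
  contDiff : ContDiff ℝ 1 b
  zero : b 0 = 0
  bound_i : ∀ s ∈ Ioo (0 : ℝ) 1, 0 < deriv b (pci s) ∧ deriv b (pci s) < -1 / deriv pci s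
  bound_d : ∀ s ∈ Ioo (0 : ℝ) 1, 0 < deriv b (pcd s) ∧ deriv b (pcd s) < -1 / deriv pcd s
  mono : Monotone b
  deriv_bdd : ∃ B : ℝ, ∀ q, deriv b q ≤ B

/-- `U_M = V_m = b(∞)`. -/
def UM (b : ℝ → ℝ) : ℝ := limUnder atTop b

/-- `U_m = b(p_c(1))`. -/
def Um (pc b : ℝ → ℝ) : ℝ := b (pc 1)

/-- `V_M = 1 + U_m`. -/
def VM (pc b : ℝ → ℝ) : ℝ := 1 + Um pc b

/-- `u ↦ p_c⁻¹(b⁻¹(u)) + u`: the curve `p = p_c(S)` written as `v = S + b(p)` in terms of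
`u = b(p)`. -/
def vCurve (pc b : ℝ → ℝ) (u : ℝ) : ℝ :=
  Function.invFunOn pc (Ioc 0 1) (Function.invFunOn b (Ici (pc 1)) u) + u

/-- The curve `ρ = (p_c⁻¹ ∘ b⁻¹ + id)⁻¹` on `(V_m, V_M)`, extended to `ℝ` by the constants
`U_M` (for `v ≤ V_m = U_M`) and `U_m` (for `v ≥ V_M`). -/
def rho (pc b : ℝ → ℝ) (v : ℝ) : ℝ :=
  open Classical in
  if v ≤ UM b then UM b
  else if VM pc b ≤ v then Um pc b
  else Function.invFunOn (vCurve pc b) (Ioo (Um pc b) (UM b)) v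

/-- The regularised hysteresis relation `∂ₜ v = Φ_τ(u, v)`. -/
def Phi (pci pcd b : ℝ → ℝ) (τ u v : ℝ) : ℝ :=
  open Classical in
  1 / τ * (if rho pcd b v < u then rho pcd b v - u
    else if u < rho pci b v then rho pci b v - u
    else 0)

/-! ### Function spaces -/

variable {d : ℕ}

/-- Test functions on `Ω`. -/
def IsTest (Ω : Set (EuclideanSpace ℝ (Fin d))) (φ : EuclideanSpace ℝ (Fin d) → ℝ) : Prop :=
  ContDiff ℝ ∞ φ ∧ HasCompactSupport φ ∧ tsupport φ ⊆ Ω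

/-- Pairs (function, vector field) in `L²(Ω) × L²(Ω; ℝᵈ)`, with the Hilbert norm. -/
abbrev Pairs (Ω : Set (EuclideanSpace ℝ (Fin d))) : Type :=
  WithLp 2 (Lp ℝ 2 (volume.restrict Ω) × Lp (EuclideanSpace ℝ (Fin d)) 2 (volume.restrict Ω))

/-- `f ∈ H¹(Ω)`: square integrable with a square integrable weak gradient. -/
def MemH1 (Ω : Set (EuclideanSpace ℝ (Fin d))) (f : EuclideanSpace ℝ (Fin d) → ℝ) : Prop :=
  MemLp f 2 (volume.restrict Ω) ∧
  ∃ G : EuclideanSpace ℝ (Fin d) → EuclideanSpace ℝ (Fin d), MemLp G 2 (volume.restrict Ω) ∧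
    ∀ φ, IsTest Ω φ → ∀ i : Fin d,
      ∫ x in Ω, f x * gradient φ x i = -∫ x in Ω, G x i * φ x

/-- `H¹₀(Ω)`, the closure of the test functions in the `H¹` norm. An element is the pair
`(f, ∇f)`, so that the norm is the `H¹` norm. -/
def H10 (Ω : Set (EuclideanSpace ℝ (Fin d))) : Submodule ℝ (Pairs Ω) :=
  (Submodule.span ℝ {w : Pairs Ω | ∃ φ, IsTest Ω φ ∧
    (w.fst : EuclideanSpace ℝ (Fin d) → ℝ) =ᵐ[volume.restrict Ω] φ ∧
    (w.snd : EuclideanSpace ℝ (Fin d) → EuclideanSpace ℝ (Fin d))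
      =ᵐ[volume.restrict Ω] gradient φ}).topologicalClosure

/-- `f ∈ H¹₀(Ω)`. -/
def MemH10 (Ω : Set (EuclideanSpace ℝ (Fin d))) (f : EuclideanSpace ℝ (Fin d) → ℝ) : Prop :=
  ∃ w ∈ H10 Ω, (w.fst : EuclideanSpace ℝ (Fin d) → ℝ) =ᵐ[volume.restrict Ω] f

/-- `H⁻¹(Ω)`, the dual of `H¹₀(Ω)`. -/
abbrev Hneg (Ω : Set (EuclideanSpace ℝ (Fin d))) : Type := StrongDual ℝ (H10 Ω)

/-- The space-time cylinder `Q = Ω × (0, T]`. -/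
def Q (Ω : Set (EuclideanSpace ℝ (Fin d))) (T : ℝ) : Set (EuclideanSpace ℝ (Fin d) × ℝ) :=
  Ω ×ˢ Ioc 0 T

/-- `w : Q → ℝ` belongs to
`𝓦 = {w ∈ L²(0,T; H¹₀(Ω)) : ∂ₜ w ∈ L²(0,T; H⁻¹(Ω))}`; here `W t` is `w(·,t)` as an element of
`H¹₀(Ω)`, and `W' = ∂ₜ w`. -/
structure IsW (Ω : Set (EuclideanSpace ℝ (Fin d))) (T : ℝ)
    (w : EuclideanSpace ℝ (Fin d) × ℝ → ℝ) (W : ℝ → H10 Ω) (W' : ℝ → Hneg Ω) : Prop where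
  meas : AEStronglyMeasurable w (volume.restrict (Q Ω T))
  memLp : MemLp W 2 (volume.restrict (Ioc 0 T))
  repr : ∀ᵐ t ∂(volume.restrict (Ioc 0 T)),
    ((W t : Pairs Ω).fst : EuclideanSpace ℝ (Fin d) → ℝ)
      =ᵐ[volume.restrict Ω] fun x => w (x, t)
  memLp' : MemLp W' 2 (volume.restrict (Ioc 0 T))
  deriv_eq : ∀ η : ℝ → ℝ, ContDiff ℝ ∞ η → HasCompactSupport η → tsupport η ⊆ Ioo 0 T →
    ∀ φ : H10 Ω,
      ∫ t in Ioc 0 T, η t * W' t φ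
        = -∫ t in Ioc 0 T, deriv η t * inner ℝ (W t : Pairs Ω).fst (φ : Pairs Ω).fst

/-- The initial value, i.e. the value at `t = 0` of the representative in `C([0,T]; L²(Ω))`,
of an element of `𝓦` is `w₀`. -/
def HasInitial (Ω : Set (EuclideanSpace ℝ (Fin d))) (T : ℝ) (W : ℝ → H10 Ω)
    (w₀ : EuclideanSpace ℝ (Fin d) → ℝ) : Prop :=
  ∃ c : ℝ → Lp ℝ 2 (volume.restrict Ω), ContinuousOn c (Icc 0 T) ∧
    (∀ᵐ t ∂(volume.restrict (Ioc 0 T)), c t = (W t : Pairs Ω).fst) ∧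
    (c 0 : EuclideanSpace ℝ (Fin d) → ℝ) =ᵐ[volume.restrict Ω] w₀

/-- `v'` is square integrable on `Q` and is the weak time derivative of `v` on `Q`. -/
def HasWeakTimeDeriv (Ω : Set (EuclideanSpace ℝ (Fin d))) (T : ℝ)
    (v v' : EuclideanSpace ℝ (Fin d) × ℝ → ℝ) : Prop :=
  MemLp v' 2 (volume.restrict (Q Ω T)) ∧
  ∀ ψ : EuclideanSpace ℝ (Fin d) × ℝ → ℝ, ContDiff ℝ ∞ ψ → HasCompactSupport ψ →
    tsupport ψ ⊆ Ω ×ˢ Ioo 0 T →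
    ∫ z in Q Ω T, v z * fderiv ℝ ψ z (0, 1) = -∫ z in Q Ω T, v' z * ψ z

/-! ### The initial data and the weak solutions -/

/-- Properties of the initial data. -/
structure InitialData (Ω : Set (EuclideanSpace ℝ (Fin d))) (pci pcd : ℝ → ℝ)
    (S₀ p₀ : EuclideanSpace ℝ (Fin d) → ℝ) : Prop where
  memH1 : MemH1 Ω S₀
  memH10 : MemH10 Ω p₀
  bounds : ∃ ε > 0, ∀ᵐ x ∂(volume.restrict Ω), ε ≤ S₀ x ∧ S₀ x ≤ 1 - ε
  between : ∀ᵐ x ∂(volume.restrict Ω), pci (S₀ x) ≤ p₀ x ∧ p₀ x ≤ pcd (S₀ x)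

/-- `(S, p)` is a weak solution of the regularised EPH model with parameter `τ`:
`p ∈ 𝓦`, `S - S₀ ∈ 𝓦`, `S ∈ [0,1]` a.e. in `Q`, `p(0) = p₀`, `S(0) = S₀`, and both weak equations
hold. Below `P`, `R` are `p`, `S - S₀` as curves in `H¹₀(Ω)`, `P'`, `R'` their time derivatives
(so `R' = ∂ₜ S`), and `v' = ∂ₜ (S + b(p))`. -/
def IsWeakSolution (Ω : Set (EuclideanSpace ℝ (Fin d))) (T : ℝ) (pci pcd b k : ℝ → ℝ)
    (g : EuclideanSpace ℝ (Fin d)) (S₀ p₀ : EuclideanSpace ℝ (Fin d) → ℝ) (τ : ℝ)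
    (S p : EuclideanSpace ℝ (Fin d) × ℝ → ℝ) : Prop :=
  ∃ (P R : ℝ → H10 Ω) (P' R' : ℝ → Hneg Ω) (v' : EuclideanSpace ℝ (Fin d) × ℝ → ℝ),
    IsW Ω T p P P' ∧
    IsW Ω T (fun z => S z - S₀ z.1) R R' ∧
    (∀ᵐ z ∂(volume.restrict (Q Ω T)), S z ∈ Icc (0 : ℝ) 1) ∧
    HasInitial Ω T P p₀ ∧
    HasInitial Ω T R 0 ∧
    HasWeakTimeDeriv Ω T (fun z => S z + b (p z)) v' ∧
    (∀ φ : ℝ → H10 Ω, MemLp φ 2 (volume.restrict (Ioc 0 T)) →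
      ∫ t in Ioc 0 T, R' t (φ t)
        = ∫ t in Ioc 0 T, ∫ x in Ω,
            inner ℝ (k (S (x, t)) • ((P t : Pairs Ω).snd x - g)) ((φ t : Pairs Ω).snd x)) ∧
    (∀ ξ : EuclideanSpace ℝ (Fin d) × ℝ → ℝ, MemLp ξ 2 (volume.restrict (Q Ω T)) →
      ∫ z in Q Ω T, v' z * ξ z
        = ∫ z in Q Ω T, Phi pci pcd b τ (b (p z)) (S z + b (p z)) * ξ z)

/-- `[ζ]₊`. -/
def posPart (ζ : ℝ) : ℝ := max ζ 0

end

end EPH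

namespace EPH

/-!
Put `u = b(p)` and `v = S + u`, so that `τ ∂ₜv = I - D` with the imbibition deficit
`I = [ρⁱ(v) - u]₊` and the drainage excess `D = [u - ρᵈ(v)]₊`, at most one of which is nonzero.
Testing the flux equation with `p` itself gives an energy balance which bounds `-∫∫ ∂ₜv p` from
above. On the other hand let `w_M(v)` be the pressure on the imbibition curve at `v`, truncated at
the level `M`: it is monotone in `v`, so `∫∫ ∂ₜv w_M(v)` is the increment of a convex entropy,
which is bounded uniformly in `M` because `v` stays in `(U_M, 1 + U_M)`. Hence
`-∫∫ ∂ₜv (p - w_M(v)) = τ⁻¹ ∫∫ (D - I) (p - w_M(v))` is bounded above. Since `b` is nondecreasing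
and Lipschitz, `p - w_M(v)` is at least a multiple of `D` where `D > 0` and at most minus a multiple
of `I` where `I > 0`, unless the truncation is active. Letting `M → ∞` bounds `τ⁻¹ ∫∫ (D² + I²)`.

The chain rules in time all come from one abstract subgradient inequality for curves in a Hilbert
space with a derivative in a weaker dual, obtained by comparing with backward time translates.

Chebyshev's inequality and the continuity of `ρⁱ`, `ρᵈ` give the limit `τ → 0`. When `b` is constant
below `p_c(1)`, the relation between `u` and `v` does not see `p` there. If `g = 0`, testing with a
smooth nondecreasing `β(p)` that vanishes exactly on `[p_c(1), ∞)` makes both sides of the balance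
vanish, hence `∇β(p) = 0` and `p ≥ p_c(1)` by the Poincaré inequality.
-/

/-! ### A single hysteresis curve -/

/-- One of the two capillary pressure curves together with the scanning function. -/
structure IsScanCurve (pc b : ℝ → ℝ) : Prop where
  contDiffOn_pc : ContDiffOn ℝ 1 pc (Ioo 0 1)
  continuousOn_pc : ContinuousOn pc (Ioc 0 1)
  deriv_neg : ∀ s ∈ Ioo (0 : ℝ) 1, deriv pc s < 0
  tendsto_pc : Tendsto pc (𝓝[>] 0) atTop
  contDiff_b : ContDiff ℝ 1 b
  monotone_b : Monotone b
  deriv_b_lt : ∀ s ∈ Ioo (0 : ℝ) 1, 0 < deriv b (pc s) ∧ deriv b (pc s) < -1 / deriv pc s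

theorem CapillaryCurves.isScanCurve_i {pci pcd b : ℝ → ℝ} (h : CapillaryCurves pci pcd)
    (hb : ScanningFunction pci pcd b) : IsScanCurve pci b :=
  ⟨h.contDiff_i, h.cont_i, h.deriv_neg_i, h.tendsto_i, hb.contDiff, hb.mono, hb.bound_i⟩

theorem CapillaryCurves.isScanCurve_d {pci pcd b : ℝ → ℝ} (h : CapillaryCurves pci pcd)
    (hb : ScanningFunction pci pcd b) : IsScanCurve pcd b :=
  ⟨h.contDiff_d, h.cont_d, h.deriv_neg_d, h.tendsto_d, hb.contDiff, hb.mono, hb.bound_d⟩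

/-- The `u`-coordinate of the graph of `rho pc b`, parametrised by the saturation `s`: it is
`b (pc s)` on `(0, 1]`, extended to `ℝ` by the constants `U_M` and `U_m`. -/
noncomputable def curveU (pc b : ℝ → ℝ) (s : ℝ) : ℝ :=
  if s ≤ 0 then UM b else b (pc (min s 1))

/-- The `v`-coordinate of the graph of `rho pc b`, parametrised by the saturation `s = v - u`. -/
noncomputable def curveV (pc b : ℝ → ℝ) (s : ℝ) : ℝ := s + curveU pc b s

namespace IsScanCurve

variable {pc b : ℝ → ℝ} {s q v : ℝ}

theorem strictAntiOn_pc (h : IsScanCurve pc b) : StrictAntiOn pc (Ioc 0 1) :=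
  strictAntiOn_of_deriv_neg (convex_Ioc 0 1) h.continuousOn_pc (by simpa using h.deriv_neg)

theorem pc_one_le (h : IsScanCurve pc b) (hs : s ∈ Ioc (0 : ℝ) 1) : pc 1 ≤ pc s :=
  h.strictAntiOn_pc.antitoneOn hs ⟨one_pos, le_rfl⟩ hs.2

theorem exists_pc_eq (h : IsScanCurve pc b) (hq : pc 1 ≤ q) : ∃ s ∈ Ioc (0 : ℝ) 1, pc s = q := by
  obtain ⟨s₀, hs₀q, hs₀⟩ := ((h.tendsto_pc.eventually (eventually_ge_atTop q)).and
    (Ioo_mem_nhdsGT (one_pos : (0 : ℝ) < 1))).exists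
  obtain ⟨s, hs, rfl⟩ := intermediate_value_Icc' hs₀.2.le
    (h.continuousOn_pc.mono fun x hx => ⟨hs₀.1.trans_le hx.1, hx.2⟩) ⟨hq, hs₀q⟩
  exact ⟨s, ⟨hs₀.1.trans_le hs.1, hs.2⟩, rfl⟩

theorem exists_pc_eq_of_lt (h : IsScanCurve pc b) (hq : pc 1 < q) :
    ∃ s ∈ Ioo (0 : ℝ) 1, pc s = q := by
  obtain ⟨s, hs, rfl⟩ := h.exists_pc_eq hq.le
  exact ⟨s, ⟨hs.1, hs.2.lt_of_ne fun hs1 => hq.ne (by rw [hs1])⟩, rfl⟩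

theorem strictMonoOn_b (h : IsScanCurve pc b) : StrictMonoOn b (Ici (pc 1)) := by
  refine strictMonoOn_of_deriv_pos (convex_Ici _) h.contDiff_b.continuous.continuousOn ?_
  intro q hq
  rw [interior_Ici] at hq
  obtain ⟨s, hs, rfl⟩ := h.exists_pc_eq_of_lt hq
  exact (h.deriv_b_lt s hs).1

theorem continuousOn_id_add_b_pc (h : IsScanCurve pc b) :
    ContinuousOn (fun s => s + b (pc s)) (Ioc 0 1) :=
  continuousOn_id.add (h.contDiff_b.continuous.comp_continuousOn h.continuousOn_pc)

theorem strictMonoOn_id_add_b_pc (h : IsScanCurve pc b) :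
    StrictMonoOn (fun s => s + b (pc s)) (Ioc 0 1) := by
  refine strictMonoOn_of_deriv_pos (convex_Ioc 0 1) h.continuousOn_id_add_b_pc fun s hs => ?_
  rw [interior_Ioc] at hs
  have hasDeriv_pc : HasDerivAt pc (deriv pc s) s :=
    ((h.contDiffOn_pc.differentiableOn one_ne_zero s hs).differentiableAt
      (isOpen_Ioo.mem_nhds hs)).hasDerivAt
  have hasDeriv_b : HasDerivAt b (deriv b (pc s)) (pc s) :=
    (h.contDiff_b.differentiable one_ne_zero _).hasDerivAt
  have hasDeriv : HasDerivAt (fun s => s + b (pc s)) (1 + deriv b (pc s) * deriv pc s) s :=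
    (hasDerivAt_id s).add (hasDeriv_b.comp s hasDeriv_pc)
  have slope_gt := (h.deriv_b_lt s hs).2
  rw [lt_div_iff_of_neg (h.deriv_neg s hs)] at slope_gt
  rw [hasDeriv.deriv]
  linarith

theorem tendsto_b (h : IsScanCurve pc b) : Tendsto b atTop (𝓝 (UM b)) := by
  rcases tendsto_atTop_of_monotone h.monotone_b with b_atTop | ⟨l, hl⟩
  · exfalso
    obtain ⟨q, hbq, hq⟩ := ((b_atTop.eventually (eventually_gt_atTop (1 + b (pc 1)))).and
      (eventually_ge_atTop (pc 1))).exists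
    obtain ⟨s, hs, rfl⟩ := h.exists_pc_eq hq
    have : s + b (pc s) ≤ 1 + b (pc 1) :=
      h.strictMonoOn_id_add_b_pc.monotoneOn hs ⟨one_pos, le_rfl⟩ hs.2
    linarith [hs.1]
  · rwa [UM, hl.limUnder_eq]

theorem b_lt_UM (h : IsScanCurve pc b) (q : ℝ) : b q < UM b := by
  calc b q ≤ b (max q (pc 1)) := h.monotone_b (le_max_left _ _)
    _ < b (max q (pc 1) + 1) :=
      h.strictMonoOn_b (mem_Ici.2 (le_max_right _ _))
        (mem_Ici.2 ((le_max_right _ _).trans (lt_add_one _).le)) (lt_add_one _)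
    _ ≤ UM b := h.monotone_b.ge_of_tendsto h.tendsto_b _

theorem tendsto_id_add_b_pc (h : IsScanCurve pc b) :
    Tendsto (fun s => s + b (pc s)) (𝓝[>] 0) (𝓝 (UM b)) := by
  have tendsto_id_zero : Tendsto (fun s : ℝ => s) (𝓝[>] 0) (𝓝 0) :=
    tendsto_id.mono_left nhdsWithin_le_nhds
  simpa using tendsto_id_zero.add (h.tendsto_b.comp h.tendsto_pc)

theorem UM_lt_add_b_pc (h : IsScanCurve pc b) (hs : s ∈ Ioc (0 : ℝ) 1) :
    UM b < s + b (pc s) := by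
  have half_mem : s / 2 ∈ Ioc (0 : ℝ) 1 := ⟨half_pos hs.1, by linarith [hs.1, hs.2]⟩
  calc UM b ≤ s / 2 + b (pc (s / 2)) := by
        refine le_of_tendsto h.tendsto_id_add_b_pc ?_
        filter_upwards [Ioo_mem_nhdsGT half_mem.1] with t ht
        exact h.strictMonoOn_id_add_b_pc.monotoneOn ⟨ht.1, ht.2.le.trans half_mem.2⟩ half_mem
          ht.2.le
    _ < s + b (pc s) := h.strictMonoOn_id_add_b_pc half_mem hs (half_lt_self hs.1)

theorem UM_lt_VM (h : IsScanCurve pc b) : UM b < VM pc b := h.UM_lt_add_b_pc ⟨one_pos, le_rfl⟩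

theorem curveU_of_nonpos (hs : s ≤ 0) : curveU pc b s = UM b := if_pos hs

theorem curveU_of_mem (hs : s ∈ Ioc (0 : ℝ) 1) : curveU pc b s = b (pc s) := by
  rw [curveU, if_neg hs.1.not_ge, min_eq_left hs.2]

theorem curveU_of_one_le (hs : 1 ≤ s) : curveU pc b s = Um pc b := by
  rw [curveU, if_neg (by linarith), min_eq_right hs, Um]

theorem antitone_curveU (h : IsScanCurve pc b) : Antitone (curveU pc b) := by
  intro s t hst
  unfold curveU
  split_ifs with ht hs hs
  · exact le_rfl
  · linarith
  · exact (h.b_lt_UM _).le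
  · exact h.monotone_b (h.strictAntiOn_pc.antitoneOn ⟨by simpa using hs, min_le_right _ _⟩
      ⟨by simpa using ht, min_le_right _ _⟩ (min_le_min_right 1 hst))

theorem strictMono_curveV (h : IsScanCurve pc b) : StrictMono (curveV pc b) := by
  intro s t hst
  rcases le_or_gt t 0 with ht | ht
  · rw [curveV, curveV, curveU_of_nonpos ht, curveU_of_nonpos (hst.le.trans ht)]
    linarith
  have ht' : min t 1 ∈ Ioc (0 : ℝ) 1 := ⟨lt_min ht one_pos, min_le_right _ _⟩
  rcases le_or_gt s 0 with hs | hs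
  · rw [curveV, curveV, curveU_of_nonpos hs, curveU, if_neg ht.not_ge]
    linarith [h.UM_lt_add_b_pc ht', min_le_left t 1]
  rw [curveV, curveV, curveU, curveU, if_neg ht.not_ge, if_neg hs.not_ge]
  rcases le_or_gt 1 s with hs1 | hs1
  · rw [min_eq_right hs1, min_eq_right (hs1.trans hst.le)]
    linarith
  · rw [min_eq_left hs1.le]
    have := h.strictMonoOn_id_add_b_pc ⟨hs, hs1.le⟩ ht' (lt_min hst hs1)
    dsimp only at this
    linarith [min_le_left t 1]

theorem surjective_curveV (h : IsScanCurve pc b) : Function.Surjective (curveV pc b) := by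
  intro v
  rcases le_or_gt v (UM b) with hv | hv
  · exact ⟨v - UM b, by rw [curveV, curveU_of_nonpos (by linarith)]; ring⟩
  rcases le_or_gt (VM pc b) v with hv' | hv'
  · exact ⟨v - Um pc b, by rw [curveV, curveU_of_one_le (by linarith [VM.eq_1 pc b])]; ring⟩
  obtain ⟨s₀, hs₀v, hs₀⟩ := ((h.tendsto_id_add_b_pc.eventually (eventually_lt_nhds hv)).and
    (Ioo_mem_nhdsGT (one_pos : (0 : ℝ) < 1))).exists
  obtain ⟨s, hs, rfl⟩ := intermediate_value_Ioo hs₀.2.le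
    (h.continuousOn_id_add_b_pc.mono fun x hx => ⟨hs₀.1.trans_le hx.1, hx.2⟩)
    (⟨hs₀v, hv'⟩ : v ∈ Ioo _ _)
  exact ⟨s, by rw [curveV, curveU_of_mem ⟨hs₀.1.trans hs.1, hs.2.le⟩]⟩

theorem vCurve_b_pc (h : IsScanCurve pc b) (hs : s ∈ Ioc (0 : ℝ) 1) :
    vCurve pc b (b (pc s)) = s + b (pc s) := by
  rw [vCurve, h.strictMonoOn_b.injOn.leftInvOn_invFunOn (h.pc_one_le hs),
    h.strictAntiOn_pc.injOn.leftInvOn_invFunOn hs]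

theorem exists_b_pc_eq (h : IsScanCurve pc b) {u : ℝ} (hu : u ∈ Ioo (Um pc b) (UM b)) :
    ∃ s ∈ Ioc (0 : ℝ) 1, b (pc s) = u := by
  obtain ⟨q₁, hq₁⟩ := (h.tendsto_b.eventually (eventually_gt_nhds hu.2)).exists
  have one_lt : pc 1 < q₁ := h.monotone_b.reflect_lt (hu.1.trans hq₁)
  obtain ⟨q, hq, rfl⟩ := intermediate_value_Ioo one_lt.le h.contDiff_b.continuous.continuousOn
    (⟨hu.1, hq₁⟩ : u ∈ Ioo _ _)
  obtain ⟨s, hs, rfl⟩ := h.exists_pc_eq hq.1.le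
  exact ⟨s, hs, rfl⟩

theorem rho_of_le (hv : v ≤ UM b) : rho pc b v = UM b := if_pos hv

theorem rho_of_ge (h : IsScanCurve pc b) (hv : VM pc b ≤ v) : rho pc b v = Um pc b := by
  rw [rho, if_neg (h.UM_lt_VM.trans_le hv).not_ge, if_pos hv]

theorem rho_add_b_pc (h : IsScanCurve pc b) (hs : s ∈ Ioc (0 : ℝ) 1) :
    rho pc b (s + b (pc s)) = b (pc s) := by
  rcases hs.2.eq_or_lt with rfl | hs1
  · exact h.rho_of_ge le_rfl
  have hv : s + b (pc s) < VM pc b := h.strictMonoOn_id_add_b_pc hs ⟨one_pos, le_rfl⟩ hs1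
  have one_lt : pc 1 < pc s := h.strictAntiOn_pc hs ⟨one_pos, le_rfl⟩ hs1
  have exists_vCurve : ∃ u ∈ Ioo (Um pc b) (UM b), vCurve pc b u = s + b (pc s) :=
    ⟨b (pc s), ⟨h.strictMonoOn_b (mem_Ici.2 le_rfl) one_lt.le one_lt, h.b_lt_UM _⟩,
      h.vCurve_b_pc hs⟩
  rw [rho, if_neg (h.UM_lt_add_b_pc hs).not_ge, if_neg hv.not_ge]
  obtain ⟨t, ht, htu⟩ := h.exists_b_pc_eq (Function.invFunOn_mem exists_vCurve)
  have vCurve_t := Function.invFunOn_eq exists_vCurve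
  rw [← htu, h.vCurve_b_pc ht] at vCurve_t
  rw [← htu, h.strictMonoOn_id_add_b_pc.injOn ht hs vCurve_t]

theorem rho_curveV (h : IsScanCurve pc b) (s : ℝ) : rho pc b (curveV pc b s) = curveU pc b s := by
  rcases le_or_gt s 0 with hs | hs
  · rw [curveV, curveU_of_nonpos hs, rho_of_le (by linarith)]
  rcases le_or_gt 1 s with hs1 | hs1
  · rw [curveV, curveU_of_one_le hs1, h.rho_of_ge (by rw [VM]; linarith)]
  · rw [curveV, curveU_of_mem ⟨hs, hs1.le⟩, h.rho_add_b_pc ⟨hs, hs1.le⟩]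

theorem curveV_sub_rho (h : IsScanCurve pc b) (s : ℝ) :
    curveV pc b s - rho pc b (curveV pc b s) = s := by
  rw [h.rho_curveV, curveV]
  ring

theorem strictMono_sub_rho (h : IsScanCurve pc b) : StrictMono fun v => v - rho pc b v := by
  refine h.surjective_curveV.forall₂.2 fun s t hst => ?_
  simp only [h.curveV_sub_rho]
  exact h.strictMono_curveV.lt_iff_lt.1 hst

theorem continuous_rho (h : IsScanCurve pc b) : Continuous (rho pc b) := by
  have continuous_sub_rho : Continuous fun v => v - rho pc b v :=
    h.strictMono_sub_rho.monotone.continuous_of_surjective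
      fun s => ⟨curveV pc b s, h.curveV_sub_rho s⟩
  exact (continuous_id.sub continuous_sub_rho).congr fun v => sub_sub_cancel _ _

theorem antitone_rho (h : IsScanCurve pc b) : Antitone (rho pc b) := by
  refine h.surjective_curveV.forall₂.2 fun s t hst => ?_
  simp only [h.rho_curveV]
  exact h.antitone_curveU (h.strictMono_curveV.le_iff_le.1 hst)

theorem rho_le_UM (h : IsScanCurve pc b) (v : ℝ) : rho pc b v ≤ UM b :=
  (h.antitone_rho (min_le_left v (UM b))).trans_eq (rho_of_le (min_le_right _ _))

theorem Um_le_rho (h : IsScanCurve pc b) (v : ℝ) : Um pc b ≤ rho pc b v :=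
  (h.rho_of_ge (le_max_right v (VM pc b))).symm.trans_le (h.antitone_rho (le_max_left _ _))

theorem exists_add_b_pc_eq (h : IsScanCurve pc b) (hv : UM b < v) (hv' : v ≤ VM pc b) :
    ∃ s ∈ Ioc (0 : ℝ) 1, s + b (pc s) = v ∧ rho pc b v = b (pc s) := by
  obtain ⟨s, rfl⟩ := h.surjective_curveV v
  have pos : 0 < s := by
    by_contra! hs
    rw [curveV, curveU_of_nonpos hs] at hv
    linarith
  have le_one : s ≤ 1 := by
    by_contra! hs
    rw [curveV, curveU_of_one_le hs.le, VM] at hv'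
    linarith
  rw [h.rho_curveV, curveV, curveU_of_mem ⟨pos, le_one⟩]
  exact ⟨s, ⟨pos, le_one⟩, rfl, rfl⟩

theorem le_pc_of_b_le_rho (h : IsScanCurve pc b) (hs : s ∈ Ioc (0 : ℝ) 1)
    (hq : b q ≤ rho pc b (s + b q)) : q ≤ pc s := by
  by_contra! pc_lt
  have b_lt := h.strictMonoOn_b (h.pc_one_le hs) ((h.pc_one_le hs).trans pc_lt.le) pc_lt
  have rho_le := h.antitone_rho (show s + b (pc s) ≤ s + b q by linarith)
  rw [h.rho_add_b_pc hs] at rho_le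
  linarith

theorem b_pc_le_of_rho_le (h : IsScanCurve pc b) (hs : s ∈ Ioc (0 : ℝ) 1)
    (hq : rho pc b (s + b q) ≤ b q) : b (pc s) ≤ b q := by
  by_contra! b_lt
  have rho_le := h.antitone_rho (show s + b q ≤ s + b (pc s) by linarith)
  rw [h.rho_add_b_pc hs] at rho_le
  linarith

theorem pc_le_of_rho_le (h : IsScanCurve pc b) (hs : s ∈ Ioo (0 : ℝ) 1)
    (hq : rho pc b (s + b q) ≤ b q) : pc s ≤ q := by
  have hs' : s ∈ Ioc (0 : ℝ) 1 := ⟨hs.1, hs.2.le⟩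
  have one_lt : pc 1 < pc s := h.strictAntiOn_pc hs' ⟨one_pos, le_rfl⟩ hs.2
  by_contra! q_lt
  have b_lt : b (max q (pc 1)) < b (pc s) :=
    h.strictMonoOn_b (mem_Ici.2 (le_max_right _ _)) one_lt.le (max_lt q_lt one_lt)
  linarith [h.monotone_b (le_max_left q (pc 1)), h.b_pc_le_of_rho_le hs' hq]

theorem saturation_pos (h : IsScanCurve pc b) (hs : 0 ≤ s) (hq : rho pc b (s + b q) ≤ b q) :
    0 < s := by
  refine hs.lt_of_ne ?_
  rintro rfl
  rw [rho_of_le (by linarith [h.b_lt_UM q])] at hq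
  exact hq.not_gt (h.b_lt_UM q)

end IsScanCurve

theorem rho_i_le_rho_d {pci pcd b : ℝ → ℝ} (hpc : CapillaryCurves pci pcd)
    (hb : ScanningFunction pci pcd b) (v : ℝ) : rho pci b v ≤ rho pcd b v := by
  have hi := hpc.isScanCurve_i hb
  have hd := hpc.isScanCurve_d hb
  have Um_eq : Um pci b = Um pcd b := by rw [Um, Um, hpc.eq_one]
  have VM_eq : VM pci b = VM pcd b := by rw [VM, VM, Um_eq]
  rcases le_or_gt v (UM b) with hv | hv
  · rw [IsScanCurve.rho_of_le hv, IsScanCurve.rho_of_le hv]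
  rcases le_or_gt (VM pci b) v with hv' | hv'
  · rw [hi.rho_of_ge hv', hd.rho_of_ge (VM_eq ▸ hv'), Um_eq]
  obtain ⟨s, hs, hsv, rho_eq_s⟩ := hi.exists_add_b_pc_eq hv hv'.le
  obtain ⟨t, ht, htv, rho_eq_t⟩ := hd.exists_add_b_pc_eq hv (VM_eq ▸ hv'.le)
  have pc_le : pci s ≤ pcd s := by
    rcases hs.2.eq_or_lt with rfl | hs1
    · exact hpc.eq_one.le
    · exact (hpc.lt s ⟨hs.1, hs1⟩).le
  have t_le : t ≤ s := by
    refine (hd.strictMonoOn_id_add_b_pc.le_iff_le ht hs).1 ?_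
    linarith [hb.mono pc_le]
  linarith

/-! ### A chain rule inequality along curves in a Hilbert space -/

section Subgradient

variable {H : Type*} [NormedAddCommGroup H] [InnerProductSpace ℝ H]
  {X : Type*} [NormedAddCommGroup X] [NormedSpace ℝ X]

section Pairing

variable {α : Type*} [MeasurableSpace α] {μ : Measure α} {U : α → StrongDual ℝ X} {W : α → X}

theorem aestronglyMeasurable_dual_apply (hU : AEStronglyMeasurable U μ)
    (hW : AEStronglyMeasurable W μ) : AEStronglyMeasurable (fun a => U a (W a)) μ :=
  isBoundedBilinearMap_apply.continuous.comp_aestronglyMeasurable (hU.prodMk hW)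

theorem integrable_dual_apply (hU : MemLp U 2 μ) (hW : MemLp W 2 μ) :
    Integrable (fun a => U a (W a)) μ :=
  (hU.norm.integrable_mul hW.norm).mono' (aestronglyMeasurable_dual_apply hU.1 hW.1)
    (Eventually.of_forall fun a => (U a).le_opNorm (W a))

end Pairing

section Translation

variable {U : ℝ → StrongDual ℝ X} {W : ℝ → X}

theorem tendsto_integral_dual_translate (hU : MemLp U 2 volume) (hW : MemLp W 2 volume) :
    Tendsto (fun s => ∫ r, U r (W (s + r))) (𝓝 0) (𝓝 (∫ r, U r (W r))) := by
  have translate : ∀ s : ℝ, MeasurePreserving (fun r : ℝ => s + r) volume volume :=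
    fun s => measurePreserving_add_left volume s
  let shift : ℝ → C(ℝ, ℝ) := (ContinuousMap.mk (fun z : ℝ × ℝ => z.1 + z.2) (by fun_prop)).curry
  let translateW (s : ℝ) : Lp X 2 volume :=
    Lp.compMeasurePreserving (shift s) (translate s) (hW.toLp W)
  have continuous_translateW : Continuous translateW :=
    continuous_const.compMeasurePreservingLp (ContinuousMap.continuous _) translate
      ENNReal.ofNat_ne_top
  let pairing : StrongDual ℝ X →L[ℝ] X →L[ℝ] ℝ := ContinuousLinearMap.id ℝ (StrongDual ℝ X)
  have continuous_pairing : Continuous fun s : ℝ =>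
      pairing.lpPairing volume 2 2 (hU.toLp U) (translateW s) := by fun_prop
  have pairing_eq : ∀ s : ℝ,
      pairing.lpPairing volume 2 2 (hU.toLp U) (translateW s) = ∫ r, U r (W (s + r)) := by
    intro s
    rw [ContinuousLinearMap.lpPairing_eq_integral]
    refine integral_congr_ae ?_
    filter_upwards [hU.coeFn_toLp, Lp.coeFn_compMeasurePreserving (hW.toLp W) (translate s),
      (translate s).quasiMeasurePreserving.ae_eq_comp hW.coeFn_toLp] with r hUr hWr hWsr
    have translateW_apply : (translateW s : ℝ → X) r = W (s + r) := hWr.trans hWsr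
    rw [hUr, translateW_apply]
    rfl
  simp only [pairing_eq] at continuous_pairing
  simpa using continuous_pairing.tendsto 0

theorem integrable_dual_translate (hU : MemLp U 2 volume) (hW : MemLp W 2 volume) (h : ℝ) :
    Integrable (fun z : ℝ × ℝ => U (-z.1 + z.2) (W z.2))
      ((volume.restrict (Ioc 0 h)).prod volume) := by
  set ν : Measure (ℝ × ℝ) := (volume.restrict (Ioc 0 h)).prod volume
  have shear : MeasurePreserving (fun z : ℝ × ℝ => (z.1, -z.1 + z.2)) ν ν :=
    measurePreserving_prod_neg_add _ _
  have integrable_U : Integrable (fun z : ℝ × ℝ => ‖U (-z.1 + z.2)‖ ^ 2) ν :=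
    shear.integrable_comp_of_integrable (hU.norm.integrable_sq.comp_snd _)
  have integrable_W : Integrable (fun z : ℝ × ℝ => ‖W z.2‖ ^ 2) ν :=
    hW.norm.integrable_sq.comp_snd _
  refine (integrable_U.add integrable_W).mono' (aestronglyMeasurable_dual_apply
    (hU.1.comp_snd.comp_measurePreserving shear) hW.1.comp_snd) (Eventually.of_forall fun z => ?_)
  refine ((U (-z.1 + z.2)).le_opNorm (W z.2)).trans ?_
  simp only [Pi.add_apply]
  nlinarith [two_mul_le_add_sq ‖U (-z.1 + z.2)‖ ‖W z.2‖, sq_nonneg ‖U (-z.1 + z.2)‖,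
    sq_nonneg ‖W z.2‖]

theorem integral_dual_translate_eq (s : ℝ) :
    ∫ r, U r (W (s + r)) = ∫ t, U (-s + t) (W t) := by
  rw [← integral_add_left_eq_self (fun t => U (-s + t) (W t)) s]
  simp only [neg_add_cancel_left]

theorem integrableOn_integral_dual_translate (hU : MemLp U 2 volume) (hW : MemLp W 2 volume)
    (h : ℝ) : IntegrableOn (fun s => ∫ r, U r (W (s + r))) (Ioc 0 h) := by
  simp only [integral_dual_translate_eq]
  exact (integrable_dual_translate hU hW h).integral_prod_left

theorem integral_integral_dual_translate (hU : MemLp U 2 volume) (hW : MemLp W 2 volume) (h : ℝ) :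
    ∫ s in Ioc 0 h, ∫ r, U r (W (s + r)) = ∫ t, ∫ s in Ioc 0 h, U (-s + t) (W t) := by
  simp only [integral_dual_translate_eq]
  exact integral_integral_swap (integrable_dual_translate hU hW h)

end Translation

theorem le_of_forall_mul_le_integral {f : ℝ → ℝ} {c l T : ℝ} (hT : 0 < T)
    (hf : Tendsto f (𝓝 0) (𝓝 l)) (hint : ∀ h, IntegrableOn f (Ioc 0 h))
    (hle : ∀ h ∈ Ioo 0 T, c * h ≤ ∫ s in Ioc 0 h, f s) : c ≤ l := by
  by_contra! lt
  obtain ⟨a, hla, hac⟩ := exists_between lt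
  obtain ⟨δ, δ_pos, hδ⟩ := Metric.eventually_nhds_iff.1 (hf.eventually (eventually_lt_nhds hla))
  obtain ⟨h, h_pos, h_lt⟩ := exists_between (lt_min δ_pos hT)
  have integral_le : ∫ s in Ioc 0 h, f s ≤ ∫ _ in Ioc 0 h, a := by
    refine setIntegral_mono_on (hint h) (by simp) measurableSet_Ioc fun s hs => (hδ ?_).le
    rw [Real.dist_eq, sub_zero, abs_of_pos hs.1]
    exact hs.2.trans_lt (h_lt.trans_le (min_le_left _ _))
  have integral_const : ∫ _ in Ioc 0 h, a = a * h := by simp [h_pos.le, mul_comm]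
  nlinarith [hle h ⟨h_pos, h_lt.trans_le (min_le_right _ _)⟩]

theorem continuous_of_subgradient {α : Type*} [TopologicalSpace α] {y q : α → H} {J : α → ℝ}
    {K : ℝ} (hy : Continuous y) (hq : ∀ t, ‖q t‖ ≤ K)
    (hJ : ∀ s t, J t - J s ≤ inner ℝ (y t - y s) (q t)) : Continuous J := by
  have sub_le : ∀ s t, J t - J s ≤ K * dist (y t) (y s) := fun s t => by
    calc J t - J s ≤ ‖y t - y s‖ * ‖q t‖ := (hJ s t).trans (real_inner_le_norm _ _)
      _ ≤ K * dist (y t) (y s) := by rw [mul_comm, dist_eq_norm]; gcongr; exact hq t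
  refine continuous_iff_continuousAt.2 fun s => ?_
  rw [ContinuousAt, tendsto_iff_dist_tendsto_zero]
  have dist_tendsto : Tendsto (fun t => K * dist (y t) (y s)) (𝓝 s) (𝓝 0) := by
    simpa using (tendsto_iff_dist_tendsto_zero.1 (hy.tendsto s)).const_mul K
  refine squeeze_zero (fun _ => dist_nonneg) (fun t => ?_) dist_tendsto
  rw [Real.dist_eq, abs_sub_le_iff]
  exact ⟨sub_le s t, dist_comm (y s) (y t) ▸ sub_le t s⟩

theorem mul_le_integral_sub_translate {f : ℝ → ℝ} {T m h : ℝ} (hf : Continuous f)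
    (hf₀ : ∀ t ≤ 0, f t = f 0) (hm : ∀ᵐ t ∂volume.restrict (Ioc 0 T), m ≤ f t)
    (hh : h ∈ Ioo 0 T) : (m - f 0) * h ≤ ∫ t in Ioc 0 T, (f t - f (t - h)) := by
  have hT : 0 < T := hh.1.trans hh.2
  have initial : ∫ t in (0 - h)..0, f t = h * f 0 := by
    rw [intervalIntegral.integral_congr (g := fun _ => f 0)]
    · simp
    · intro t ht
      rw [uIcc_of_le (by linarith [hh.1])] at ht
      exact hf₀ t ht.2
  have final : m * h ≤ ∫ t in (T - h)..T, f t := by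
    have integral_const : ∫ _ in (T - h)..T, m = m * h := by simp [mul_comm]
    rw [← integral_const, intervalIntegral.integral_of_le (by linarith [hh.1]),
      intervalIntegral.integral_of_le (by linarith [hh.1])]
    exact setIntegral_mono_ae_restrict (by simp) hf.integrableOn_Ioc
      (ae_restrict_of_ae_restrict_of_subset (Ioc_subset_Ioc_left (by linarith [hh.2])) hm)
  rw [← intervalIntegral.integral_of_le hT.le, intervalIntegral.integral_sub
    (hf.intervalIntegrable _ _)
    (Continuous.intervalIntegrable (by fun_prop) _ _),
    intervalIntegral.integral_comp_sub_right f h,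
    intervalIntegral.integral_interval_sub_interval_comm' (hf.intervalIntegrable _ _)
      (hf.intervalIntegrable _ _) (hf.intervalIntegrable _ _)]
  linarith

/-- The backward difference quotients of `J` are bounded by those of `y` paired with the
subgradient `ι (W t)`, and the latter converge by continuity of translations in `L²`. -/
theorem sub_le_integral_dual_of_subgradient {T : ℝ} (hT : 0 < T) (ι : X →L[ℝ] H) {y : ℝ → H}
    {U : ℝ → StrongDual ℝ X} (hU : MemLp U 2 volume)
    (hyU : ∀ φ s t, inner ℝ (y t - y s) (ι φ) = ∫ r in s..t, U r φ)
    {W : ℝ → X} (hW : MemLp W 2 volume) (hW₀ : ∀ t ∉ Ioc 0 T, W t = 0)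
    {q : ℝ → H} (hWq : ∀ᵐ t ∂volume.restrict (Ioc 0 T), ι (W t) = q t)
    {J : ℝ → ℝ} (hJc : Continuous J) (hJ : ∀ s t, J t - J s ≤ inner ℝ (y t - y s) (q t))
    (hJ₀ : ∀ t ≤ 0, J t = J 0) {m : ℝ} (hm : ∀ᵐ t ∂volume.restrict (Ioc 0 T), m ≤ J t) :
    m - J 0 ≤ ∫ t, U t (W t) := by
  refine le_of_forall_mul_le_integral hT (tendsto_integral_dual_translate hU hW)
    (integrableOn_integral_dual_translate hU hW) fun h hh => ?_
  have integrable_translate : Integrable fun t => ∫ s in Ioc 0 h, U (-s + t) (W t) :=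
    (integrable_dual_translate hU hW h).integral_prod_right
  have translate_eq : ∀ φ t, ∫ s in Ioc 0 h, U (-s + t) φ = inner ℝ (y t - y (t - h)) (ι φ) := by
    intro φ t
    rw [hyU, ← intervalIntegral.integral_of_le hh.1.le]
    simpa only [sub_zero, neg_add_eq_sub] using
      intervalIntegral.integral_comp_sub_left (a := 0) (b := h) (fun r => U r φ) t
  calc (m - J 0) * h ≤ ∫ t in Ioc 0 T, (J t - J (t - h)) :=
        mul_le_integral_sub_translate hJc hJ₀ hm hh
    _ ≤ ∫ t in Ioc 0 T, ∫ s in Ioc 0 h, U (-s + t) (W t) := by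
        refine setIntegral_mono_ae_restrict (Continuous.integrableOn_Ioc (by fun_prop))
          integrable_translate.integrableOn ?_
        filter_upwards [hWq] with t ht
        rw [translate_eq, ht]
        exact hJ _ _
    _ = ∫ t, ∫ s in Ioc 0 h, U (-s + t) (W t) :=
        setIntegral_eq_integral_of_forall_compl_eq_zero fun t ht => by simp [hW₀ t ht]
    _ = ∫ s in Ioc 0 h, ∫ r, U r (W (s + r)) := (integral_integral_dual_translate hU hW h).symm

theorem intervalIntegral_indicator_Ioc {E : Type*} [NormedAddCommGroup E] [NormedSpace ℝ E]
    {T : ℝ} (hT : 0 ≤ T) (f : ℝ → E) (t : ℝ) :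
    ∫ r in 0..t, (Ioc 0 T).indicator f r = ∫ r in Ioc 0 (projIcc 0 T hT t : ℝ), f r := by
  rw [coe_projIcc]
  rcases le_total t 0 with ht | ht
  · rw [intervalIntegral.integral_of_ge ht, setIntegral_eq_zero_of_forall_eq_zero fun r hr =>
      indicator_of_notMem (fun h => h.1.not_ge hr.2) f,
      max_eq_left ((min_le_right _ _).trans ht), Ioc_self, setIntegral_empty, neg_zero]
  · rw [intervalIntegral.integral_of_le ht, setIntegral_indicator measurableSet_Ioc,
      Ioc_inter_Ioc, max_self, max_eq_right (le_min hT ht), min_comm]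

/-- Stated for a normed group only: on dual spaces, unification with
`memLp_indicator_iff_restrict` is too slow. -/
theorem memLp_indicator_of_restrict {α F : Type*} [MeasurableSpace α] {μ : Measure α}
    [NormedAddCommGroup F] {p : ENNReal} {s : Set α} {f : α → F} (hs : MeasurableSet s)
    (hf : MemLp f p (μ.restrict s)) : MemLp (s.indicator f) p μ :=
  (memLp_indicator_iff_restrict hs).2 hf

theorem inner_sub_projIcc_eq_integral {T : ℝ} (hT : 0 ≤ T) (ι : X →L[ℝ] H) {y : ℝ → H}
    {U : ℝ → StrongDual ℝ X} (hU : MemLp U 2 (volume.restrict (Ioc 0 T)))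
    (hyU : ∀ φ, ∀ t ∈ Icc 0 T, inner ℝ (y t - y 0) (ι φ) = ∫ r in Ioc 0 t, U r φ)
    (φ : X) (s t : ℝ) :
    inner ℝ (y (projIcc 0 T hT t) - y (projIcc 0 T hT s)) (ι φ)
      = ∫ r in s..t, (Ioc 0 T).indicator U r φ := by
  have indicator_apply (r : ℝ) :
      (Ioc 0 T).indicator U r φ = (Ioc 0 T).indicator (fun r => U r φ) r := by
    by_cases hr : r ∈ Ioc 0 T <;> simp [hr]
  have integrable : Integrable ((Ioc 0 T).indicator fun r => U r φ) :=
    IntegrableOn.integrable_indicator (integrable_dual_apply hU (memLp_const φ)) measurableSet_Ioc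
  have from_zero (t : ℝ) : ∫ r in 0..t, (Ioc 0 T).indicator (fun r => U r φ) r
      = inner ℝ (y (projIcc 0 T hT t) - y 0) (ι φ) := by
    rw [hyU φ _ (projIcc 0 T hT t).2, intervalIntegral_indicator_Ioc hT]
  simp only [indicator_apply]
  rw [← intervalIntegral.integral_interval_sub_left (a := 0) integrable.intervalIntegrable
    integrable.intervalIntegrable, from_zero, from_zero, ← inner_sub_left,
    sub_sub_sub_cancel_right]

theorem sub_le_integral_of_subgradient {T : ℝ} (hT : 0 < T) (ι : X →L[ℝ] H)
    {y : ℝ → H} (hy : ContinuousOn y (Icc 0 T))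
    {U : ℝ → StrongDual ℝ X} (hU : MemLp U 2 (volume.restrict (Ioc 0 T)))
    (hyU : ∀ φ, ∀ t ∈ Icc 0 T, inner ℝ (y t - y 0) (ι φ) = ∫ r in Ioc 0 t, U r φ)
    {W : ℝ → X} (hW : MemLp W 2 (volume.restrict (Ioc 0 T)))
    {q : ℝ → H} {K : ℝ} (hq : ∀ t ∈ Icc 0 T, ‖q t‖ ≤ K)
    (hWq : ∀ᵐ t ∂volume.restrict (Ioc 0 T), ι (W t) = q t)
    {J : ℝ → ℝ} (hJ : ∀ s ∈ Icc 0 T, ∀ t ∈ Icc 0 T, J t - J s ≤ inner ℝ (y t - y s) (q t))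
    {m : ℝ} (hm : ∀ᵐ t ∂volume.restrict (Ioc 0 T), m ≤ J t) :
    m - J 0 ≤ ∫ t in Ioc 0 T, U t (W t) := by
  let clamp (t : ℝ) : ℝ := projIcc 0 T hT.le t
  have clamp_mem (t : ℝ) : clamp t ∈ Icc 0 T := (projIcc 0 T hT.le t).2
  have clamp_of_mem {t : ℝ} (ht : t ∈ Icc 0 T) : clamp t = t := by simp [clamp, projIcc_of_mem _ ht]
  have clamp_of_nonpos {t : ℝ} (ht : t ≤ 0) : clamp t = 0 := by
    simp [clamp, projIcc_of_le_left _ ht]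
  have continuous_y : Continuous (y ∘ clamp) := hy.comp_continuous (by fun_prop) clamp_mem
  have hJ' (s t : ℝ) : (J ∘ clamp) t - (J ∘ clamp) s
      ≤ inner ℝ ((y ∘ clamp) t - (y ∘ clamp) s) ((q ∘ clamp) t) :=
    hJ _ (clamp_mem s) _ (clamp_mem t)
  have on_line : m - (J ∘ clamp) 0
      ≤ ∫ t, (Ioc 0 T).indicator U t ((Ioc 0 T).indicator W t) := by
    refine sub_le_integral_dual_of_subgradient hT ι
      (memLp_indicator_of_restrict measurableSet_Ioc hU)
      (inner_sub_projIcc_eq_integral hT.le ι hU hyU)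
      (memLp_indicator_of_restrict measurableSet_Ioc hW)
      (fun t ht => indicator_of_notMem ht W) ?_
      (continuous_of_subgradient continuous_y (fun t => hq _ (clamp_mem t)) hJ') hJ'
      (fun t ht => by simp only [Function.comp_apply, clamp_of_nonpos, ht, le_refl]) ?_
    · filter_upwards [hWq, ae_restrict_mem measurableSet_Ioc] with t ht htT
      rw [indicator_of_mem htT, ht, Function.comp_apply, clamp_of_mem (Ioc_subset_Icc_self htT)]
    · filter_upwards [hm, ae_restrict_mem measurableSet_Ioc] with t ht htT
      rwa [Function.comp_apply, clamp_of_mem (Ioc_subset_Icc_self htT)]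
  rw [Function.comp_apply, clamp_of_nonpos le_rfl] at on_line
  refine on_line.trans_eq ?_
  rw [← integral_indicator measurableSet_Ioc]
  refine integral_congr_ae (Eventually.of_forall fun t => ?_)
  by_cases ht : t ∈ Ioc 0 T <;> simp [ht]

end Subgradient

/-! ### The fundamental theorem of calculus for weak derivatives -/

section WeakDeriv

variable {a b : ℝ}

theorem exists_Icc_superset_tsupport (hab : a < b) {η : ℝ → ℝ} (hη : HasCompactSupport η)
    (hηab : tsupport η ⊆ Ioo a b) :
    ∃ c d, a < c ∧ c ≤ d ∧ d < b ∧ Function.support η ⊆ Icc c d := by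
  rcases (tsupport η).eq_empty_or_nonempty with h | h
  · obtain ⟨c, hac, hcb⟩ := exists_between hab
    exact ⟨c, c, hac, le_rfl, hcb, by simp [tsupport_eq_empty_iff.1 h]⟩
  · obtain ⟨c, hc, hcle⟩ := IsCompact.exists_isLeast hη h
    obtain ⟨d, hd, hled⟩ := IsCompact.exists_isGreatest hη h
    exact ⟨c, d, (hηab hc).1, hcle hd, (hηab hd).2,
      (subset_tsupport η).trans fun t ht => ⟨hcle ht, hled ht⟩⟩

theorem exists_deriv_eq_of_integral_eq_zero (hab : a < b) {η : ℝ → ℝ} (hη : ContDiff ℝ ∞ η)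
    (hη_supp : HasCompactSupport η) (hηab : tsupport η ⊆ Ioo a b) (hη_zero : ∫ t, η t = 0) :
    ∃ θ : ℝ → ℝ, ContDiff ℝ ∞ θ ∧ HasCompactSupport θ ∧ tsupport θ ⊆ Ioo a b ∧ deriv θ = η := by
  obtain ⟨c, d, hac, -, hdb, hsub⟩ := exists_Icc_superset_tsupport hab hη_supp hηab
  set θ : ℝ → ℝ := fun t => ∫ r in Iic t, η r
  have hint : Integrable η := hη.continuous.integrable_of_hasCompactSupport hη_supp
  have hθ' (t : ℝ) : HasDerivAt θ (η t) t := by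
    have heq : θ = fun t => (∫ r in Iic c, η r) + ∫ r in c..t, η r := funext fun t => by
      rw [← intervalIntegral.integral_Iic_sub_Iic hint.integrableOn hint.integrableOn,
        add_sub_cancel]
    rw [heq]
    exact (hη.continuous.integral_hasStrictDerivAt c t).hasDerivAt.const_add _
  have hderiv : deriv θ = η := funext fun t => (hθ' t).deriv
  have hθ_supp : Function.support θ ⊆ Icc c d := by
    intro t ht
    by_contra hmem
    refine ht ?_
    rcases lt_or_ge t c with htc | htc
    · refine setIntegral_eq_zero_of_forall_eq_zero fun r hr => ?_
      exact Function.notMem_support.1 fun h => ((hsub h).1.trans hr).not_gt htc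
    · have hdt : d < t := not_le.1 fun h => hmem ⟨htc, h⟩
      rw [← hη_zero]
      refine setIntegral_eq_integral_of_forall_compl_eq_zero fun r hr => ?_
      exact Function.notMem_support.1 fun h => hr ((hsub h).2.trans hdt.le)
  refine ⟨θ, ?_, .of_support_subset_isCompact isCompact_Icc hθ_supp,
    (closure_minimal hθ_supp isClosed_Icc).trans (Icc_subset_Ioo hac hdb), hderiv⟩
  exact contDiff_infty_iff_deriv.2 ⟨fun t => (hθ' t).differentiableAt, hderiv ▸ hη⟩

theorem exists_bump_integral_eq_one (hab : a < b) :
    ∃ χ : ℝ → ℝ, ContDiff ℝ ∞ χ ∧ HasCompactSupport χ ∧ tsupport χ ⊆ Ioo a b ∧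
      ∫ t, χ t = 1 := by
  let f : ContDiffBump ((a + b) / 2) :=
    ⟨(b - a) / 8, (b - a) / 4, by linarith, by linarith⟩
  refine ⟨f.normed volume, f.contDiff_normed, f.hasCompactSupport_normed, ?_, f.integral_normed⟩
  rw [f.tsupport_normed_eq, Real.closedBall_eq_Icc]
  exact Icc_subset_Ioo (by simp only [f]; linarith) (by simp only [f]; linarith)

theorem eqOn_const_of_forall_integral_deriv_mul_eq_zero (hab : a < b) {w : ℝ → ℝ}
    (hw : ContinuousOn w (Icc a b))
    (h : ∀ θ : ℝ → ℝ, ContDiff ℝ ∞ θ → HasCompactSupport θ → tsupport θ ⊆ Ioo a b →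
      ∫ t in Ioc a b, deriv θ t * w t = 0) :
    ∃ c, EqOn w (fun _ => c) (Icc a b) := by
  obtain ⟨χ, hχ, hχ_supp, hχab, hχ_one⟩ := exists_bump_integral_eq_one hab
  set c := ∫ t in Ioc a b, χ t * w t
  have mul_integrable {ζ : ℝ → ℝ} (hζ : Continuous ζ) :
      IntegrableOn (fun t => ζ t * w t) (Ioc a b) :=
    ((hζ.continuousOn.mul hw).integrableOn_Icc).mono_set Ioc_subset_Icc_self
  have setIntegral_eq {ζ : ℝ → ℝ} (hζab : tsupport ζ ⊆ Ioo a b) (y : ℝ → ℝ) :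
      ∫ t in Ioc a b, ζ t * y t = ∫ t, ζ t * y t :=
    setIntegral_eq_integral_of_forall_compl_eq_zero fun t ht => by
      rw [image_eq_zero_of_notMem_tsupport fun h => ht (Ioo_subset_Ioc_self (hζab h)), zero_mul]
  have key (η : ℝ → ℝ) (hη : ContDiff ℝ ∞ η) (hη_supp : HasCompactSupport η)
      (hηab : tsupport η ⊆ Ioo a b) : ∫ t, η t • (w t - c) = 0 := by
    obtain ⟨θ, hθ, hθ_supp, hθab, hθ'⟩ :=
      exists_deriv_eq_of_integral_eq_zero hab (η := fun t => η t - (∫ s, η s) * χ t)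
        (hη.sub (contDiff_const.mul hχ)) (hη_supp.sub hχ_supp.mul_left)
        ((tsupport_sub _ _).trans (union_subset hηab ((tsupport_mul_subset_right).trans hχab)))
        (by
          rw [integral_sub (hη.continuous.integrable_of_hasCompactSupport hη_supp)
            ((hχ.continuous.integrable_of_hasCompactSupport hχ_supp).const_mul _),
            integral_const_mul, hχ_one, mul_one, sub_self])
    have hzero := h θ hθ hθ_supp hθab
    simp only [hθ', sub_mul, mul_assoc] at hzero
    rw [integral_sub (mul_integrable hη.continuous) ((mul_integrable hχ.continuous).const_mul _),
      integral_const_mul] at hzero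
    simp only [smul_eq_mul]
    rw [← setIntegral_eq hηab]
    simp only [mul_sub]
    rw [integral_sub (mul_integrable hη.continuous) (hη.continuous.integrableOn_Ioc.mul_const c),
      integral_mul_const, ← hzero]
    congr 2
    simpa using setIntegral_eq hηab 1
  refine ⟨c, Measure.eqOn_Icc_of_ae_eq volume hab.ne ?_ hw continuousOn_const⟩
  have hae := isOpen_Ioo.ae_eq_zero_of_integral_contDiff_smul_eq_zero
    ((hw.mono Ioo_subset_Icc_self).sub continuousOn_const
      |>.locallyIntegrableOn measurableSet_Ioo) key
  rw [EventuallyEq, ← restrict_Ioo_eq_restrict_Icc, ae_restrict_iff' measurableSet_Ioo]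
  exact hae.mono fun t ht htab => sub_eq_zero.1 (ht htab)

theorem integral_deriv_mul_primitive {f : ℝ → ℝ} (hab : a ≤ b) (hf : IntegrableOn f (Ioc a b))
    {η : ℝ → ℝ} (hη : ContDiff ℝ 1 η) (hηb : η b = 0) :
    ∫ t in Ioc a b, deriv η t * ∫ r in a..t, f r = -∫ t in Ioc a b, η t * f t := by
  have hfi : IntervalIntegrable f volume a b :=
    (intervalIntegrable_iff_integrableOn_Ioc_of_le hab).2 hf
  have hparts := (hη.contDiffOn (s := uIcc a b)).absolutelyContinuousOnInterval
    |>.integral_mul_deriv_eq_deriv_mul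
      (hfi.absolutelyContinuousOnInterval_intervalIntegral left_mem_uIcc)
  rw [hηb, zero_mul, intervalIntegral.integral_same, mul_zero, sub_zero, zero_sub] at hparts
  have hderiv : ∫ t in a..b, η t * deriv (fun s => ∫ r in a..s, f r) t
      = ∫ t in a..b, η t * f t := by
    refine intervalIntegral.integral_congr_ae ?_
    filter_upwards [hfi.ae_hasDerivAt_integral] with t ht htab
    rw [(ht (uIoc_subset_uIcc htab) a left_mem_uIcc).deriv]
  rw [← intervalIntegral.integral_of_le hab, ← intervalIntegral.integral_of_le hab, ← hderiv,
    hparts, neg_neg]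

theorem sub_eq_integral_of_weakDeriv (hab : a < b) {y f : ℝ → ℝ}
    (hy : ContinuousOn y (Icc a b)) (hf : IntegrableOn f (Ioc a b))
    (h : ∀ η : ℝ → ℝ, ContDiff ℝ ∞ η → HasCompactSupport η → tsupport η ⊆ Ioo a b →
      ∫ t in Ioc a b, η t * f t = -∫ t in Ioc a b, deriv η t * y t) :
    ∀ t ∈ Icc a b, y t - y a = ∫ r in Ioc a t, f r := by
  have hF : ContinuousOn (fun t => ∫ r in a..t, f r) (Icc a b) := by
    rw [← uIcc_of_le hab.le]
    refine intervalIntegral.continuousOn_primitive_interval ?_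
    rwa [uIcc_of_le hab.le, integrableOn_Icc_iff_integrableOn_Ioc]
  obtain ⟨c, hc⟩ := eqOn_const_of_forall_integral_deriv_mul_eq_zero hab (hy.sub hF)
    fun η hη hη_supp hηab => by
      have hη' : Continuous (deriv η) := hη.continuous_deriv (by simp)
      have mul_integrable {ζ : ℝ → ℝ} (hζ : ContinuousOn ζ (Icc a b)) :
          IntegrableOn (fun t => deriv η t * ζ t) (Ioc a b) :=
        ((hη'.continuousOn.mul hζ).integrableOn_Icc).mono_set Ioc_subset_Icc_self
      have hηb : η b = 0 := image_eq_zero_of_notMem_tsupport fun hb => (hηab hb).2.false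
      simp only [Pi.sub_apply, mul_sub]
      rw [integral_sub (mul_integrable hy) (mul_integrable hF),
        integral_deriv_mul_primitive hab.le hf (hη.of_le (by simp)) hηb,
        h η hη hη_supp hηab, neg_neg, sub_self]
  intro t ht
  have hct := hc ht
  have hca := hc (left_mem_Icc.2 hab.le)
  simp only [Pi.sub_apply, intervalIntegral.integral_same, sub_zero] at hct hca
  rw [← intervalIntegral.integral_of_le ht.1, hca, ← hct, sub_sub_cancel]

end WeakDeriv

/-! ### Square integrable functions on a product as curves in `L²` -/

section Separable

variable {H : Type*} [NormedAddCommGroup H] [InnerProductSpace ℝ H] [SecondCountableTopology H]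

theorem countable_of_orthonormal {s : Set H} (hs : Orthonormal ℝ ((↑) : s → H)) : Countable s := by
  have : DiscreteTopology s := .of_forall_le_dist one_pos fun x y hxy => by
    have hsq : dist x y ^ 2 = 2 := by
      rw [Subtype.dist_eq, dist_eq_norm, norm_sub_sq_real, hs.1 x, hs.1 y, hs.2 hxy]
      norm_num
    nlinarith [dist_nonneg (x := x) (y := y)]
  exact countable_of_Lindelof_of_discrete

theorem aestronglyMeasurable_of_forall_inner [CompleteSpace H] {α : Type*} [MeasurableSpace α]
    {μ : Measure α} {f : α → H} (hf : ∀ e : H, AEStronglyMeasurable (fun a => inner ℝ e (f a)) μ) :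
    AEStronglyMeasurable f μ := by
  obtain ⟨s, B, hB⟩ := exists_hilbertBasis ℝ H
  have : Countable s := countable_of_orthonormal (hB ▸ B.orthonormal)
  refine aestronglyMeasurable_of_tendsto_ae atTop
    (f := fun (F : Finset s) a => ∑ i ∈ F, inner ℝ (B i) (f a) • B i)
    (fun F => Finset.aestronglyMeasurable_fun_sum F fun i _ => (hf (B i)).smul_const (B i))
    (Eventually.of_forall fun a => ?_)
  change HasSum (fun i => inner ℝ (B i) (f a) • B i) (f a)
  simpa only [B.repr_apply_apply] using B.hasSum_repr (f a)

end Separable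

section Curves

variable {α β : Type*} [MeasurableSpace α] [MeasurableSpace β] {μ : Measure α} {ν : Measure β}

instance secondCountableTopology_L2 {E : Type*} [NormedAddCommGroup E]
    [TopologicalSpace.SeparableSpace E] [IsSeparable μ] : SecondCountableTopology (Lp E 2 μ) :=
  haveI : Fact ((2 : ENNReal) ≠ ⊤) := ⟨by norm_num⟩
  Lp.SecondCountableTopology

theorem norm_L2_sq {E : Type*} [NormedAddCommGroup E] [InnerProductSpace ℝ E] (f : Lp E 2 μ) :
    ‖f‖ ^ 2 = ∫ x, ‖f x‖ ^ 2 ∂μ := by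
  rw [← real_inner_self_eq_norm_sq, L2.inner_def]
  simp only [real_inner_self_eq_norm_sq]

theorem inner_L2_eq_integral (f g : Lp ℝ 2 μ) : inner ℝ f g = ∫ x, f x * g x ∂μ := by
  rw [L2.inner_def]
  exact integral_congr_ae (Eventually.of_forall fun x => by simp [mul_comm])

variable [SFinite μ] [SFinite ν]

theorem ae_ae_of_ae_prod_symm {p : α × β → Prop} (h : ∀ᵐ z ∂(μ.prod ν), p z) :
    ∀ᵐ t ∂ν, ∀ᵐ x ∂μ, p (x, t) :=
  Measure.ae_ae_of_ae_prod (p := fun z => p z.swap)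
    (Measure.measurePreserving_swap.quasiMeasurePreserving.ae h)

theorem exists_L2_curve [IsSeparable μ] {w : α × β → ℝ} (hw : MemLp w 2 (μ.prod ν)) :
    ∃ W : β → Lp ℝ 2 μ, MemLp W 2 ν ∧ ∀ᵐ t ∂ν, W t =ᵐ[μ] fun x => w (x, t) := by
  classical
  let W : β → Lp ℝ 2 μ := fun t => if h : MemLp (fun x => w (x, t)) 2 μ then h.toLp _ else 0
  have hWw : ∀ᵐ t ∂ν, W t =ᵐ[μ] fun x => w (x, t) := by
    filter_upwards [hw.integrable_sq.prod_left_ae, hw.1.prodMk_right] with t hsq hmeas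
    have h : MemLp (fun x => w (x, t)) 2 μ := (memLp_two_iff_integrable_sq hmeas).2 hsq
    simp only [W, h, dif_pos]
    exact h.coeFn_toLp
  have hmeas : AEStronglyMeasurable W ν := aestronglyMeasurable_of_forall_inner fun e => by
    refine AEStronglyMeasurable.congr (f := fun t => ∫ x, e x * w (x, t) ∂μ)
      ((Lp.aestronglyMeasurable e).comp_fst.mul hw.1).prod_swap.integral_prod_right' ?_
    filter_upwards [hWw] with t ht
    rw [inner_L2_eq_integral]
    exact integral_congr_ae (ht.mono fun x hx => by simp only [hx])
  refine ⟨W, (memLp_two_iff_integrable_sq_norm hmeas).2 ?_, hWw⟩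
  refine hw.integrable_sq.integral_prod_right.congr ?_
  filter_upwards [hWw] with t ht
  rw [norm_L2_sq]
  exact integral_congr_ae (ht.mono fun x hx => by simp only [hx, Real.norm_eq_abs, sq_abs])

theorem integral_prod_eq_integral_inner {w ζ : α × β → ℝ} (hw : MemLp w 2 (μ.prod ν))
    (hζ : MemLp ζ 2 (μ.prod ν)) {W Z : β → Lp ℝ 2 μ} (hW : ∀ᵐ t ∂ν, W t =ᵐ[μ] fun x => w (x, t))
    (hZ : ∀ᵐ t ∂ν, Z t =ᵐ[μ] fun x => ζ (x, t)) :
    ∫ z, w z * ζ z ∂(μ.prod ν) = ∫ t, inner ℝ (W t) (Z t) ∂ν := by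
  rw [integral_prod_symm (fun z => w z * ζ z) (hw.integrable_mul hζ)]
  refine integral_congr_ae ?_
  filter_upwards [hW, hZ] with t hWt hZt
  rw [inner_L2_eq_integral]
  exact integral_congr_ae (by filter_upwards [hWt, hZt] with x hx hx'; rw [hx, hx'])

theorem memLp_prod_of_L2_curve {w : α × β → ℝ} (hw : AEStronglyMeasurable w (μ.prod ν))
    {W : β → Lp ℝ 2 μ} (hWLp : MemLp W 2 ν) (hW : ∀ᵐ t ∂ν, W t =ᵐ[μ] fun x => w (x, t)) :
    MemLp w 2 (μ.prod ν) := by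
  rw [memLp_two_iff_integrable_sq hw, integrable_prod_iff' (by fun_prop)]
  constructor
  · filter_upwards [hW] with t ht
    exact (Lp.memLp (W t)).integrable_sq.congr (ht.mono fun x hx => by simp only [hx])
  · refine hWLp.norm.integrable_sq.congr ?_
    filter_upwards [hW] with t ht
    rw [norm_L2_sq]
    exact integral_congr_ae (ht.mono fun x hx => by simp only [hx, norm_pow])

end Curves

section Cylinder

variable {d : ℕ} {Ω : Set (EuclideanSpace ℝ (Fin d))}

theorem restrict_Q (Ω : Set (EuclideanSpace ℝ (Fin d))) (T : ℝ) :
    volume.restrict (Q Ω T) = (volume.restrict Ω).prod (volume.restrict (Ioc 0 T)) := by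
  rw [Measure.prod_restrict]
  rfl

theorem isFiniteMeasure_restrict_Q [IsFiniteMeasure (volume.restrict Ω)] (T : ℝ) :
    IsFiniteMeasure (volume.restrict (Q Ω T)) := by
  rw [restrict_Q]
  infer_instance

theorem eq_zero_of_forall_isTest (hΩ : IsOpen Ω) (f : Lp ℝ 2 (volume.restrict Ω))
    (h : ∀ φ, IsTest Ω φ → ∫ x in Ω, f x * φ x = 0) : f = 0 := by
  rw [Lp.eq_zero_iff_ae_eq_zero, EventuallyEq, ae_restrict_iff' hΩ.measurableSet]
  refine hΩ.ae_eq_zero_of_integral_contDiff_smul_eq_zero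
    (locallyIntegrableOn_of_locallyIntegrable_restrict
      ((Lp.memLp f).locallyIntegrable one_le_two)) fun φ hφ hφ_supp hφΩ => ?_
  rw [← h φ ⟨hφ, hφ_supp, hφΩ⟩]
  simp only [smul_eq_mul, mul_comm (φ _)]
  refine (setIntegral_eq_integral_of_forall_compl_eq_zero fun x hx => ?_).symm
  rw [image_eq_zero_of_notMem_tsupport fun h => hx (hφΩ h), mul_zero]

end Cylinder

/-! ### Multiplication by a bounded function of an `L²` function -/

section SmulComp

variable {α E : Type*} [MeasurableSpace α] {μ : Measure α} [NormedAddCommGroup E]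
  [InnerProductSpace ℝ E]

theorem memLp_comp_smul {γ : ℝ → ℝ} (hγ : Continuous γ) {K : ℝ} (hK : ∀ s, |γ s| ≤ K)
    (f : Lp ℝ 2 μ) (G : Lp E 2 μ) : MemLp (fun x => γ (f x) • G x) 2 μ := by
  refine (Lp.memLp G).of_le_mul (c := K)
    ((hγ.comp_aestronglyMeasurable (Lp.aestronglyMeasurable f)).smul (Lp.aestronglyMeasurable G))
    (Eventually.of_forall fun x => ?_)
  rw [norm_smul]
  exact mul_le_mul_of_nonneg_right (hK _) (norm_nonneg _)

/-- The product of `G` with the bounded function `γ ∘ f`, as an element of `L²`. -/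
noncomputable def smulComp {γ : ℝ → ℝ} (hγ : Continuous γ) {K : ℝ} (hK : ∀ s, |γ s| ≤ K)
    (f : Lp ℝ 2 μ) (G : Lp E 2 μ) : Lp E 2 μ := (memLp_comp_smul hγ hK f G).toLp _

variable {γ : ℝ → ℝ} (hγ : Continuous γ) {K : ℝ} (hK : ∀ s, |γ s| ≤ K)

theorem coeFn_smulComp (f : Lp ℝ 2 μ) (G : Lp E 2 μ) :
    smulComp hγ hK f G =ᵐ[μ] fun x => γ (f x) • G x := MemLp.coeFn_toLp _

theorem norm_smulComp_le (f : Lp ℝ 2 μ) (G : Lp E 2 μ) : ‖smulComp hγ hK f G‖ ≤ K * ‖G‖ := by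
  refine Lp.norm_le_mul_norm_of_ae_le_mul ?_
  filter_upwards [coeFn_smulComp hγ hK f G] with x hx
  rw [hx, norm_smul]
  exact mul_le_mul_of_nonneg_right (hK _) (norm_nonneg _)

theorem smulComp_sub_right (f : Lp ℝ 2 μ) (G G' : Lp E 2 μ) :
    smulComp hγ hK f (G - G') = smulComp hγ hK f G - smulComp hγ hK f G' := by
  refine Lp.ext ?_
  filter_upwards [coeFn_smulComp hγ hK f G, coeFn_smulComp hγ hK f G', Lp.coeFn_sub G G',
    coeFn_smulComp hγ hK f (G - G'),
    Lp.coeFn_sub (smulComp hγ hK f G) (smulComp hγ hK f G')] with x hG hG' hGG' hl hr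
  rw [hl, hr, Pi.sub_apply, hG, hG', hGG', Pi.sub_apply, smul_sub]

theorem coeFn_smulComp_sub_left (f f' : Lp ℝ 2 μ) (G : Lp E 2 μ) :
    ⇑(smulComp hγ hK f G - smulComp hγ hK f' G) =ᵐ[μ] fun x => (γ (f x) - γ (f' x)) • G x := by
  filter_upwards [coeFn_smulComp hγ hK f G, coeFn_smulComp hγ hK f' G,
    Lp.coeFn_sub (smulComp hγ hK f G) (smulComp hγ hK f' G)] with x hf hf' hsub
  rw [hsub, Pi.sub_apply, hf, hf', sub_smul]

theorem tendsto_smulComp_of_ae {f : Lp ℝ 2 μ} {F : ℕ → Lp ℝ 2 μ} (G : Lp E 2 μ)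
    (h : ∀ᵐ x ∂μ, Tendsto (fun n => F n x) atTop (𝓝 (f x))) :
    Tendsto (fun n => smulComp hγ hK (F n) G) atTop (𝓝 (smulComp hγ hK f G)) := by
  have hsub : ∀ᵐ x ∂μ, ∀ n, (smulComp hγ hK (F n) G - smulComp hγ hK f G) x
      = (γ (F n x) - γ (f x)) • G x :=
    ae_all_iff.2 fun n => coeFn_smulComp_sub_left hγ hK (F n) f G
  have key : Tendsto (fun n => ∫ x, ‖(smulComp hγ hK (F n) G - smulComp hγ hK f G) x‖ ^ 2 ∂μ)
      atTop (𝓝 (∫ _, (0 : ℝ) ∂μ)) := by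
    refine tendsto_integral_of_dominated_convergence (fun x => (2 * K) ^ 2 * ‖G x‖ ^ 2)
      (fun n => (Lp.aestronglyMeasurable _).norm.pow 2)
      ((Lp.memLp G).norm.integrable_sq.const_mul _) (fun n => hsub.mono fun x hx => ?_) ?_
    · rw [hx n, norm_smul, mul_pow, Real.norm_of_nonneg (by positivity), Real.norm_eq_abs]
      gcongr
      linarith [abs_sub (γ (F n x)) (γ (f x)), hK (F n x), hK (f x)]
    · filter_upwards [h, hsub] with x hx hx'
      have hγx : Tendsto (fun n => γ (F n x) - γ (f x)) atTop (𝓝 0) := by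
        simpa using ((hγ.tendsto _).comp hx).sub_const (γ (f x))
      simp only [hx']
      simpa using (hγx.smul_const (G x)).norm.pow 2
  rw [tendsto_iff_norm_sub_tendsto_zero]
  simpa only [← norm_L2_sq, integral_zero, Real.sqrt_sq (norm_nonneg _), Real.sqrt_zero]
    using key.sqrt

theorem continuous_smulComp :
    Continuous fun w : Lp ℝ 2 μ × Lp E 2 μ => smulComp hγ hK w.1 w.2 := by
  rw [continuous_iff_seqContinuous]
  intro u w hu
  refine tendsto_of_subseq_tendsto fun ns hns => ?_
  have hfst : Tendsto (fun n => (u (ns n)).1) atTop (𝓝 w.1) :=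
    (continuous_fst.tendsto w).comp (hu.comp hns)
  have hsnd : Tendsto (fun n => (u (ns n)).2) atTop (𝓝 w.2) :=
    (continuous_snd.tendsto w).comp (hu.comp hns)
  obtain ⟨ms, hms, hae⟩ := (tendstoInMeasure_of_tendsto_Lp hfst).exists_seq_tendsto_ae
  have hvary : Tendsto (fun n => smulComp hγ hK (u (ns (ms n))).1 ((u (ns (ms n))).2 - w.2))
      atTop (𝓝 0) := by
    refine squeeze_zero_norm (fun n => norm_smulComp_le hγ hK _ _) ?_
    simpa using ((hsnd.comp hms.tendsto_atTop).sub_const w.2).norm.const_mul K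
  refine ⟨ms, ?_⟩
  simpa [smulComp_sub_right] using hvary.add (tendsto_smulComp_of_ae hγ hK w.2 hae)

end SmulComp

/-! ### The chain rule in `H¹₀` -/

section Gradient

variable {E : Type*} [NormedAddCommGroup E] [InnerProductSpace ℝ E] [CompleteSpace E] {φ ψ : E → ℝ}

theorem gradient_add (hφ : Differentiable ℝ φ) (hψ : Differentiable ℝ ψ) :
    gradient (φ + ψ) = gradient φ + gradient ψ := by
  ext1 x
  simp only [gradient, Pi.add_apply]
  rw [fderiv_add (hφ x) (hψ x), map_add]

theorem gradient_const_smul (hφ : Differentiable ℝ φ) (c : ℝ) :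
    gradient (c • φ) = c • gradient φ := by
  ext1 x
  simp only [gradient, Pi.smul_apply]
  rw [fderiv_const_smul (hφ x), map_smul]

theorem gradient_comp (hφ : Differentiable ℝ φ) {β : ℝ → ℝ} (hβ : Differentiable ℝ β) :
    gradient (β ∘ φ) = fun x => deriv β (φ x) • gradient φ x := by
  ext1 x
  simp only [gradient]
  rw [((hβ (φ x)).hasDerivAt.comp_hasFDerivAt x (hφ x).hasFDerivAt).fderiv, map_smul]

theorem norm_gradient (φ : E → ℝ) (x : E) : ‖gradient φ x‖ = ‖fderiv ℝ φ x‖ := by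
  rw [gradient, LinearIsometryEquiv.norm_map]

end Gradient

section H10

variable {d : ℕ} {Ω : Set (EuclideanSpace ℝ (Fin d))}

/-- The pairs `(φ, ∇φ)` of test functions `φ`; their closure is `H¹₀(Ω)`. -/
def testPairs (Ω : Set (EuclideanSpace ℝ (Fin d))) : Set (Pairs Ω) :=
  {w : Pairs Ω | ∃ φ, IsTest Ω φ ∧
    (w.fst : EuclideanSpace ℝ (Fin d) → ℝ) =ᵐ[volume.restrict Ω] φ ∧
    (w.snd : EuclideanSpace ℝ (Fin d) → EuclideanSpace ℝ (Fin d))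
      =ᵐ[volume.restrict Ω] gradient φ}

theorem IsTest.differentiable {φ : EuclideanSpace ℝ (Fin d) → ℝ} (h : IsTest Ω φ) :
    Differentiable ℝ φ := h.1.differentiable (by simp)

theorem coe_span_testPairs :
    (Submodule.span ℝ (testPairs Ω) : Set (Pairs Ω)) = testPairs Ω := by
  refine Subset.antisymm (fun _ hw => ?_) Submodule.subset_span
  induction hw using Submodule.span_induction with
  | mem _ hw => exact hw
  | zero =>
    refine ⟨0, ⟨contDiff_const, HasCompactSupport.zero, by simp⟩, Lp.coeFn_zero _ _ _,
      (Lp.coeFn_zero _ _ _).trans (Eventually.of_forall fun x => ?_)⟩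
    simp [gradient]
  | add w z _ _ hw hz =>
    obtain ⟨φ, hφ, hwφ, hwφ'⟩ := hw
    obtain ⟨ψ, hψ, hzψ, hzψ'⟩ := hz
    refine ⟨φ + ψ, ⟨hφ.1.add hψ.1, hφ.2.1.add hψ.2.1,
      (tsupport_add φ ψ).trans (union_subset hφ.2.2 hψ.2.2)⟩,
      (Lp.coeFn_add w.fst z.fst).trans (hwφ.add hzψ), ?_⟩
    rw [gradient_add hφ.differentiable hψ.differentiable]
    exact (Lp.coeFn_add w.snd z.snd).trans (hwφ'.add hzψ')
  | smul c w _ hw =>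
    obtain ⟨φ, hφ, hwφ, hwφ'⟩ := hw
    refine ⟨c • φ, ⟨hφ.1.const_smul c, hφ.2.1.smul_left (f := fun _ => c),
      (tsupport_smul_subset_right (fun _ => c) φ).trans hφ.2.2⟩,
      (Lp.coeFn_smul c w.fst).trans (hwφ.const_smul c), ?_⟩
    rw [gradient_const_smul hφ.differentiable]
    exact (Lp.coeFn_smul c w.snd).trans (hwφ'.const_smul c)

theorem mem_H10_iff {w : Pairs Ω} : w ∈ H10 Ω ↔ w ∈ closure (testPairs Ω) := by
  change w ∈ ((Submodule.span ℝ (testPairs Ω)).topologicalClosure : Set (Pairs Ω)) ↔ _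
  rw [Submodule.topologicalClosure_coe, coe_span_testPairs]

section Comp

variable {β : ℝ → ℝ} {K : NNReal}

theorem lipschitzWith_of_abs_deriv_le (hβ : ContDiff ℝ ∞ β) (hK : ∀ s, |deriv β s| ≤ K) :
    LipschitzWith K β :=
  lipschitzWith_of_nnnorm_deriv_le (hβ.differentiable (by simp)) hK

/-- The superposition operator `(f, G) ↦ (β ∘ f, (β' ∘ f) G)`, which turns `(f, ∇f)` into
`(β ∘ f, ∇(β ∘ f))`. -/
noncomputable def compPair (hβ : ContDiff ℝ ∞ β) (hβ_zero : β 0 = 0)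
    (hK : ∀ s, |deriv β s| ≤ K) (w : Pairs Ω) : Pairs Ω :=
  WithLp.toLp 2 ((lipschitzWith_of_abs_deriv_le hβ hK).compLp hβ_zero w.fst,
    smulComp (hβ.continuous_deriv (by simp)) hK w.fst w.snd)

variable (hβ : ContDiff ℝ ∞ β) (hβ_zero : β 0 = 0) (hK : ∀ s, |deriv β s| ≤ K)

theorem coeFn_compPair_fst (w : Pairs Ω) :
    (compPair hβ hβ_zero hK w).fst =ᵐ[volume.restrict Ω] fun x => β (w.fst x) :=
  (lipschitzWith_of_abs_deriv_le hβ hK).coeFn_compLp hβ_zero _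

theorem coeFn_compPair_snd (w : Pairs Ω) :
    (compPair hβ hβ_zero hK w).snd =ᵐ[volume.restrict Ω] fun x => deriv β (w.fst x) • w.snd x :=
  coeFn_smulComp (hβ.continuous_deriv (by simp)) hK _ _

theorem continuous_compPair : Continuous (compPair hβ hβ_zero hK : Pairs Ω → Pairs Ω) := by
  refine (WithLp.prod_continuous_toLp 2 _ _).comp (Continuous.prodMk ?_ ?_)
  · exact ((lipschitzWith_of_abs_deriv_le hβ hK).continuous_compLp hβ_zero).comp
      (WithLp.continuous_fst 2 _ _)
  · exact (continuous_smulComp (hβ.continuous_deriv (by simp)) hK).comp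
      ((WithLp.continuous_fst 2 _ _).prodMk (WithLp.continuous_snd 2 _ _))

theorem norm_compPair_le (w : Pairs Ω) : ‖compPair hβ hβ_zero hK w‖ ≤ K * ‖w‖ := by
  refine le_of_sq_le_sq ?_ (by positivity)
  rw [mul_pow, WithLp.prod_norm_sq_eq_of_L2, WithLp.prod_norm_sq_eq_of_L2, mul_add, ← mul_pow,
    ← mul_pow]
  exact add_le_add
    (pow_le_pow_left₀ (norm_nonneg _)
      ((lipschitzWith_of_abs_deriv_le hβ hK).norm_compLp_le hβ_zero _) 2)
    (pow_le_pow_left₀ (norm_nonneg _)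
      (norm_smulComp_le (hβ.continuous_deriv (by simp)) hK _ _) 2)

theorem mapsTo_compPair_testPairs :
    MapsTo (compPair hβ hβ_zero hK) (testPairs Ω) (testPairs Ω) := by
  rintro w ⟨φ, hφ, hwφ, hwφ'⟩
  refine ⟨β ∘ φ, ⟨hβ.comp hφ.1, hφ.2.1.comp_left hβ_zero,
    (tsupport_comp_subset hβ_zero φ).trans hφ.2.2⟩, ?_, ?_⟩
  · filter_upwards [coeFn_compPair_fst hβ hβ_zero hK w, hwφ] with x hx hxφ
    rw [hx, hxφ, Function.comp_apply]
  · rw [gradient_comp hφ.differentiable (hβ.differentiable (by simp))]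
    filter_upwards [coeFn_compPair_snd hβ hβ_zero hK w, hwφ, hwφ'] with x hx hxφ hxφ'
    rw [hx, hxφ, hxφ']

theorem compPair_mem_H10 {w : Pairs Ω} (hw : w ∈ H10 Ω) : compPair hβ hβ_zero hK w ∈ H10 Ω :=
  mem_H10_iff.2 (map_mem_closure (continuous_compPair hβ hβ_zero hK) (mem_H10_iff.1 hw)
    (mapsTo_compPair_testPairs hβ hβ_zero hK))

/-- Composition with `β` as an operator on `H¹₀(Ω)`. -/
noncomputable def compH10 (w : H10 Ω) : H10 Ω :=
  ⟨compPair hβ hβ_zero hK w, compPair_mem_H10 hβ hβ_zero hK w.2⟩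

theorem memLp_compH10 {α : Type*} [MeasurableSpace α] {μ : Measure α} {W : α → H10 Ω}
    (hW : MemLp W 2 μ) : MemLp (fun t => compH10 hβ hβ_zero hK (W t)) 2 μ := by
  have hcont : Continuous (compH10 hβ hβ_zero hK : H10 Ω → H10 Ω) :=
    ((continuous_compPair hβ hβ_zero hK).comp continuous_subtype_val).subtype_mk _
  exact hW.of_le_mul (hcont.comp_aestronglyMeasurable hW.1)
    (Eventually.of_forall fun t => norm_compPair_le hβ hβ_zero hK _)

end Comp

end H10

/-! ### The Poincaré inequality -/

section Poincare

theorem integrable_sq_of_hasCompactSupport {X : Type*} [TopologicalSpace X] [MeasurableSpace X]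
    [OpensMeasurableSpace X] {μ : Measure X} [IsFiniteMeasureOnCompacts μ] {φ : X → ℝ}
    (hφ : Continuous φ) (hsupp : HasCompactSupport φ) : Integrable (fun x => φ x ^ 2) μ := by
  simp only [sq]
  exact (hφ.mul hφ).integrable_of_hasCompactSupport hsupp.mul_left

variable {E : Type*} [NormedAddCommGroup E] [NormedSpace ℝ E] [FiniteDimensional ℝ E]
  [MeasurableSpace E] [BorelSpace E] {μ : Measure E} [μ.IsAddHaarMeasure]
  {φ : E → ℝ} {ℓ : E →L[ℝ] ℝ} {e : E}

theorem integral_sq_eq_neg_integral_mul_fderiv (hφ : ContDiff ℝ 1 φ) (hsupp : HasCompactSupport φ)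
    (hℓ : ℓ e = 1) :
    ∫ x, φ x ^ 2 ∂μ = -∫ x, ℓ x * (2 * φ x * fderiv ℝ φ x e) ∂μ := by
  have hφ' : Continuous fun x => fderiv ℝ φ x e :=
    (hφ.continuous_fderiv one_ne_zero).clm_apply continuous_const
  have hsq : ∀ x, HasFDerivAt (fun x => φ x ^ 2) ((2 * φ x) • fderiv ℝ φ x) x := fun x => by
    simpa using (hφ.differentiable one_ne_zero x).hasFDerivAt.pow 2
  have hparts := integral_mul_fderiv_eq_neg_fderiv_mul_of_integrable (μ := μ) (f := ℓ)
    (g := fun x => φ x ^ 2) (v := e) ?_ ?_ ?_ (fun x _ => ℓ.differentiableAt)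
    (fun x _ => (hsq x).differentiableAt)
  · simp only [(hsq _).fderiv, ContinuousLinearMap.fderiv, hℓ, one_mul, smul_apply,
      smul_eq_mul] at hparts
    rw [hparts, neg_neg]
  · simpa only [ContinuousLinearMap.fderiv, hℓ, one_mul] using
      integrable_sq_of_hasCompactSupport hφ.continuous hsupp
  · simp only [(hsq _).fderiv, smul_apply, smul_eq_mul]
    exact (ℓ.continuous.mul ((hφ.continuous.const_mul 2).mul hφ')).integrable_of_hasCompactSupport
      (hsupp.mul_left.mul_right.mul_left)
  · simp only [sq]
    exact (ℓ.continuous.mul (hφ.continuous.mul hφ.continuous)).integrable_of_hasCompactSupport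
      hsupp.mul_left.mul_left

theorem integral_sq_le_integral_fderiv_sq (hφ : ContDiff ℝ 1 φ) (hsupp : HasCompactSupport φ)
    (hℓ : ℓ e = 1) {R : ℝ} (hR : ∀ x ∈ tsupport φ, |ℓ x| ≤ R) :
    ∫ x, φ x ^ 2 ∂μ ≤ 4 * R ^ 2 * ∫ x, fderiv ℝ φ x e ^ 2 ∂μ := by
  have hφ' : Continuous fun x => fderiv ℝ φ x e :=
    (hφ.continuous_fderiv one_ne_zero).clm_apply continuous_const
  have hint : Integrable (fun x => φ x ^ 2) μ :=
    integrable_sq_of_hasCompactSupport hφ.continuous hsupp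
  have hint' : Integrable (fun x => fderiv ℝ φ x e ^ 2) μ :=
    integrable_sq_of_hasCompactSupport hφ' (hsupp.fderiv_apply ℝ e)
  have hint'' : Integrable (fun x => ℓ x * (2 * φ x * fderiv ℝ φ x e)) μ :=
    (ℓ.continuous.mul ((hφ.continuous.const_mul 2).mul hφ')).integrable_of_hasCompactSupport
      (hsupp.mul_left.mul_right.mul_left)
  have hyoung : ∀ x, -(ℓ x * (2 * φ x * fderiv ℝ φ x e))
      ≤ 1 / 2 * φ x ^ 2 + 2 * R ^ 2 * fderiv ℝ φ x e ^ 2 := by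
    intro x
    by_cases hx : x ∈ tsupport φ
    · have hℓx : ℓ x ^ 2 ≤ R ^ 2 := sq_le_sq.2 ((hR x hx).trans (le_abs_self R))
      nlinarith [sq_nonneg (φ x + 2 * (ℓ x * fderiv ℝ φ x e)),
        mul_le_mul_of_nonneg_right hℓx (sq_nonneg (fderiv ℝ φ x e))]
    · rw [image_eq_zero_of_notMem_tsupport hx]
      simp only [mul_zero, zero_mul, neg_zero]
      positivity
  have hle := integral_mono hint''.neg ((hint.const_mul _).add (hint'.const_mul _)) hyoung
  simp only [Pi.add_apply, Pi.neg_apply] at hle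
  rw [integral_neg, ← integral_sq_eq_neg_integral_mul_fderiv hφ hsupp hℓ,
    integral_add (hint.const_mul _) (hint'.const_mul _), integral_const_mul,
    integral_const_mul] at hle
  linarith

end Poincare

section H10

variable {d : ℕ} {Ω : Set (EuclideanSpace ℝ (Fin d))} {φ : EuclideanSpace ℝ (Fin d) → ℝ}

theorem IsTest.integral_sq_le (hφ : IsTest Ω φ) (hd : 0 < d) {R : ℝ} (hR : ∀ x ∈ Ω, ‖x‖ ≤ R) :
    ∫ x, φ x ^ 2 ≤ 4 * R ^ 2 * ∫ x, ‖gradient φ x‖ ^ 2 := by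
  have hC1 : ContDiff ℝ 1 φ := hφ.1.of_le (by simp)
  set e : EuclideanSpace ℝ (Fin d) := EuclideanSpace.single ⟨0, hd⟩ 1
  have he : ‖e‖ = 1 := by simp [e]
  refine (integral_sq_le_integral_fderiv_sq (ℓ := EuclideanSpace.proj ⟨0, hd⟩) (e := e) hC1 hφ.2.1
    (by simp [e]) fun x hx => (PiLp.norm_apply_le x _).trans (hR x (hφ.2.2 hx))).trans ?_
  have hderiv : ∀ x, fderiv ℝ φ x e ^ 2 ≤ ‖gradient φ x‖ ^ 2 := fun x => by
    rw [norm_gradient, ← sq_abs]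
    simpa [he] using pow_le_pow_left₀ (abs_nonneg _) ((fderiv ℝ φ x).le_opNorm e) 2
  have hfderiv : Continuous (fderiv ℝ φ) := hC1.continuous_fderiv one_ne_zero
  refine mul_le_mul_of_nonneg_left (integral_mono ?_ ?_ hderiv) (by positivity)
  · exact integrable_sq_of_hasCompactSupport (hfderiv.clm_apply continuous_const)
      (hφ.2.1.fderiv_apply ℝ e)
  · simp only [norm_gradient]
    exact integrable_sq_of_hasCompactSupport hfderiv.norm (hφ.2.1.fderiv ℝ).norm

theorem IsTest.eq_zero_of_notMem (hφ : IsTest Ω φ) {x : EuclideanSpace ℝ (Fin d)} (hx : x ∉ Ω) :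
    φ x = 0 :=
  image_eq_zero_of_notMem_tsupport fun h => hx (hφ.2.2 h)

theorem IsTest.gradient_eq_zero_of_notMem (hφ : IsTest Ω φ) {x : EuclideanSpace ℝ (Fin d)}
    (hx : x ∉ Ω) : gradient φ x = 0 := by
  rw [← norm_eq_zero, norm_gradient, norm_eq_zero]
  exact image_eq_zero_of_notMem_tsupport fun h => hx (hφ.2.2 (tsupport_fderiv_subset ℝ h))

theorem exists_poincare (hd : 0 < d) (hΩ : Bornology.IsBounded Ω) :
    ∃ C : ℝ, ∀ w ∈ H10 Ω, ‖w.fst‖ ^ 2 ≤ C * ‖w.snd‖ ^ 2 := by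
  obtain ⟨R, hR⟩ := hΩ.exists_norm_le
  refine ⟨4 * R ^ 2, fun w hw => ?_⟩
  have hclosed : IsClosed {w : Pairs Ω | ‖w.fst‖ ^ 2 ≤ 4 * R ^ 2 * ‖w.snd‖ ^ 2} :=
    isClosed_le ((WithLp.continuous_fst 2 _ _).norm.pow 2)
      (((WithLp.continuous_snd 2 _ _).norm.pow 2).const_mul _)
  refine closure_minimal ?_ hclosed (mem_H10_iff.1 hw)
  rintro w ⟨φ, hφ, hwφ, hwφ'⟩
  have hfst : ‖w.fst‖ ^ 2 = ∫ x, φ x ^ 2 := by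
    rw [norm_L2_sq, ← setIntegral_eq_integral_of_forall_compl_eq_zero (s := Ω)
      (f := fun x => φ x ^ 2) fun x hx => by rw [hφ.eq_zero_of_notMem hx, zero_pow two_ne_zero]]
    exact integral_congr_ae (by filter_upwards [hwφ] with x hx; simp [hx])
  have hsnd : ‖w.snd‖ ^ 2 = ∫ x, ‖gradient φ x‖ ^ 2 := by
    rw [norm_L2_sq, ← setIntegral_eq_integral_of_forall_compl_eq_zero (s := Ω)
      (f := fun x => ‖gradient φ x‖ ^ 2) fun x hx => by
        rw [hφ.gradient_eq_zero_of_notMem hx, norm_zero, zero_pow two_ne_zero]]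
    exact integral_congr_ae (by filter_upwards [hwφ'] with x hx; simp [hx])
  rw [mem_ofPred_eq, hfst, hsnd]
  exact hφ.integral_sq_le hd hR

end H10

/-! ### Weak time derivatives -/

section Tensor

variable {E F : Type*} {ψ : E → ℝ} {η : F → ℝ}

theorem tsupport_mul_prod_subset [TopologicalSpace E] [TopologicalSpace F] (ψ : E → ℝ)
    (η : F → ℝ) : tsupport (fun z : E × F => ψ z.1 * η z.2) ⊆ tsupport ψ ×ˢ tsupport η :=
  closure_minimal (fun _ hz => ⟨subset_tsupport _ (left_ne_zero_of_mul hz),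
    subset_tsupport _ (right_ne_zero_of_mul hz)⟩) ((isClosed_tsupport _).prod (isClosed_tsupport _))

theorem hasCompactSupport_mul_prod [TopologicalSpace E] [TopologicalSpace F]
    (hψ : HasCompactSupport ψ) (hη : HasCompactSupport η) :
    HasCompactSupport fun z : E × F => ψ z.1 * η z.2 :=
  (hψ.isCompact.prod hη.isCompact).of_isClosed_subset (isClosed_tsupport _)
    (tsupport_mul_prod_subset ψ η)

theorem fderiv_mul_prod_apply_zero_one [NormedAddCommGroup E] [NormedSpace ℝ E] {η : ℝ → ℝ}
    {z : E × ℝ} (hψ : DifferentiableAt ℝ ψ z.1) (hη : DifferentiableAt ℝ η z.2) :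
    fderiv ℝ (fun z : E × ℝ => ψ z.1 * η z.2) z (0, 1) = ψ z.1 * deriv η z.2 := by
  have hψ' : HasFDerivAt (fun z : E × ℝ => ψ z.1) ((fderiv ℝ ψ z.1).comp (.fst ℝ E ℝ)) z :=
    hψ.hasFDerivAt.comp z hasFDerivAt_fst
  have hη' : HasFDerivAt (fun z : E × ℝ => η z.2) ((fderiv ℝ η z.2).comp (.snd ℝ E ℝ)) z :=
    hη.hasFDerivAt.comp z hasFDerivAt_snd
  refine (DFunLike.congr_fun (hψ'.mul hη').fderiv (0, 1)).trans ?_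
  simp

end Tensor

theorem integrable_continuous_smul {α E : Type*} [TopologicalSpace α] [MeasurableSpace α]
    [OpensMeasurableSpace α] {μ : Measure α} [NormedAddCommGroup E] [NormedSpace ℝ E] {f : α → ℝ}
    {W : α → E} (hf : Continuous f) (hf_supp : HasCompactSupport f) (hW : Integrable W μ) :
    Integrable (fun t => f t • W t) μ := by
  obtain ⟨K, hK⟩ := hf_supp.exists_bound_of_continuous hf
  exact hW.bdd_smul K hf.aestronglyMeasurable (Eventually.of_forall hK)

section WeakTimeDeriv

variable {d : ℕ} {Ω : Set (EuclideanSpace ℝ (Fin d))} {T : ℝ}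

theorem integral_Q_mul_prod_eq_integral_inner {v : EuclideanSpace ℝ (Fin d) × ℝ → ℝ}
    {V : ℝ → Lp ℝ 2 (volume.restrict Ω)} {ψ : EuclideanSpace ℝ (Fin d) → ℝ} {η : ℝ → ℝ}
    (hψ : Continuous ψ) (hψ_supp : HasCompactSupport ψ) (hη : Continuous η)
    (hη_supp : HasCompactSupport η) (hv : MemLp v 2 (volume.restrict (Q Ω T)))
    (hV : ∀ᵐ t ∂volume.restrict (Ioc 0 T), V t =ᵐ[volume.restrict Ω] fun x => v (x, t))
    {ψ₂ : Lp ℝ 2 (volume.restrict Ω)} (hψ₂ : ψ₂ =ᵐ[volume.restrict Ω] ψ) :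
    ∫ z in Q Ω T, v z * (ψ z.1 * η z.2) = ∫ t in Ioc 0 T, inner ℝ ψ₂ (η t • V t) := by
  have hψη : MemLp (fun z : EuclideanSpace ℝ (Fin d) × ℝ => ψ z.1 * η z.2) 2
      (volume.restrict (Q Ω T)) :=
    (((hψ.comp continuous_fst).mul (hη.comp continuous_snd)).memLp_of_hasCompactSupport
      (hasCompactSupport_mul_prod hψ_supp hη_supp)).restrict _
  rw [restrict_Q] at hv hψη ⊢
  rw [integral_prod_eq_integral_inner hv hψη (Z := fun t => η t • ψ₂) hV]
  · simp only [inner_smul_right, real_inner_comm]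
  · refine Eventually.of_forall fun t => ?_
    filter_upwards [Lp.coeFn_smul (η t) ψ₂, hψ₂] with x hx hx'
    rw [hx, Pi.smul_apply, hx', smul_eq_mul, mul_comm]

namespace HasWeakTimeDeriv

variable {v v' : EuclideanSpace ℝ (Fin d) × ℝ → ℝ} {V V' : ℝ → Lp ℝ 2 (volume.restrict Ω)}
  {η : ℝ → ℝ}

theorem integral_mul_prod_eq {ψ : EuclideanSpace ℝ (Fin d) → ℝ} (h : HasWeakTimeDeriv Ω T v v')
    (hψ : IsTest Ω ψ) (hη : ContDiff ℝ ∞ η) (hη_supp : HasCompactSupport η)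
    (hη_Ioo : tsupport η ⊆ Ioo 0 T) :
    ∫ z in Q Ω T, v z * (ψ z.1 * deriv η z.2) = -∫ z in Q Ω T, v' z * (ψ z.1 * η z.2) := by
  have hweak := h.2 (fun z => ψ z.1 * η z.2)
    ((hψ.1.comp contDiff_fst).mul (hη.comp contDiff_snd))
    (hasCompactSupport_mul_prod hψ.2.1 hη_supp)
    ((tsupport_mul_prod_subset ψ η).trans (prod_mono hψ.2.2 hη_Ioo))
  simpa only [fderiv_mul_prod_apply_zero_one (hψ.differentiable _)
    (hη.differentiable (by simp) _)] using hweak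

theorem integral_smul_eq (h : HasWeakTimeDeriv Ω T v v') (hΩ : IsOpen Ω)
    (hv : MemLp v 2 (volume.restrict (Q Ω T))) (hV_int : IntegrableOn V (Ioc 0 T))
    (hV : ∀ᵐ t ∂volume.restrict (Ioc 0 T), V t =ᵐ[volume.restrict Ω] fun x => v (x, t))
    (hV'_int : IntegrableOn V' (Ioc 0 T))
    (hV' : ∀ᵐ t ∂volume.restrict (Ioc 0 T), V' t =ᵐ[volume.restrict Ω] fun x => v' (x, t))
    (hη : ContDiff ℝ ∞ η) (hη_supp : HasCompactSupport η) (hη_Ioo : tsupport η ⊆ Ioo 0 T) :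
    ∫ t in Ioc 0 T, η t • V' t = -∫ t in Ioc 0 T, deriv η t • V t := by
  have hη' : Continuous (deriv η) := hη.continuous_deriv (by simp)
  rw [← add_eq_zero_iff_eq_neg]
  refine eq_zero_of_forall_isTest hΩ _ fun ψ hψ => ?_
  have hψL : MemLp ψ 2 (volume.restrict Ω) :=
    (hψ.1.continuous.memLp_of_hasCompactSupport hψ.2.1).restrict Ω
  have inner_eq (f : Lp ℝ 2 (volume.restrict Ω)) :
      ∫ x in Ω, f x * ψ x = inner ℝ (hψL.toLp ψ) f := by
    rw [real_inner_comm, inner_L2_eq_integral]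
    exact integral_congr_ae (by filter_upwards [hψL.coeFn_toLp] with x hx; rw [hx])
  have htest := h.integral_mul_prod_eq hψ hη hη_supp hη_Ioo
  rw [integral_Q_mul_prod_eq_integral_inner hψ.1.continuous hψ.2.1 hη' hη_supp.deriv hv hV
    hψL.coeFn_toLp, integral_Q_mul_prod_eq_integral_inner hψ.1.continuous hψ.2.1 hη.continuous
    hη_supp h.1 hV' hψL.coeFn_toLp] at htest
  rw [inner_eq, inner_add_right,
    ← integral_inner (integrable_continuous_smul hη.continuous hη_supp hV'_int),
    ← integral_inner (integrable_continuous_smul hη' hη_supp.deriv hV_int), htest, add_neg_cancel]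

theorem inner_sub_eq (h : HasWeakTimeDeriv Ω T v v') (hΩ : IsOpen Ω) (hT : 0 < T)
    (hv : MemLp v 2 (volume.restrict (Q Ω T))) (hV_cont : ContinuousOn V (Icc 0 T))
    (hV : ∀ᵐ t ∂volume.restrict (Ioc 0 T), V t =ᵐ[volume.restrict Ω] fun x => v (x, t))
    (hV'_int : IntegrableOn V' (Ioc 0 T))
    (hV' : ∀ᵐ t ∂volume.restrict (Ioc 0 T), V' t =ᵐ[volume.restrict Ω] fun x => v' (x, t))
    (φ : Lp ℝ 2 (volume.restrict Ω)) :
    ∀ t ∈ Icc 0 T, inner ℝ (V t - V 0) φ = ∫ r in Ioc 0 t, inner ℝ (V' r) φ := by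
  have hV_int : IntegrableOn V (Ioc 0 T) :=
    hV_cont.integrableOn_Icc.mono_set Ioc_subset_Icc_self
  simp only [inner_sub_left]
  refine sub_eq_integral_of_weakDeriv hT (hV_cont.inner continuousOn_const)
    (hV'_int.inner_const φ) fun η hη hη_supp hη_Ioo => ?_
  have hη' : Continuous (deriv η) := hη.continuous_deriv (by simp)
  have hweak := congrArg (inner ℝ φ)
    (h.integral_smul_eq hΩ hv hV_int hV hV'_int hV' hη hη_supp hη_Ioo)
  rw [inner_neg_right,
    ← integral_inner (integrable_continuous_smul hη.continuous hη_supp hV'_int),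
    ← integral_inner (integrable_continuous_smul hη' hη_supp.deriv hV_int)] at hweak
  simpa only [inner_smul_right, real_inner_comm φ] using hweak

end HasWeakTimeDeriv

theorem IsW.inner_sub_eq (hT : 0 < T) {w : EuclideanSpace ℝ (Fin d) × ℝ → ℝ} {W : ℝ → H10 Ω}
    {W' : ℝ → Hneg Ω} (h : IsW Ω T w W W') {c : ℝ → Lp ℝ 2 (volume.restrict Ω)}
    (hc : ContinuousOn c (Icc 0 T))
    (hcW : ∀ᵐ t ∂volume.restrict (Ioc 0 T), c t = (W t : Pairs Ω).fst) (φ : H10 Ω) :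
    ∀ t ∈ Icc 0 T, inner ℝ (c t - c 0) (φ : Pairs Ω).fst = ∫ r in Ioc 0 t, W' r φ := by
  simp only [inner_sub_left]
  refine sub_eq_integral_of_weakDeriv hT (hc.inner continuousOn_const)
    (integrable_dual_apply h.memLp' (memLp_const φ)) fun η hη hη_supp hη_Ioo => ?_
  rw [h.deriv_eq η hη hη_supp hη_Ioo φ]
  congr 1
  exact integral_congr_ae (by filter_upwards [hcW] with t ht; rw [ht])

end WeakTimeDeriv

/-! ### Convex energies -/

/-- `∫ₐ^q β(s) b'(s) ds`, the energy density whose time derivative along a solution is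
`∂ₜ b(p) β(p)`. -/
noncomputable def energy (b β : ℝ → ℝ) (a q : ℝ) : ℝ := ∫ s in a..q, β s * deriv b s

section Energy

variable {b β : ℝ → ℝ}

theorem intervalIntegrable_mul_deriv (hb : ContDiff ℝ 1 b) (hβ : Monotone β) (x y : ℝ) :
    IntervalIntegrable (fun s => β s * deriv b s) volume x y :=
  hβ.intervalIntegrable.mul_continuousOn (hb.continuous_deriv le_rfl).continuousOn

theorem continuous_energy (hb : ContDiff ℝ 1 b) (hβ : Monotone β) (a : ℝ) :
    Continuous (energy b β a) :=
  intervalIntegral.continuous_primitive (intervalIntegrable_mul_deriv hb hβ) a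

theorem energy_self (a : ℝ) : energy b β a a = 0 := intervalIntegral.integral_same

theorem energy_sub_le (hb : ContDiff ℝ 1 b) (hb_mono : Monotone b) (hβ : Monotone β)
    (a q q' : ℝ) : energy b β a q - energy b β a q' ≤ (b q - b q') * β q := by
  have deriv_nonneg (s : ℝ) : 0 ≤ deriv b s := hb_mono.deriv_nonneg
  have integrable (x y : ℝ) := intervalIntegrable_mul_deriv hb hβ x y
  have integrable_const (x y : ℝ) : IntervalIntegrable (fun s => β q * deriv b s) volume x y :=
    (continuous_const.mul (hb.continuous_deriv le_rfl)).intervalIntegrable x y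
  have integral_const (x y : ℝ) : ∫ s in x..y, β q * deriv b s = β q * (b y - b x) := by
    rw [intervalIntegral.integral_const_mul, intervalIntegral.integral_deriv_eq_sub
      (fun s _ => hb.differentiable one_ne_zero s)
      ((hb.continuous_deriv le_rfl).intervalIntegrable x y)]
  unfold energy
  rw [intervalIntegral.integral_interval_sub_left (integrable _ _) (integrable _ _), mul_comm]
  rcases le_total q' q with hq | hq
  · rw [← integral_const]
    exact intervalIntegral.integral_mono_on hq (integrable _ _) (integrable_const _ _) fun s hs =>
      mul_le_mul_of_nonneg_right (hβ hs.2) (deriv_nonneg s)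
  · rw [← neg_sub (b q'), mul_neg, ← integral_const, intervalIntegral.integral_symm, neg_le_neg_iff]
    exact intervalIntegral.integral_mono_on hq (integrable_const _ _) (integrable _ _) fun s hs =>
      mul_le_mul_of_nonneg_right (hβ hs.1) (deriv_nonneg s)

theorem energy_nonneg (hb : ContDiff ℝ 1 b) (hb_mono : Monotone b) (hβ : Monotone β) {a : ℝ}
    (ha : β a = 0) (q : ℝ) : 0 ≤ energy b β a q := by
  simpa [energy_self, ha] using energy_sub_le hb hb_mono hβ a a q

theorem energy_nonpos_of_apply_eq_zero (hb : ContDiff ℝ 1 b) (hb_mono : Monotone b)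
    (hβ : Monotone β) (a : ℝ) {q : ℝ} (hq : β q = 0) : energy b β a q ≤ 0 := by
  simpa [energy_self, hq] using energy_sub_le hb hb_mono hβ a q a

variable {α : Type*} [MeasurableSpace α] {μ : Measure α} [IsFiniteMeasure μ]

theorem integrable_energy_comp (hb : ContDiff ℝ 1 b) (hb_mono : Monotone b) (hβ : Monotone β)
    (a : ℝ) {f : α → ℝ} (hf : AEStronglyMeasurable f μ) (hbf : MemLp (fun x => b (f x)) 2 μ)
    (hβf : MemLp (fun x => β (f x)) 2 μ) : Integrable (fun x => energy b β a (f x)) μ := by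
  have diff_memLp : MemLp (fun x => b (f x) - b a) 2 μ := hbf.sub (memLp_const _)
  have majorant : Integrable (fun x => |(b (f x) - b a) * β (f x)| + |(b (f x) - b a) * β a|) μ :=
    (diff_memLp.integrable_mul hβf).abs.add ((diff_memLp.integrable one_le_two).mul_const _).abs
  refine majorant.mono'
    ((continuous_energy hb hβ a).comp_aestronglyMeasurable hf) (Eventually.of_forall fun x => ?_)
  have upper := energy_sub_le hb hb_mono hβ a (f x) a
  have lower := energy_sub_le hb hb_mono hβ a a (f x)
  rw [energy_self] at upper lower
  rw [Real.norm_eq_abs, abs_le]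
  constructor
  · linarith [neg_abs_le ((b (f x) - b a) * β a), abs_nonneg ((b (f x) - b a) * β (f x))]
  · linarith [le_abs_self ((b (f x) - b a) * β (f x)), abs_nonneg ((b (f x) - b a) * β a)]

theorem integral_energy_sub_le_inner (hb : ContDiff ℝ 1 b) (hb_mono : Monotone b)
    (hβ : Monotone β) (a : ℝ) {f f' : α → ℝ} (hf : AEStronglyMeasurable f μ)
    (hf' : AEStronglyMeasurable f' μ) {y y' q q' : Lp ℝ 2 μ} (hy : y =ᵐ[μ] fun x => b (f x))
    (hy' : y' =ᵐ[μ] fun x => b (f' x)) (hq : q =ᵐ[μ] fun x => β (f x))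
    (hq' : q' =ᵐ[μ] fun x => β (f' x)) :
    (∫ x, energy b β a (f x) ∂μ) - ∫ x, energy b β a (f' x) ∂μ ≤ inner ℝ (y - y') q := by
  have integrable := integrable_energy_comp hb hb_mono hβ a hf ((memLp_congr_ae hy).1 (Lp.memLp y))
    ((memLp_congr_ae hq).1 (Lp.memLp q))
  have integrable' := integrable_energy_comp hb hb_mono hβ a hf'
    ((memLp_congr_ae hy').1 (Lp.memLp y')) ((memLp_congr_ae hq').1 (Lp.memLp q'))
  rw [← integral_sub integrable integrable', inner_L2_eq_integral]
  refine integral_mono_ae (integrable.sub integrable')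
    ((Lp.memLp (y - y')).integrable_mul (Lp.memLp q)) ?_
  filter_upwards [hy, hy', hq, Lp.coeFn_sub y y'] with x hyx hyx' hqx hsub
  rw [hqx, hsub, Pi.sub_apply, hyx, hyx']
  exact energy_sub_le hb hb_mono hβ a _ _

end Energy

/-! ### Solutions as curves in `L²(Ω)` -/

theorem ScanningFunction.exists_lipschitz {pci pcd b : ℝ → ℝ} (hb : ScanningFunction pci pcd b) :
    ∃ B : NNReal, 0 < B ∧ LipschitzWith B b := by
  obtain ⟨B, hB⟩ := hb.deriv_bdd
  refine ⟨Real.toNNReal (max B 1), Real.toNNReal_pos.2 (zero_lt_one.trans_le (le_max_right B 1)),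
    lipschitzWith_of_nnnorm_deriv_le (hb.contDiff.differentiable one_ne_zero) fun q => ?_⟩
  rw [← NNReal.coe_le_coe, coe_nnnorm, Real.norm_of_nonneg hb.mono.deriv_nonneg,
    Real.coe_toNNReal _ (zero_le_one.trans (le_max_right B 1))]
  exact (hB q).trans (le_max_left _ _)

section InnerComp

variable {X H α : Type*} [NormedAddCommGroup X] [NormedSpace ℝ X] [NormedAddCommGroup H]
  [InnerProductSpace ℝ H] [MeasurableSpace α] {μ : Measure α} {V : α → H}

theorem memLp_innerSL_comp (ι : X →L[ℝ] H) (hV : MemLp V 2 μ) :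
    MemLp (fun a => (innerSL ℝ (V a)).comp ι) 2 μ :=
  (((ContinuousLinearMap.compL ℝ X H ℝ).flip ι).comp (innerSL ℝ)).comp_memLp' hV

theorem memLp_innerSL_comp_sub (ι : X →L[ℝ] H) (hV : MemLp V 2 μ) {U : α → StrongDual ℝ X}
    (hU : MemLp U 2 μ) : MemLp (fun a => (innerSL ℝ (V a)).comp ι - U a) 2 μ :=
  MemLp.sub (E := StrongDual ℝ X) (memLp_innerSL_comp ι hV) hU

end InnerComp

section Solutions

variable {d : ℕ} {Ω : Set (EuclideanSpace ℝ (Fin d))} {T : ℝ}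

/-- The embedding of `H¹₀(Ω)` into `L²(Ω)`. -/
noncomputable def fstH10 (Ω : Set (EuclideanSpace ℝ (Fin d))) :
    H10 Ω →L[ℝ] Lp ℝ 2 (volume.restrict Ω) :=
  (WithLp.fstL 2 ℝ _ _).comp (H10 Ω).subtypeL

/-- The weak gradient as an operator on `H¹₀(Ω)`. -/
noncomputable def sndH10 (Ω : Set (EuclideanSpace ℝ (Fin d))) :
    H10 Ω →L[ℝ] Lp (EuclideanSpace ℝ (Fin d)) 2 (volume.restrict Ω) :=
  (WithLp.sndL 2 ℝ _ _).comp (H10 Ω).subtypeL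

theorem IsW.memLp_Q [IsFiniteMeasure (volume.restrict Ω)]
    {w : EuclideanSpace ℝ (Fin d) × ℝ → ℝ} {W : ℝ → H10 Ω} {W' : ℝ → Hneg Ω}
    (h : IsW Ω T w W W') : MemLp w 2 (volume.restrict (Q Ω T)) := by
  have hmeas := h.meas
  rw [restrict_Q] at hmeas ⊢
  exact memLp_prod_of_L2_curve hmeas ((fstH10 Ω).comp_memLp' h.memLp) h.repr

theorem IsW.memLp_Q_of_sub [IsFiniteMeasure (volume.restrict Ω)]
    {w : EuclideanSpace ℝ (Fin d) × ℝ → ℝ} {w₀ : EuclideanSpace ℝ (Fin d) → ℝ} {W : ℝ → H10 Ω}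
    {W' : ℝ → Hneg Ω} (h : IsW Ω T (fun z => w z - w₀ z.1) W W')
    (hw₀ : MemLp w₀ 2 (volume.restrict Ω)) : MemLp w 2 (volume.restrict (Q Ω T)) := by
  have hw₀_Q : MemLp (fun z : EuclideanSpace ℝ (Fin d) × ℝ => w₀ z.1) 2
      (volume.restrict (Q Ω T)) := restrict_Q Ω T ▸ hw₀.comp_fst _
  simpa only [Pi.add_def, sub_add_cancel] using h.memLp_Q.add hw₀_Q

/-- A pair `(S, p)` with `p`, `S - S₀` in `𝓦` and `∂ₜ(S + b(p))` in `L²(Q)`, together with its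
derivatives and its representatives as curves: `v' = ∂ₜ(S + b(p))`, `P` is `p` as a curve in
`H¹₀(Ω)`, `R' = ∂ₜS`, and `c`, `r`, `V`, `V'` are `p`, `S - S₀`, `S + b(p)`, `v'` as curves
in `L²(Ω)`. -/
structure SolutionCurves (Ω : Set (EuclideanSpace ℝ (Fin d))) (T : ℝ) (b : ℝ → ℝ)
    (S₀ p₀ : EuclideanSpace ℝ (Fin d) → ℝ) (S p : EuclideanSpace ℝ (Fin d) × ℝ → ℝ) where
  v' : EuclideanSpace ℝ (Fin d) × ℝ → ℝ
  P : ℝ → H10 Ω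
  R' : ℝ → Hneg Ω
  c : ℝ → Lp ℝ 2 (volume.restrict Ω)
  r : ℝ → Lp ℝ 2 (volume.restrict Ω)
  V : ℝ → Lp ℝ 2 (volume.restrict Ω)
  V' : ℝ → Lp ℝ 2 (volume.restrict Ω)
  memLp_S : MemLp S 2 (volume.restrict (Q Ω T))
  memLp_p : MemLp p 2 (volume.restrict (Q Ω T))
  memLp_v' : MemLp v' 2 (volume.restrict (Q Ω T))
  memLp_P : MemLp P 2 (volume.restrict (Ioc 0 T))
  memLp_R' : MemLp R' 2 (volume.restrict (Ioc 0 T))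
  memLp_V' : MemLp V' 2 (volume.restrict (Ioc 0 T))
  cont_c : ContinuousOn c (Icc 0 T)
  cont_V : ContinuousOn V (Icc 0 T)
  P_ae : ∀ᵐ t ∂volume.restrict (Ioc 0 T),
    (P t : Pairs Ω).fst =ᵐ[volume.restrict Ω] fun x => p (x, t)
  c_ae : ∀ᵐ t ∂volume.restrict (Ioc 0 T), c t =ᵐ[volume.restrict Ω] fun x => p (x, t)
  V_ae : ∀ᵐ t ∂volume.restrict (Ioc 0 T),
    V t =ᵐ[volume.restrict Ω] fun x => S (x, t) + b (p (x, t))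
  V'_ae : ∀ᵐ t ∂volume.restrict (Ioc 0 T), V' t =ᵐ[volume.restrict Ω] fun x => v' (x, t)
  c_zero : c 0 =ᵐ[volume.restrict Ω] p₀
  r_zero : r 0 =ᵐ[volume.restrict Ω] 0
  V_eq : ∀ t, V t =ᵐ[volume.restrict Ω] fun x => r t x + S₀ x + b (c t x)
  inner_V : ∀ φ, ∀ t ∈ Icc 0 T, inner ℝ (V t - V 0) φ = ∫ s in Ioc 0 t, inner ℝ (V' s) φ
  inner_r : ∀ φ : H10 Ω, ∀ t ∈ Icc 0 T,
    inner ℝ (r t - r 0) (φ : Pairs Ω).fst = ∫ s in Ioc 0 t, R' s φ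

variable {b : ℝ → ℝ} {S₀ p₀ : EuclideanSpace ℝ (Fin d) → ℝ}
  {S p : EuclideanSpace ℝ (Fin d) × ℝ → ℝ}

theorem coeFn_add_add_compLp {α : Type*} [MeasurableSpace α] {μ : Measure α} {B : NNReal}
    (hB : LipschitzWith B b) (hb_zero : b 0 = 0) {s : α → ℝ} (hs : MemLp s 2 μ)
    (f g : Lp ℝ 2 μ) :
    ↑(f + hs.toLp s + hB.compLp hb_zero g) =ᵐ[μ] fun x => f x + s x + b (g x) := by
  filter_upwards [Lp.coeFn_add (f + hs.toLp s) (hB.compLp hb_zero g), Lp.coeFn_add f (hs.toLp s),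
    hs.coeFn_toLp, hB.coeFn_compLp hb_zero g] with x hsum hsum' hsx hbx
  rw [hsum, Pi.add_apply, hsum', Pi.add_apply, hsx, hbx, Function.comp_apply]

theorem exists_solutionCurves (hΩ : IsOpen Ω) [IsFiniteMeasure (volume.restrict Ω)] (hT : 0 < T)
    {B : NNReal} (hB : LipschitzWith B b) (hb_zero : b 0 = 0)
    (hS₀ : MemLp S₀ 2 (volume.restrict Ω)) {v' : EuclideanSpace ℝ (Fin d) × ℝ → ℝ}
    {P R : ℝ → H10 Ω} {P' R' : ℝ → Hneg Ω}
    (hP : IsW Ω T p P P') (hR : IsW Ω T (fun z => S z - S₀ z.1) R R')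
    (hP_zero : HasInitial Ω T P p₀) (hR_zero : HasInitial Ω T R 0)
    (hv : HasWeakTimeDeriv Ω T (fun z => S z + b (p z)) v') :
    ∃ h : SolutionCurves Ω T b S₀ p₀ S p, h.v' = v' ∧ h.P = P ∧ h.R' = R' := by
  obtain ⟨c, hc_cont, hc, hc_zero⟩ := hP_zero
  obtain ⟨r, hr_cont, hr, hr_zero⟩ := hR_zero
  obtain ⟨V', hV', hV'_ae⟩ := exists_L2_curve (restrict_Q Ω T ▸ hv.1)
  let V (t : ℝ) : Lp ℝ 2 (volume.restrict Ω) := r t + hS₀.toLp S₀ + hB.compLp hb_zero (c t)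
  have hV_cont : ContinuousOn V (Icc 0 T) := (hr_cont.add continuousOn_const).add
    ((hB.continuous_compLp hb_zero).comp_continuousOn hc_cont)
  have hV_eq (t : ℝ) : V t =ᵐ[volume.restrict Ω] fun x => r t x + S₀ x + b (c t x) :=
    coeFn_add_add_compLp hB hb_zero hS₀ (r t) (c t)
  have hc_ae : ∀ᵐ t ∂volume.restrict (Ioc 0 T), c t =ᵐ[volume.restrict Ω] fun x => p (x, t) := by
    filter_upwards [hc, hP.repr] with t ht hPt
    exact ht ▸ hPt
  have hV_ae : ∀ᵐ t ∂volume.restrict (Ioc 0 T),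
      V t =ᵐ[volume.restrict Ω] fun x => S (x, t) + b (p (x, t)) := by
    filter_upwards [hc_ae, hr, hR.repr] with t hct hrt hRt
    filter_upwards [hV_eq t, hct, hRt] with x hVx hcx hRx
    rw [hVx, hrt, hRx, hcx, sub_add_cancel]
  have hS := hR.memLp_Q_of_sub hS₀
  have hv_Q : MemLp (fun z => S z + b (p z)) 2 (volume.restrict (Q Ω T)) :=
    hS.add (hB.comp_memLp hb_zero hP.memLp_Q)
  exact ⟨{
    v' := v', P := P, R' := R', c := c, r := r, V := V, V' := V'
    memLp_S := hS, memLp_p := hP.memLp_Q, memLp_v' := hv.1, memLp_P := hP.memLp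
    memLp_R' := hR.memLp', memLp_V' := hV', cont_c := hc_cont, cont_V := hV_cont
    P_ae := hP.repr, c_ae := hc_ae, V_ae := hV_ae, V'_ae := hV'_ae
    c_zero := hc_zero, r_zero := hr_zero, V_eq := hV_eq
    inner_V := hv.inner_sub_eq hΩ hT hv_Q hV_cont hV_ae (hV'.integrable one_le_two) hV'_ae
    inner_r := hR.inner_sub_eq hT hr_cont hr }, rfl, rfl, rfl⟩

namespace SolutionCurves

theorem V_zero (h : SolutionCurves Ω T b S₀ p₀ S p) :
    h.V 0 =ᵐ[volume.restrict Ω] fun x => S₀ x + b (p₀ x) := by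
  filter_upwards [h.V_eq 0, h.r_zero, h.c_zero] with x hV hr hc
  rw [hV, hr, hc, Pi.zero_apply, zero_add]

theorem compLp_sub_eq (h : SolutionCurves Ω T b S₀ p₀ S p) {B : NNReal} (hB : LipschitzWith B b)
    (hb_zero : b 0 = 0) (t : ℝ) :
    hB.compLp hb_zero (h.c t) - hB.compLp hb_zero (h.c 0) = (h.V t - h.V 0) - (h.r t - h.r 0) := by
  refine Lp.ext ?_
  filter_upwards [h.V_eq t, h.V_eq 0, Lp.coeFn_sub (h.V t - h.V 0) (h.r t - h.r 0),
    Lp.coeFn_sub (h.V t) (h.V 0), Lp.coeFn_sub (h.r t) (h.r 0),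
    Lp.coeFn_sub (hB.compLp hb_zero (h.c t)) (hB.compLp hb_zero (h.c 0)),
    hB.coeFn_compLp hb_zero (h.c t), hB.coeFn_compLp hb_zero (h.c 0)]
    with x hVt hV0 hsub hV hr hb hbt hb0
  simp only [hsub, hV, hr, hb, hVt, hV0, hbt, hb0, Pi.sub_apply, Function.comp_apply]
  ring

theorem inner_compLp_sub_eq (h : SolutionCurves Ω T b S₀ p₀ S p) {B : NNReal}
    (hB : LipschitzWith B b) (hb_zero : b 0 = 0) (φ : H10 Ω) :
    ∀ t ∈ Icc 0 T, inner ℝ (hB.compLp hb_zero (h.c t) - hB.compLp hb_zero (h.c 0)) (fstH10 Ω φ)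
      = ∫ s in Ioc 0 t, ((innerSL ℝ (h.V' s)).comp (fstH10 Ω) - h.R' s) φ := by
  intro t ht
  have hsub : volume.restrict (Ioc 0 t) ≤ volume.restrict (Ioc 0 T) :=
    Measure.restrict_mono (Ioc_subset_Ioc_right ht.2) le_rfl
  have hV'_int : IntegrableOn (fun s => inner ℝ (h.V' s) (fstH10 Ω φ)) (Ioc 0 t) :=
    ((h.memLp_V'.integrable one_le_two).mono_measure hsub).inner_const _
  have hR'_int : IntegrableOn (fun s => h.R' s φ) (Ioc 0 t) :=
    (integrable_dual_apply h.memLp_R' (memLp_const φ)).mono_measure hsub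
  rw [compLp_sub_eq, inner_sub_left, h.inner_V _ t ht]
  exact (congrArg _ (h.inner_r φ t ht)).trans (integral_sub hV'_int hR'_int).symm

variable [IsFiniteMeasure (volume.restrict Ω)]

theorem sub_integral_energy_id_le (h : SolutionCurves Ω T b S₀ p₀ S p) (hT : 0 < T)
    (hb : Continuous b) {θ : ℝ → ℝ} (hθ : Monotone θ) {K : ℝ} (hK : ∀ s, |θ s| ≤ K) (a : ℝ) {m : ℝ}
    (hm : ∀ᵐ t ∂volume.restrict (Ioc 0 T),
      m ≤ ∫ x in Ω, energy id θ a (S (x, t) + b (p (x, t)))) :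
    m - ∫ x in Ω, energy id θ a (S₀ x + b (p₀ x)) ≤ ∫ z in Q Ω T, h.v' z * θ (S z + b (p z)) := by
  have memLp_comp {α : Type _} [MeasurableSpace α] {μ : Measure α} [IsFiniteMeasure μ] {f : α → ℝ}
      (hf : AEStronglyMeasurable f μ) : MemLp (fun x => θ (f x)) 2 μ :=
    .of_bound (hθ.measurable.comp_aemeasurable hf.aemeasurable).aestronglyMeasurable K
      (Eventually.of_forall fun x => hK _)
  have := isFiniteMeasure_restrict_Q (Ω := Ω) T
  have hθ_Q : MemLp (fun z => θ (S z + b (p z))) 2 (volume.restrict (Q Ω T)) :=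
    memLp_comp (h.memLp_S.1.add (hb.comp_aestronglyMeasurable h.memLp_p.1))
  obtain ⟨W, hW, hW_ae⟩ := exists_L2_curve (restrict_Q Ω T ▸ hθ_Q)
  let q (t : ℝ) := (memLp_comp (Lp.aestronglyMeasurable (h.V t))).toLp _
  have hq (t : ℝ) : q t =ᵐ[volume.restrict Ω] fun x => θ (h.V t x) := MemLp.coeFn_toLp _
  rw [restrict_Q, integral_prod_eq_integral_inner (restrict_Q Ω T ▸ h.memLp_v')
    (restrict_Q Ω T ▸ hθ_Q) h.V'_ae hW_ae, integral_congr_ae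
    (show (fun x => energy id θ a (S₀ x + b (p₀ x))) =ᵐ[volume.restrict Ω] _ from
      h.V_zero.symm.fun_comp (energy id θ a))]
  refine sub_le_integral_of_subgradient hT (.id ℝ _) h.cont_V
    (memLp_innerSL_comp (.id ℝ _) h.memLp_V') h.inner_V hW (q := q)
    (fun t _ => Lp.norm_le_of_ae_bound ((abs_nonneg _).trans (hK 0)) ?_) ?_
    (J := fun t => ∫ x in Ω, energy id θ a (h.V t x))
    (fun s _ t _ => integral_energy_sub_le_inner contDiff_id monotone_id hθ a
      (Lp.aestronglyMeasurable _) (Lp.aestronglyMeasurable _) .rfl .rfl (hq t) (hq s)) ?_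
  · filter_upwards [hq t] with x hx
    exact hx ▸ hK _
  · filter_upwards [hW_ae, h.V_ae] with t hWt hVt
    exact Lp.ext (hWt.trans ((hVt.fun_comp θ).symm.trans (hq t).symm))
  · filter_upwards [hm, h.V_ae] with t hmt hVt
    exact hmt.trans_eq (integral_congr_ae (hVt.fun_comp (energy id θ a)).symm)

theorem neg_integral_energy_le (h : SolutionCurves Ω T b S₀ p₀ S p) (hT : 0 < T)
    (hb : ContDiff ℝ 1 b) (hb_mono : Monotone b) {B : NNReal} (hB : LipschitzWith B b)
    (hb_zero : b 0 = 0) {β : ℝ → ℝ} (hβ_mono : Monotone β) {K : NNReal} (hβ : LipschitzWith K β)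
    (hβ_zero : β 0 = 0) {W : ℝ → H10 Ω} (hW : MemLp W 2 (volume.restrict (Ioc 0 T)))
    (hWβ : ∀ᵐ t ∂volume.restrict (Ioc 0 T),
      (W t : Pairs Ω).fst =ᵐ[volume.restrict Ω] fun x => β (p (x, t))) {a : ℝ} (ha : β a = 0) :
    -∫ x in Ω, energy b β a (p₀ x)
      ≤ (∫ z in Q Ω T, h.v' z * β (p z)) - ∫ t in Ioc 0 T, h.R' t (W t) := by
  obtain ⟨M, hM⟩ := isCompact_Icc.exists_bound_of_continuousOn h.cont_c
  have integral_v' : ∫ z in Q Ω T, h.v' z * β (p z)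
      = ∫ t in Ioc 0 T, (innerSL ℝ (h.V' t)).comp (fstH10 Ω) (W t) := by
    rw [restrict_Q]
    exact integral_prod_eq_integral_inner (restrict_Q Ω T ▸ h.memLp_v')
      (restrict_Q Ω T ▸ hβ.comp_memLp hβ_zero h.memLp_p) h.V'_ae hWβ
  rw [integral_v', ← integral_sub
      (integrable_dual_apply (memLp_innerSL_comp (fstH10 Ω) h.memLp_V') hW)
      (integrable_dual_apply h.memLp_R' hW), ← zero_sub,
    integral_congr_ae (show (fun x => energy b β a (p₀ x)) =ᵐ[volume.restrict Ω] _ from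
      h.c_zero.symm.fun_comp (energy b β a))]
  refine sub_le_integral_of_subgradient hT (fstH10 Ω)
    (y := fun t => hB.compLp hb_zero (h.c t))
    ((hB.continuous_compLp hb_zero).comp_continuousOn h.cont_c)
    (memLp_innerSL_comp_sub (fstH10 Ω) h.memLp_V' h.memLp_R') (h.inner_compLp_sub_eq hB hb_zero) hW
    (q := fun t => hβ.compLp hβ_zero (h.c t))
    (fun t ht => (hβ.norm_compLp_le hβ_zero _).trans
      (mul_le_mul_of_nonneg_left (hM t ht) K.coe_nonneg)) ?_
    (J := fun t => ∫ x in Ω, energy b β a (h.c t x))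
    (fun s _ t _ => integral_energy_sub_le_inner hb hb_mono hβ_mono a
      (Lp.aestronglyMeasurable _) (Lp.aestronglyMeasurable _) (hB.coeFn_compLp hb_zero _)
      (hB.coeFn_compLp hb_zero _) (hβ.coeFn_compLp hβ_zero _) (hβ.coeFn_compLp hβ_zero _))
    (Eventually.of_forall fun t => integral_nonneg fun x => energy_nonneg hb hb_mono hβ_mono ha _)
  filter_upwards [hWβ, h.c_ae] with t hWt hct
  exact Lp.ext (hWt.trans ((hct.fun_comp β).symm.trans (hβ.coeFn_compLp hβ_zero (h.c t)).symm))

end SolutionCurves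

end Solutions

/-! ### The regularised hysteresis relation -/

theorem posPart_nonneg (x : ℝ) : 0 ≤ posPart x := le_max_right _ _

theorem posPart_of_nonneg {x : ℝ} (hx : 0 ≤ x) : posPart x = x := max_eq_left hx

theorem posPart_of_nonpos {x : ℝ} (hx : x ≤ 0) : posPart x = 0 := max_eq_right hx

theorem continuous_posPart : Continuous posPart := continuous_id.max continuous_const

theorem posPart_le_abs (x : ℝ) : posPart x ≤ |x| := max_le (le_abs_self x) (abs_nonneg x)

theorem posPart_mul_nonneg {x y : ℝ} (h : 0 < x → 0 ≤ y) : 0 ≤ posPart x * y := by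
  rcases le_or_gt x 0 with hx | hx
  · rw [posPart_of_nonpos hx, zero_mul]
  · exact mul_nonneg (posPart_nonneg x) (h hx)

theorem sq_posPart_le_posPart_mul {x y : ℝ} (h : 0 < x → x ≤ y) :
    posPart x ^ 2 ≤ posPart x * y := by
  rcases le_or_gt x 0 with hx | hx
  · rw [posPart_of_nonpos hx, sq, zero_mul, zero_mul]
  · rw [sq, posPart_of_nonneg hx.le]
    exact mul_le_mul_of_nonneg_left (h hx) hx.le

/-- The distance of `u` above the drainage curve. -/
noncomputable def drainageExcess (pcd b : ℝ → ℝ) (u v : ℝ) : ℝ := posPart (u - rho pcd b v)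

/-- The distance of `u` below the imbibition curve. -/
noncomputable def imbibitionDeficit (pci b : ℝ → ℝ) (u v : ℝ) : ℝ := posPart (rho pci b v - u)

/-- The pressure on the curve `u = ρ(v)`, truncated at the level `M` because `ρ(v)` may attain the
value `b(∞)`. -/
noncomputable def curvePressure (pc b : ℝ → ℝ) (M v : ℝ) : ℝ :=
  Function.invFunOn b (Ici (pc 1)) (min (b M) (rho pc b v))

namespace IsScanCurve

variable {pc b : ℝ → ℝ} {M s q v : ℝ}

theorem exists_b_eq_min (h : IsScanCurve pc b) (hM : pc 1 ≤ M) (v : ℝ) :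
    ∃ q ∈ Ici (pc 1), b q = min (b M) (rho pc b v) := by
  obtain ⟨q, hq, hbq⟩ := intermediate_value_Icc hM h.contDiff_b.continuous.continuousOn
    ⟨le_min (h.monotone_b hM) (h.Um_le_rho v), min_le_left (b M) (rho pc b v)⟩
  exact ⟨q, hq.1, hbq⟩

theorem b_curvePressure (h : IsScanCurve pc b) (hM : pc 1 ≤ M) (v : ℝ) :
    b (curvePressure pc b M v) = min (b M) (rho pc b v) :=
  Function.invFunOn_eq (h.exists_b_eq_min hM v)

theorem le_curvePressure (h : IsScanCurve pc b) (hM : pc 1 ≤ M) (v : ℝ) :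
    pc 1 ≤ curvePressure pc b M v :=
  Function.invFunOn_mem (h.exists_b_eq_min hM v)

theorem curvePressure_le_of_min_le (h : IsScanCurve pc b) (hM : pc 1 ≤ M) (hq : pc 1 ≤ q)
    (hv : min (b M) (rho pc b v) ≤ b q) : curvePressure pc b M v ≤ q := by
  rw [← h.b_curvePressure hM] at hv
  exact (h.strictMonoOn_b.le_iff_le (h.le_curvePressure hM v) hq).1 hv

theorem curvePressure_le (h : IsScanCurve pc b) (hM : pc 1 ≤ M) (v : ℝ) :
    curvePressure pc b M v ≤ M :=
  h.curvePressure_le_of_min_le hM hM (min_le_left _ _)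

theorem curvePressure_eq_of_b_le_rho (h : IsScanCurve pc b) (hM : pc 1 ≤ M)
    (hv : b M ≤ rho pc b v) : curvePressure pc b M v = M :=
  h.strictMonoOn_b.injOn (h.le_curvePressure hM v) hM
    ((h.b_curvePressure hM v).trans (min_eq_left hv))

theorem antitone_curvePressure (h : IsScanCurve pc b) (hM : pc 1 ≤ M) :
    Antitone (curvePressure pc b M) := fun v _ hvw =>
  h.curvePressure_le_of_min_le hM (h.le_curvePressure hM v)
    ((min_le_min le_rfl (h.antitone_rho hvw)).trans_eq (h.b_curvePressure hM v).symm)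

theorem abs_curvePressure_le (h : IsScanCurve pc b) (hM : pc 1 ≤ M) (v : ℝ) :
    |curvePressure pc b M v| ≤ max |pc 1| |M| :=
  abs_le_max_abs_abs (h.le_curvePressure hM v) (h.curvePressure_le hM v)

theorem abs_curvePressure_le_of_add_b_pc_le (h : IsScanCurve pc b) (hM : pc 1 ≤ M)
    (hs : s ∈ Ioc 0 1) (hv : s + b (pc s) ≤ v) :
    |curvePressure pc b M v| ≤ max |pc 1| |pc s| :=
  abs_le_max_abs_abs (h.le_curvePressure hM v) <| h.curvePressure_le_of_min_le hM (h.pc_one_le hs)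
    ((min_le_right _ _).trans ((h.antitone_rho hv).trans_eq (h.rho_add_b_pc hs)))

theorem rho_lt_UM (h : IsScanCurve pc b) (hv : UM b < v) : rho pc b v < UM b := by
  rcases le_or_gt (VM pc b) v with hVM | hVM
  · rw [h.rho_of_ge hVM]
    exact h.b_lt_UM _
  · obtain ⟨s, -, -, hs⟩ := h.exists_add_b_pc_eq hv hVM.le
    rw [hs]
    exact h.b_lt_UM _

theorem neg_le_energy_curvePressure (h : IsScanCurve pc b) (hM : pc 1 ≤ M) (hs : s ∈ Ioc 0 1)
    (hv : UM b < v) (hv' : v ≤ 1 + UM b) :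
    -max |pc 1| |pc s| ≤ energy id (fun w => -curvePressure pc b M w) (s + b (pc s)) v := by
  have lower := energy_sub_le contDiff_id monotone_id (h.antitone_curvePressure hM).neg
    (s + b (pc s)) (s + b (pc s)) v
  have dist_le : |s + b (pc s) - v| ≤ 1 := abs_le.2
    ⟨by linarith [h.UM_lt_add_b_pc hs], by linarith [h.b_lt_UM (pc s), hs.2]⟩
  have bound : (s + b (pc s) - v) * -curvePressure pc b M (s + b (pc s)) ≤ max |pc 1| |pc s| :=
    (le_abs_self _).trans <| by
      rw [abs_mul, abs_neg]
      exact (mul_le_of_le_one_left (abs_nonneg _) dist_le).trans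
        (h.abs_curvePressure_le_of_add_b_pc_le hM hs le_rfl)
  rw [energy_self, zero_sub] at lower
  exact neg_le.2 (lower.trans bound)

theorem energy_curvePressure_le (h : IsScanCurve pc b) (hM : pc 1 ≤ M) (hs : s ∈ Ioc 0 1)
    (hv : s + b (pc s) ≤ v) (hv' : v ≤ 1 + UM b) :
    energy id (fun w => -curvePressure pc b M w) (s + b (pc s)) v ≤ max |pc 1| |pc s| := by
  have upper := energy_sub_le contDiff_id monotone_id (h.antitone_curvePressure hM).neg
    (s + b (pc s)) v (s + b (pc s))
  rw [energy_self, sub_zero] at upper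
  refine upper.trans ((le_abs_self _).trans ?_)
  rw [abs_mul, abs_neg]
  refine (mul_le_of_le_one_left (abs_nonneg _) (abs_le.2 ⟨?_, ?_⟩)).trans
    (h.abs_curvePressure_le_of_add_b_pc_le hM hs hv)
  all_goals simp only [id]; linarith [h.UM_lt_add_b_pc hs]

end IsScanCurve

section TwoCurves

variable {pci pcd b : ℝ → ℝ}

theorem Phi_eq (hpc : CapillaryCurves pci pcd) (hb : ScanningFunction pci pcd b) (τ u v : ℝ) :
    Phi pci pcd b τ u v = 1 / τ * (imbibitionDeficit pci b u v - drainageExcess pcd b u v) := by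
  have hle := rho_i_le_rho_d hpc hb v
  unfold Phi imbibitionDeficit drainageExcess
  split_ifs with hd hi
  · rw [posPart_of_nonpos (by linarith), posPart_of_nonneg (by linarith), zero_sub, neg_sub]
  · rw [posPart_of_nonneg (by linarith), posPart_of_nonpos (by linarith), sub_zero]
  · rw [posPart_of_nonpos (by linarith), posPart_of_nonpos (by linarith), sub_zero]

/-- The part of the dissipation controlled by the pressure `curvePressure pci b M`: the squared
distance to the hysteresis region where the truncation at `M` is inactive, and an error term
elsewhere. -/
noncomputable def truncatedDissipation (pci pcd b : ℝ → ℝ) (B M p v : ℝ) : ℝ :=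
  open Classical in
  if rho pci b v ≤ b M then
    drainageExcess pcd b (b p) v ^ 2 + imbibitionDeficit pci b (b p) v ^ 2
  else -(B * (imbibitionDeficit pci b (b p) v * |p|))

theorem le_mul_sub_of_lipschitzWith {B : NNReal} (hB : LipschitzWith B b) {x y : ℝ} (hxy : y ≤ x) :
    b x - b y ≤ B * (x - y) := by
  have := hB.dist_le_mul x y
  rw [Real.dist_eq, Real.dist_eq, abs_of_nonneg (sub_nonneg.2 hxy)] at this
  exact (le_abs_self _).trans this

theorem sq_excess_add_sq_deficit_le (hpc : CapillaryCurves pci pcd)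
    (hb : ScanningFunction pci pcd b) {B : NNReal} (hB : LipschitzWith B b) {p v w : ℝ}
    (hw : b w = rho pci b v) :
    drainageExcess pcd b (b p) v ^ 2 + imbibitionDeficit pci b (b p) v ^ 2
      ≤ -(B * ((imbibitionDeficit pci b (b p) v - drainageExcess pcd b (b p) v) * (p - w))) := by
  have hle := rho_i_le_rho_d hpc hb v
  unfold drainageExcess imbibitionDeficit
  have excess_sq : posPart (b p - rho pcd b v) ^ 2 ≤ posPart (b p - rho pcd b v) * (B * (p - w)) :=
    sq_posPart_le_posPart_mul fun hp => by
      have hwp : b w < b p := by linarith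
      linarith [le_mul_sub_of_lipschitzWith hB (hb.mono.reflect_lt hwp).le]
  have deficit_sq : posPart (rho pci b v - b p) ^ 2
      ≤ posPart (rho pci b v - b p) * (B * (w - p)) :=
    sq_posPart_le_posPart_mul fun hp => by
      have hpw : b p < b w := by linarith
      linarith [le_mul_sub_of_lipschitzWith hB (hb.mono.reflect_lt hpw).le]
  linarith

theorem neg_deficit_mul_abs_le (hpc : CapillaryCurves pci pcd) (hb : ScanningFunction pci pcd b)
    {M p v : ℝ} (hM : 0 ≤ M) (hv : b M < rho pci b v) :
    -(imbibitionDeficit pci b (b p) v * |p|)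
      ≤ -((imbibitionDeficit pci b (b p) v - drainageExcess pcd b (b p) v) * (p - M)) := by
  have hle := rho_i_le_rho_d hpc hb v
  unfold drainageExcess imbibitionDeficit
  have excess_nonneg : 0 ≤ posPart (b p - rho pcd b v) * (p - M) :=
    posPart_mul_nonneg fun hp => by
      have hMp : b M < b p := by linarith
      linarith [hb.mono.reflect_lt hMp]
  have deficit_nonneg : 0 ≤ posPart (rho pci b v - b p) * (M + (|p| - p)) :=
    posPart_mul_nonneg fun _ => add_nonneg hM (sub_nonneg.2 (le_abs_self p))
  linarith

theorem truncatedDissipation_le (hpc : CapillaryCurves pci pcd)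
    (hb : ScanningFunction pci pcd b) {B : NNReal} (hB : LipschitzWith B b) {M : ℝ}
    (hM : pci 1 ≤ M) (hM_nonneg : 0 ≤ M) (p v : ℝ) :
    truncatedDissipation pci pcd b B M p v
      ≤ -(B * ((imbibitionDeficit pci b (b p) v - drainageExcess pcd b (b p) v)
        * (p - curvePressure pci b M v))) := by
  have hi := hpc.isScanCurve_i hb
  unfold truncatedDissipation
  split_ifs with hv
  · exact sq_excess_add_sq_deficit_le hpc hb hB
      ((hi.b_curvePressure hM v).trans (min_eq_right hv))
  · rw [hi.curvePressure_eq_of_b_le_rho hM (not_le.1 hv).le, ← neg_le_neg_iff,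
      neg_neg, neg_neg]
    exact mul_le_mul_of_nonneg_left
      (neg_le_neg_iff.1 (neg_deficit_mul_abs_le hpc hb hM_nonneg (not_le.1 hv))) B.coe_nonneg

theorem excess_lt_deficit_of_le_UM (hpc : CapillaryCurves pci pcd)
    (hb : ScanningFunction pci pcd b) {p v : ℝ} (hv : v ≤ UM b) :
    drainageExcess pcd b (b p) v < imbibitionDeficit pci b (b p) v := by
  have hp := (hpc.isScanCurve_i hb).b_lt_UM p
  rw [drainageExcess, imbibitionDeficit, IsScanCurve.rho_of_le hv, IsScanCurve.rho_of_le hv,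
    posPart_of_nonpos (by linarith), posPart_of_nonneg (by linarith)]
  linarith

end TwoCurves

/-! ### The dissipation estimate -/

section Integral

variable {α : Type*} [MeasurableSpace α] {μ : Measure α}

theorem integral_le_mul_measureReal [IsFiniteMeasure μ] {f : α → ℝ} {C : ℝ} (hC : 0 ≤ C)
    (hf : ∀ᵐ x ∂μ, f x ≤ C) : ∫ x, f x ∂μ ≤ C * μ.real univ := by
  by_cases hf_int : Integrable f μ
  · have h := integral_mono_ae hf_int (integrable_const C) hf
    rwa [integral_const, smul_eq_mul, mul_comm] at h
  · rw [integral_undef hf_int]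
    exact mul_nonneg hC measureReal_nonneg

theorem neg_mul_measureReal_le_integral [IsFiniteMeasure μ] {f : α → ℝ} {C : ℝ} (hC : 0 ≤ C)
    (hf : ∀ᵐ x ∂μ, -C ≤ f x) : -(C * μ.real univ) ≤ ∫ x, f x ∂μ := by
  have h := integral_le_mul_measureReal hC (hf.mono fun x hx => neg_le.1 hx)
  rw [integral_neg] at h
  exact neg_le.1 h

theorem ae_eq_zero_of_nonpos_of_integral_nonneg {f : α → ℝ} (hf_int : Integrable f μ)
    (hf : ∀ᵐ x ∂μ, f x ≤ 0) (h : 0 ≤ ∫ x, f x ∂μ) : f =ᵐ[μ] 0 := by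
  have hneg : 0 ≤ᵐ[μ] -f := hf.mono fun x hx => neg_nonneg.2 hx
  have hzero : ∫ x, (-f) x ∂μ = 0 :=
    le_antisymm (by simpa only [Pi.neg_apply, integral_neg, neg_nonpos] using h)
      (integral_nonneg_of_ae hneg)
  filter_upwards [(integral_eq_zero_iff_of_nonneg_ae hneg hf_int.neg).1 hzero] with x hx
  exact neg_eq_zero.1 hx

theorem ae_eq_of_forall_integral_mul_eq {f g : α → ℝ} (hf : MemLp f 2 μ) (hg : MemLp g 2 μ)
    (h : ∀ ξ, MemLp ξ 2 μ → ∫ x, f x * ξ x ∂μ = ∫ x, g x * ξ x ∂μ) : f =ᵐ[μ] g := by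
  have hfg := hf.sub hg
  have hsq : ∫ x, (f - g) x ^ 2 ∂μ = 0 := by
    calc ∫ x, (f - g) x ^ 2 ∂μ = ∫ x, (f x * (f - g) x - g x * (f - g) x) ∂μ := by
          simp only [sq, Pi.sub_apply, sub_mul]
      _ = (∫ x, f x * (f - g) x ∂μ) - ∫ x, g x * (f - g) x ∂μ :=
          integral_sub (hf.integrable_mul hfg) (hg.integrable_mul hfg)
      _ = 0 := sub_eq_zero.2 (h _ hfg)
  rw [integral_eq_zero_iff_of_nonneg (fun _ => sq_nonneg _) hfg.integrable_sq] at hsq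
  filter_upwards [hsq] with x hx
  exact sub_eq_zero.1 ((pow_eq_zero_iff two_ne_zero).1 hx)

theorem monotone_indicator_Iic_neg_one (a : ℝ) :
    Monotone ((Iic a).indicator fun _ => (-1 : ℝ)) := by
  intro x y hxy
  by_cases hy : y ≤ a
  · rw [indicator_of_mem (mem_Iic.2 (hxy.trans hy)), indicator_of_mem (mem_Iic.2 hy)]
  · rw [indicator_of_notMem (notMem_Iic.2 (not_le.1 hy))]
    exact indicator_nonpos (fun _ _ => by norm_num) x

end Integral

section Curves

variable {α : Type*} [MeasurableSpace α] {μ : Measure α} {pc pci pcd b : ℝ → ℝ} {u v : α → ℝ}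

theorem memLp_posPart (hu : MemLp u 2 μ) : MemLp (fun z => posPart (u z)) 2 μ :=
  hu.mono (continuous_posPart.comp_aestronglyMeasurable hu.1) (Eventually.of_forall fun _ =>
    (Real.norm_of_nonneg (posPart_nonneg _)).trans_le (posPart_le_abs _))

variable [IsFiniteMeasure μ]

theorem IsScanCurve.memLp_rho_comp (h : IsScanCurve pc b) (hv : AEStronglyMeasurable v μ) :
    MemLp (fun z => rho pc b (v z)) 2 μ :=
  .of_bound (h.continuous_rho.comp_aestronglyMeasurable hv) (max |Um pc b| |UM b|)
    (Eventually.of_forall fun _ => abs_le_max_abs_abs (h.Um_le_rho _) (h.rho_le_UM _))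

theorem IsScanCurve.memLp_drainageExcess (h : IsScanCurve pcd b) (hu : MemLp u 2 μ)
    (hv : AEStronglyMeasurable v μ) : MemLp (fun z => drainageExcess pcd b (u z) (v z)) 2 μ :=
  memLp_posPart (hu.sub (h.memLp_rho_comp hv))

theorem IsScanCurve.memLp_imbibitionDeficit (h : IsScanCurve pci b) (hu : MemLp u 2 μ)
    (hv : AEStronglyMeasurable v μ) : MemLp (fun z => imbibitionDeficit pci b (u z) (v z)) 2 μ :=
  memLp_posPart ((h.memLp_rho_comp hv).sub hu)

theorem IsScanCurve.integrable_mul_curvePressure (h : IsScanCurve pc b) {M : ℝ} (hM : pc 1 ≤ M)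
    (hu : MemLp u 2 μ) (hv : AEStronglyMeasurable v μ) :
    Integrable (fun z => u z * curvePressure pc b M (v z)) μ :=
  (hu.integrable one_le_two).mul_bdd
    ((h.antitone_curvePressure hM).measurable.comp_aemeasurable
      hv.aemeasurable).aestronglyMeasurable
    (Eventually.of_forall fun _ => h.abs_curvePressure_le hM _)

end Curves

section Permeability

variable {k : ℝ → ℝ}

theorem Permeability.lt_one (hk : Permeability k) : k 0 < k 1 := by
  have h := hk.mid (1 / 2) ⟨by norm_num, by norm_num⟩
  exact h.1.trans h.2

theorem Permeability.mem_Icc (hk : Permeability k) (s : ℝ) : k s ∈ Icc 0 (k 1) := by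
  rcases le_or_gt s 0 with hs | hs
  · rw [hk.eq_left s hs]
    exact ⟨hk.nonneg, hk.lt_one.le⟩
  · rcases le_or_gt 1 s with hs' | hs'
    · rw [hk.eq_right s hs']
      exact ⟨hk.nonneg.trans hk.lt_one.le, le_rfl⟩
    · exact ⟨hk.nonneg.trans (hk.mid s ⟨hs, hs'⟩).1.le, (hk.mid s ⟨hs, hs'⟩).2.le⟩

theorem Permeability.neg_le_inner_flux {E : Type*} [NormedAddCommGroup E] [InnerProductSpace ℝ E]
    (hk : Permeability k) (s : ℝ) (g G : E) :
    -(k 1 * ‖g‖ ^ 2) ≤ inner ℝ (k s • (G - g)) G := by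
  obtain ⟨hks, hks'⟩ := hk.mem_Icc s
  have young : -‖g‖ ^ 2 ≤ inner ℝ (G - g) G := by
    rw [inner_sub_left, real_inner_self_eq_norm_sq]
    nlinarith [sq_nonneg (‖G‖ - ‖g‖), sq_nonneg ‖G‖, sq_nonneg ‖g‖, real_inner_le_norm g G]
  calc -(k 1 * ‖g‖ ^ 2) ≤ k s * -‖g‖ ^ 2 := by
        rw [mul_neg]
        exact neg_le_neg (mul_le_mul_of_nonneg_right hks' (sq_nonneg _))
    _ ≤ inner ℝ (k s • (G - g)) G := by
        rw [real_inner_smul_left]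
        exact mul_le_mul_of_nonneg_left young hks

end Permeability

section Solutions

variable {d : ℕ} {Ω : Set (EuclideanSpace ℝ (Fin d))} {T : ℝ} {pci pcd b k : ℝ → ℝ}
  {g : EuclideanSpace ℝ (Fin d)} {S₀ p₀ : EuclideanSpace ℝ (Fin d) → ℝ}

theorem InitialData.exists_scanning_bounds (h₀ : InitialData Ω pci pcd S₀ p₀)
    (hpc : CapillaryCurves pci pcd) (hb : ScanningFunction pci pcd b) :
    ∃ s ∈ Ioc (0 : ℝ) 1, ∀ᵐ x ∂volume.restrict Ω,
      s + b (pci s) ≤ S₀ x + b (p₀ x) ∧ S₀ x + b (p₀ x) ≤ 1 + UM b := by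
  have hi := hpc.isScanCurve_i hb
  obtain ⟨ε, hε, hS₀⟩ := h₀.bounds
  have hs : min ε 1 ∈ Ioc (0 : ℝ) 1 := ⟨lt_min hε one_pos, min_le_right _ _⟩
  refine ⟨min ε 1, hs, ?_⟩
  filter_upwards [hS₀, h₀.between] with x hSx hpx
  have hSx_mem : S₀ x ∈ Ioc (0 : ℝ) 1 := ⟨hε.trans_le hSx.1, by linarith⟩
  have hmono : min ε 1 + b (pci (min ε 1)) ≤ S₀ x + b (pci (S₀ x)) :=
    hi.strictMonoOn_id_add_b_pc.monotoneOn hs hSx_mem ((min_le_left _ _).trans hSx.1)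
  exact ⟨hmono.trans (by linarith [hb.mono hpx.1]), by linarith [hi.b_lt_UM (p₀ x), hSx_mem.2]⟩

theorem InitialData.ae_pc_one_le (h₀ : InitialData Ω pci pcd S₀ p₀)
    (hpc : CapillaryCurves pci pcd) (hb : ScanningFunction pci pcd b) :
    ∀ᵐ x ∂volume.restrict Ω, pci 1 ≤ p₀ x := by
  obtain ⟨ε, hε, hS₀⟩ := h₀.bounds
  filter_upwards [hS₀, h₀.between] with x hSx hpx
  exact ((hpc.isScanCurve_i hb).pc_one_le ⟨hε.trans_le hSx.1, by linarith⟩).trans hpx.1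

/-- A weak solution with chosen witnesses: its curves in the function spaces, together with the
two weak equations. -/
structure SolutionData (Ω : Set (EuclideanSpace ℝ (Fin d))) (T : ℝ) (pci pcd b k : ℝ → ℝ)
    (g : EuclideanSpace ℝ (Fin d)) (S₀ p₀ : EuclideanSpace ℝ (Fin d) → ℝ) (τ : ℝ)
    (S p : EuclideanSpace ℝ (Fin d) × ℝ → ℝ) extends SolutionCurves Ω T b S₀ p₀ S p where
  S_mem : ∀ᵐ z ∂volume.restrict (Q Ω T), S z ∈ Icc (0 : ℝ) 1
  flux_eq : ∀ φ : ℝ → H10 Ω, MemLp φ 2 (volume.restrict (Ioc 0 T)) →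
    ∫ t in Ioc 0 T, R' t (φ t) = ∫ t in Ioc 0 T, ∫ x in Ω,
      inner ℝ (k (S (x, t)) • ((P t : Pairs Ω).snd x - g)) ((φ t : Pairs Ω).snd x)
  hysteresis_eq : ∀ ξ, MemLp ξ 2 (volume.restrict (Q Ω T)) →
    ∫ z in Q Ω T, v' z * ξ z
      = ∫ z in Q Ω T, Phi pci pcd b τ (b (p z)) (S z + b (p z)) * ξ z

variable {τ : ℝ} {S p : EuclideanSpace ℝ (Fin d) × ℝ → ℝ}

theorem SolutionCurves.memLp_b_p (h : SolutionCurves Ω T b S₀ p₀ S p)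
    (hb : ScanningFunction pci pcd b) : MemLp (fun z => b (p z)) 2 (volume.restrict (Q Ω T)) := by
  obtain ⟨B, -, hB⟩ := hb.exists_lipschitz
  exact hB.comp_memLp hb.zero h.memLp_p

theorem SolutionCurves.aestronglyMeasurable_v (h : SolutionCurves Ω T b S₀ p₀ S p)
    (hb : ScanningFunction pci pcd b) :
    AEStronglyMeasurable (fun z => S z + b (p z)) (volume.restrict (Q Ω T)) :=
  (h.memLp_S.add (h.memLp_b_p hb)).1

variable [IsFiniteMeasure (volume.restrict Ω)]

theorem SolutionCurves.integral_deriv_mul_nonneg (h : SolutionCurves Ω T b S₀ p₀ S p) (hT : 0 < T)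
    (hb : Continuous b) {θ : ℝ → ℝ} (hθ_mono : Monotone θ) {K a : ℝ} (hK : ∀ v, |θ v| ≤ K)
    (ha : θ a = 0) (h₀ : ∀ᵐ x ∂volume.restrict Ω, θ (S₀ x + b (p₀ x)) = 0) :
    0 ≤ ∫ z in Q Ω T, h.v' z * θ (S z + b (p z)) := by
  have initial_energy : ∫ x in Ω, energy id θ a (S₀ x + b (p₀ x)) ≤ 0 :=
    integral_nonpos_of_ae <| h₀.mono fun _ =>
      energy_nonpos_of_apply_eq_zero contDiff_id monotone_id hθ_mono a
  exact (sub_nonneg.2 initial_energy).trans <|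
    h.sub_integral_energy_id_le hT hb hθ_mono hK a <| Eventually.of_forall fun _ =>
      integral_nonneg fun _ => energy_nonneg contDiff_id monotone_id hθ_mono ha _

theorem IsWeakSolution.nonempty_solutionData (h : IsWeakSolution Ω T pci pcd b k g S₀ p₀ τ S p)
    (hΩ : IsOpen Ω) (hT : 0 < T) (hb : ScanningFunction pci pcd b)
    (h₀ : InitialData Ω pci pcd S₀ p₀) :
    Nonempty (SolutionData Ω T pci pcd b k g S₀ p₀ τ S p) := by
  obtain ⟨P, R, P', R', v', hP, hR, hS, hP_zero, hR_zero, hv, flux_eq, hysteresis_eq⟩ := h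
  obtain ⟨B, -, hB⟩ := hb.exists_lipschitz
  obtain ⟨c, rfl, rfl, rfl⟩ :=
    exists_solutionCurves hΩ hT hB hb.zero h₀.memH1.1 hP hR hP_zero hR_zero hv
  exact ⟨⟨c, hS, flux_eq, hysteresis_eq⟩⟩

namespace SolutionData

theorem memLp_excess (h : SolutionData Ω T pci pcd b k g S₀ p₀ τ S p)
    (hpc : CapillaryCurves pci pcd) (hb : ScanningFunction pci pcd b) :
    MemLp (fun z => drainageExcess pcd b (b (p z)) (S z + b (p z))) 2
      (volume.restrict (Q Ω T)) := by
  have := isFiniteMeasure_restrict_Q (Ω := Ω) T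
  exact (hpc.isScanCurve_d hb).memLp_drainageExcess (h.memLp_b_p hb) (h.aestronglyMeasurable_v hb)

theorem memLp_deficit (h : SolutionData Ω T pci pcd b k g S₀ p₀ τ S p)
    (hpc : CapillaryCurves pci pcd) (hb : ScanningFunction pci pcd b) :
    MemLp (fun z => imbibitionDeficit pci b (b (p z)) (S z + b (p z))) 2
      (volume.restrict (Q Ω T)) := by
  have := isFiniteMeasure_restrict_Q (Ω := Ω) T
  exact (hpc.isScanCurve_i hb).memLp_imbibitionDeficit (h.memLp_b_p hb)
    (h.aestronglyMeasurable_v hb)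

theorem ae_deriv_eq (h : SolutionData Ω T pci pcd b k g S₀ p₀ τ S p)
    (hpc : CapillaryCurves pci pcd) (hb : ScanningFunction pci pcd b) :
    ∀ᵐ z ∂volume.restrict (Q Ω T),
      h.v' z = 1 / τ * (imbibitionDeficit pci b (b (p z)) (S z + b (p z))
        - drainageExcess pcd b (b (p z)) (S z + b (p z))) := by
  refine ae_eq_of_forall_integral_mul_eq h.memLp_v'
    (((h.memLp_deficit hpc hb).sub (h.memLp_excess hpc hb)).const_mul (1 / τ)) fun ξ hξ => ?_
  rw [h.hysteresis_eq ξ hξ]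
  simp only [Phi_eq hpc hb]

theorem ae_UM_lt (h : SolutionData Ω T pci pcd b k g S₀ p₀ τ S p) (hT : 0 < T) (hτ : 0 < τ)
    (hpc : CapillaryCurves pci pcd) (hb : ScanningFunction pci pcd b)
    (h₀ : InitialData Ω pci pcd S₀ p₀) :
    ∀ᵐ z ∂volume.restrict (Q Ω T), UM b < S z + b (p z) := by
  have := isFiniteMeasure_restrict_Q (Ω := Ω) T
  set θ : ℝ → ℝ := (Iic (UM b)).indicator fun _ => -1
  have θ_of_le {v : ℝ} (hv : v ≤ UM b) : θ v = -1 := indicator_of_mem (mem_Iic.2 hv) fun _ => -1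
  have θ_of_lt {v : ℝ} (hv : UM b < v) : θ v = 0 :=
    indicator_of_notMem (notMem_Iic.2 hv) fun _ => -1
  have θ_mono : Monotone θ := monotone_indicator_Iic_neg_one _
  have abs_θ_le (v : ℝ) : |θ v| ≤ 1 := by
    rcases le_or_gt v (UM b) with hv | hv
    · rw [θ_of_le hv, abs_neg, abs_one]
    · rw [θ_of_lt hv, abs_zero]
      exact zero_le_one
  have initial : ∀ᵐ x ∂volume.restrict Ω, θ (S₀ x + b (p₀ x)) = 0 := by
    obtain ⟨s, hs, hv₀⟩ := h₀.exists_scanning_bounds hpc hb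
    filter_upwards [hv₀] with x hx
    exact θ_of_lt (((hpc.isScanCurve_i hb).UM_lt_add_b_pc hs).trans_le hx.1)
  have deriv_pos : ∀ᵐ z ∂volume.restrict (Q Ω T), S z + b (p z) ≤ UM b → 0 < h.v' z := by
    filter_upwards [h.ae_deriv_eq hpc hb] with z hz hv
    rw [hz]
    exact mul_pos (one_div_pos.2 hτ) (sub_pos.2 (excess_lt_deficit_of_le_UM hpc hb hv))
  have product_nonpos : ∀ᵐ z ∂volume.restrict (Q Ω T), h.v' z * θ (S z + b (p z)) ≤ 0 := by
    filter_upwards [deriv_pos] with z hz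
    rcases le_or_gt (S z + b (p z)) (UM b) with hv | hv
    · rw [θ_of_le hv, mul_neg_one]
      exact neg_nonpos.2 (hz hv).le
    · rw [θ_of_lt hv, mul_zero]
  have product_integrable : IntegrableOn (fun z => h.v' z * θ (S z + b (p z))) (Q Ω T) :=
    (h.memLp_v'.integrable one_le_two).mul_bdd (θ_mono.measurable.comp_aemeasurable
      (h.aestronglyMeasurable_v hb).aemeasurable).aestronglyMeasurable
      (Eventually.of_forall fun _ => abs_θ_le _)
  have product_integral := h.integral_deriv_mul_nonneg hT hb.contDiff.continuous θ_mono abs_θ_le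
    (θ_of_lt (lt_add_one _)) initial
  filter_upwards [deriv_pos, ae_eq_zero_of_nonpos_of_integral_nonneg product_integrable
    product_nonpos product_integral] with z hz hzero
  by_contra! hv
  rw [θ_of_le hv, mul_neg_one] at hzero
  exact (hz hv).ne' (neg_eq_zero.1 hzero)

end SolutionData

end Solutions

section TruncatedDissipation

variable {pci pcd b : ℝ → ℝ}

theorem measurable_truncatedDissipation (hpc : CapillaryCurves pci pcd)
    (hb : ScanningFunction pci pcd b) (B M : ℝ) :
    Measurable fun x : ℝ × ℝ => truncatedDissipation pci pcd b B M x.1 x.2 := by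
  have hi := (hpc.isScanCurve_i hb).continuous_rho
  have hd := (hpc.isScanCurve_d hb).continuous_rho
  have hb_cont := hb.contDiff.continuous
  have excess_cont : Continuous fun x : ℝ × ℝ => drainageExcess pcd b (b x.1) x.2 :=
    continuous_posPart.comp ((hb_cont.comp continuous_fst).sub (hd.comp continuous_snd))
  have deficit_cont : Continuous fun x : ℝ × ℝ => imbibitionDeficit pci b (b x.1) x.2 :=
    continuous_posPart.comp ((hi.comp continuous_snd).sub (hb_cont.comp continuous_fst))
  exact Measurable.ite (measurableSet_le (hi.comp continuous_snd).measurable measurable_const)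
    ((excess_cont.pow 2).add (deficit_cont.pow 2)).measurable
    (continuous_const.mul (deficit_cont.mul continuous_fst.abs)).neg.measurable

theorem abs_truncatedDissipation_le {B : ℝ} (hB : 0 ≤ B) (M p v : ℝ) :
    |truncatedDissipation pci pcd b B M p v|
      ≤ drainageExcess pcd b (b p) v ^ 2 + imbibitionDeficit pci b (b p) v ^ 2
        + B * (imbibitionDeficit pci b (b p) v * |p|) := by
  have sq_nonneg' : 0 ≤ drainageExcess pcd b (b p) v ^ 2 + imbibitionDeficit pci b (b p) v ^ 2 :=
    add_nonneg (sq_nonneg _) (sq_nonneg _)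
  have tail_nonneg : 0 ≤ B * (imbibitionDeficit pci b (b p) v * |p|) :=
    mul_nonneg hB (mul_nonneg (posPart_nonneg _) (abs_nonneg _))
  unfold truncatedDissipation
  split_ifs
  · rw [abs_of_nonneg sq_nonneg']
    exact le_add_of_nonneg_right tail_nonneg
  · rw [abs_neg, abs_of_nonneg tail_nonneg]
    exact le_add_of_nonneg_left sq_nonneg'

theorem eventually_truncatedDissipation_eq (hpc : CapillaryCurves pci pcd)
    (hb : ScanningFunction pci pcd b) (B p : ℝ) {v : ℝ} (hv : UM b < v) :
    ∀ᶠ M in atTop, truncatedDissipation pci pcd b B M p v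
      = drainageExcess pcd b (b p) v ^ 2 + imbibitionDeficit pci b (b p) v ^ 2 := by
  have hi := hpc.isScanCurve_i hb
  filter_upwards [hi.tendsto_b.eventually (lt_mem_nhds (hi.rho_lt_UM hv))] with M hM
  exact if_pos hM.le

end TruncatedDissipation

section Dissipation

variable {d : ℕ} {Ω : Set (EuclideanSpace ℝ (Fin d))} {T : ℝ} {pci pcd b k : ℝ → ℝ}
  {g : EuclideanSpace ℝ (Fin d)} {S₀ p₀ : EuclideanSpace ℝ (Fin d) → ℝ} {τ : ℝ}
  {S p : EuclideanSpace ℝ (Fin d) × ℝ → ℝ}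

theorem integral_Q_eq {f : EuclideanSpace ℝ (Fin d) × ℝ → ℝ} (hf : IntegrableOn f (Q Ω T)) :
    ∫ z in Q Ω T, f z = ∫ t in Ioc 0 T, ∫ x in Ω, f (x, t) := by
  rw [IntegrableOn, restrict_Q] at hf
  rw [restrict_Q, integral_prod_symm f hf]

variable [IsFiniteMeasure (volume.restrict Ω)]

namespace SolutionData

theorem neg_le_integral_mul (h : SolutionData Ω T pci pcd b k g S₀ p₀ τ S p)
    (hT : 0 < T) (hk : Permeability k) (hb : ScanningFunction pci pcd b) :
    -((∫ x in Ω, energy b id 0 (p₀ x)) + k 1 * ‖g‖ ^ 2 * (volume.restrict Ω).real univ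
        * (volume.restrict (Ioc 0 T)).real univ) ≤ ∫ z in Q Ω T, h.v' z * p z := by
  obtain ⟨B, -, hB⟩ := hb.exists_lipschitz
  have chain_rule := h.neg_integral_energy_le hT hb.contDiff hb.mono hB hb.zero monotone_id
    LipschitzWith.id rfl h.memLp_P h.P_ae (a := 0) rfl
  have hC : 0 ≤ k 1 * ‖g‖ ^ 2 := mul_nonneg (hk.nonneg.trans hk.lt_one.le) (sq_nonneg _)
  have flux_ge := neg_mul_measureReal_le_integral (μ := volume.restrict (Ioc 0 T))
    (f := fun t => ∫ x in Ω,
      inner ℝ (k (S (x, t)) • ((h.P t : Pairs Ω).snd x - g)) ((h.P t : Pairs Ω).snd x))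
    (mul_nonneg hC measureReal_nonneg) <| Eventually.of_forall fun _ =>
      neg_mul_measureReal_le_integral hC (Eventually.of_forall fun _ => hk.neg_le_inner_flux _ _ _)
  rw [← h.flux_eq h.P h.memLp_P] at flux_ge
  simp only [id] at chain_rule
  linarith

theorem integral_mul_curvePressure_le (h : SolutionData Ω T pci pcd b k g S₀ p₀ τ S p)
    (hT : 0 < T) (hτ : 0 < τ) (hpc : CapillaryCurves pci pcd) (hb : ScanningFunction pci pcd b)
    (h₀ : InitialData Ω pci pcd S₀ p₀) {s : ℝ} (hs : s ∈ Ioc (0 : ℝ) 1)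
    (hv₀ : ∀ᵐ x ∂volume.restrict Ω,
      s + b (pci s) ≤ S₀ x + b (p₀ x) ∧ S₀ x + b (p₀ x) ≤ 1 + UM b)
    {M : ℝ} (hM : pci 1 ≤ M) :
    ∫ z in Q Ω T, h.v' z * curvePressure pci b M (S z + b (p z))
      ≤ 2 * (max |pci 1| |pci s| * (volume.restrict Ω).real univ) := by
  have hi := hpc.isScanCurve_i hb
  have hC : 0 ≤ max |pci 1| |pci s| := le_max_of_le_left (abs_nonneg _)
  have entropy_ge : ∀ᵐ t ∂volume.restrict (Ioc 0 T),
      -(max |pci 1| |pci s| * (volume.restrict Ω).real univ)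
        ≤ ∫ x in Ω, energy id (fun w => -curvePressure pci b M w) (s + b (pci s))
            (S (x, t) + b (p (x, t))) := by
    have hv := (h.ae_UM_lt hT hτ hpc hb h₀).and h.S_mem
    rw [restrict_Q] at hv
    filter_upwards [ae_ae_of_ae_prod_symm hv] with t ht
    refine neg_mul_measureReal_le_integral hC ?_
    filter_upwards [ht] with x hx
    exact hi.neg_le_energy_curvePressure hM hs hx.1 (add_le_add hx.2.2 (hi.b_lt_UM _).le)
  have initial_entropy_le :
      ∫ x in Ω, energy id (fun w => -curvePressure pci b M w) (s + b (pci s)) (S₀ x + b (p₀ x))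
        ≤ max |pci 1| |pci s| * (volume.restrict Ω).real univ :=
    integral_le_mul_measureReal hC <| hv₀.mono fun _ hx =>
      hi.energy_curvePressure_le hM hs hx.1 hx.2
  have chain_rule := h.sub_integral_energy_id_le hT hb.contDiff.continuous
    (hi.antitone_curvePressure hM).neg
    (fun v => (abs_neg _).trans_le (hi.abs_curvePressure_le hM v)) _ entropy_ge
  simp only [mul_neg, integral_neg] at chain_rule
  linarith

theorem integrable_dissipation_bound (h : SolutionData Ω T pci pcd b k g S₀ p₀ τ S p)
    (hpc : CapillaryCurves pci pcd) (hb : ScanningFunction pci pcd b) (B : ℝ) :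
    IntegrableOn (fun z => drainageExcess pcd b (b (p z)) (S z + b (p z)) ^ 2
      + imbibitionDeficit pci b (b (p z)) (S z + b (p z)) ^ 2
      + B * (imbibitionDeficit pci b (b (p z)) (S z + b (p z)) * |p z|)) (Q Ω T) :=
  ((h.memLp_excess hpc hb).integrable_sq.add (h.memLp_deficit hpc hb).integrable_sq).add
    (((h.memLp_deficit hpc hb).integrable_mul h.memLp_p.abs).const_mul B)

theorem integrable_truncatedDissipation (h : SolutionData Ω T pci pcd b k g S₀ p₀ τ S p)
    (hpc : CapillaryCurves pci pcd) (hb : ScanningFunction pci pcd b) (B : NNReal) (M : ℝ) :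
    IntegrableOn (fun z => truncatedDissipation pci pcd b B M (p z) (S z + b (p z))) (Q Ω T) :=
  .mono' (h.integrable_dissipation_bound hpc hb B)
    ((measurable_truncatedDissipation hpc hb B M).comp_aemeasurable
      (h.memLp_p.1.aemeasurable.prodMk
        (h.aestronglyMeasurable_v hb).aemeasurable)).aestronglyMeasurable
    (Eventually.of_forall fun _ => abs_truncatedDissipation_le B.coe_nonneg _ _ _)

end SolutionData

theorem exists_integral_mul_curvePressure_sub_le (hT : 0 < T) (hpc : CapillaryCurves pci pcd)
    (hk : Permeability k) (hb : ScanningFunction pci pcd b) (h₀ : InitialData Ω pci pcd S₀ p₀) :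
    ∃ C, ∀ τ > 0, ∀ S p, ∀ h : SolutionData Ω T pci pcd b k g S₀ p₀ τ S p, ∀ M ≥ pci 1,
      ∫ z in Q Ω T, h.v' z * (curvePressure pci b M (S z + b (p z)) - p z) ≤ C := by
  have := isFiniteMeasure_restrict_Q (Ω := Ω) T
  obtain ⟨s, hs, hv₀⟩ := h₀.exists_scanning_bounds hpc hb
  refine ⟨2 * (max |pci 1| |pci s| * (volume.restrict Ω).real univ)
    - -((∫ x in Ω, energy b id 0 (p₀ x)) + k 1 * ‖g‖ ^ 2 * (volume.restrict Ω).real univ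
      * (volume.restrict (Ioc 0 T)).real univ), fun τ hτ S p h M hM => ?_⟩
  simp only [mul_sub]
  exact (integral_sub ((hpc.isScanCurve_i hb).integrable_mul_curvePressure hM h.memLp_v'
    (h.aestronglyMeasurable_v hb)) (h.memLp_v'.integrable_mul h.memLp_p)).trans_le
    (sub_le_sub (h.integral_mul_curvePressure_le hT hτ hpc hb h₀ hs hv₀ hM)
      (h.neg_le_integral_mul hT hk hb))

namespace SolutionData

theorem integral_truncatedDissipation_le (h : SolutionData Ω T pci pcd b k g S₀ p₀ τ S p)
    (hτ : 0 < τ) (hpc : CapillaryCurves pci pcd) (hb : ScanningFunction pci pcd b)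
    {B : NNReal} (hB : LipschitzWith B b) {C M : ℝ} (hM : pci 1 ≤ M) (hM_nonneg : 0 ≤ M)
    (hC : ∫ z in Q Ω T, h.v' z * (curvePressure pci b M (S z + b (p z)) - p z) ≤ C) :
    ∫ z in Q Ω T, truncatedDissipation pci pcd b B M (p z) (S z + b (p z)) ≤ B * C * τ := by
  have := isFiniteMeasure_restrict_Q (Ω := Ω) T
  have work_integrable :
      IntegrableOn (fun z => h.v' z * (curvePressure pci b M (S z + b (p z)) - p z)) (Q Ω T) := by
    simp only [mul_sub]
    exact ((hpc.isScanCurve_i hb).integrable_mul_curvePressure hM h.memLp_v'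
      (h.aestronglyMeasurable_v hb)).sub (h.memLp_v'.integrable_mul h.memLp_p)
  calc ∫ z in Q Ω T, truncatedDissipation pci pcd b B M (p z) (S z + b (p z))
      ≤ ∫ z in Q Ω T, B * τ * (h.v' z * (curvePressure pci b M (S z + b (p z)) - p z)) := by
        refine integral_mono_ae (h.integrable_truncatedDissipation hpc hb B M)
          (work_integrable.const_mul _) ?_
        filter_upwards [h.ae_deriv_eq hpc hb] with z hz
        refine (truncatedDissipation_le hpc hb hB hM hM_nonneg _ _).trans_eq ?_
        rw [hz]
        field_simp
        ring
    _ ≤ B * τ * C := by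
        rw [integral_const_mul]
        exact mul_le_mul_of_nonneg_left hC (mul_nonneg B.coe_nonneg hτ.le)
    _ = B * C * τ := mul_right_comm _ _ _

theorem tendsto_integral_truncatedDissipation (h : SolutionData Ω T pci pcd b k g S₀ p₀ τ S p)
    (hT : 0 < T) (hτ : 0 < τ) (hpc : CapillaryCurves pci pcd) (hb : ScanningFunction pci pcd b)
    (h₀ : InitialData Ω pci pcd S₀ p₀) (B : NNReal) :
    Tendsto (fun M => ∫ z in Q Ω T, truncatedDissipation pci pcd b B M (p z) (S z + b (p z))) atTop
      (𝓝 (∫ z in Q Ω T, (drainageExcess pcd b (b (p z)) (S z + b (p z)) ^ 2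
        + imbibitionDeficit pci b (b (p z)) (S z + b (p z)) ^ 2))) := by
  refine tendsto_integral_filter_of_dominated_convergence _
    (Eventually.of_forall fun M => (h.integrable_truncatedDissipation hpc hb B M).1)
    (Eventually.of_forall fun M => Eventually.of_forall fun _ =>
      abs_truncatedDissipation_le B.coe_nonneg M _ _)
    (h.integrable_dissipation_bound hpc hb B) ?_
  filter_upwards [h.ae_UM_lt hT hτ hpc hb h₀] with z hz
  exact tendsto_nhds_of_eventually_eq (eventually_truncatedDissipation_eq hpc hb B _ hz)

end SolutionData

theorem exists_integral_sq_le (hΩ : IsOpen Ω) (hT : 0 < T) (hpc : CapillaryCurves pci pcd)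
    (hk : Permeability k) (hb : ScanningFunction pci pcd b) (h₀ : InitialData Ω pci pcd S₀ p₀) :
    ∃ C > 0, ∀ τ > 0, ∀ S p : EuclideanSpace ℝ (Fin d) × ℝ → ℝ,
      IsWeakSolution Ω T pci pcd b k g S₀ p₀ τ S p →
      MemLp (fun z => drainageExcess pcd b (b (p z)) (S z + b (p z))) 2 (volume.restrict (Q Ω T)) ∧
      MemLp (fun z => imbibitionDeficit pci b (b (p z)) (S z + b (p z))) 2
        (volume.restrict (Q Ω T)) ∧
      (∫ z in Q Ω T, drainageExcess pcd b (b (p z)) (S z + b (p z)) ^ 2)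
        + (∫ z in Q Ω T, imbibitionDeficit pci b (b (p z)) (S z + b (p z)) ^ 2) < C * τ := by
  obtain ⟨B, -, hB⟩ := hb.exists_lipschitz
  obtain ⟨C, hC⟩ := exists_integral_mul_curvePressure_sub_le (g := g) hT hpc hk hb h₀
  refine ⟨|B * C| + 1, by positivity, fun τ hτ S p h => ?_⟩
  obtain ⟨h⟩ := h.nonempty_solutionData hΩ hT hb h₀
  have hD := h.memLp_excess hpc hb
  have hI := h.memLp_deficit hpc hb
  refine ⟨hD, hI, ?_⟩
  rw [← integral_add hD.integrable_sq hI.integrable_sq]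
  have sq_le : ∫ z in Q Ω T, (drainageExcess pcd b (b (p z)) (S z + b (p z)) ^ 2
      + imbibitionDeficit pci b (b (p z)) (S z + b (p z)) ^ 2) ≤ B * C * τ := by
    refine le_of_tendsto (h.tendsto_integral_truncatedDissipation hT hτ hpc hb h₀ B) ?_
    filter_upwards [eventually_ge_atTop (pci 1), eventually_ge_atTop 0] with M hM hM_nonneg
    exact h.integral_truncatedDissipation_le hτ hpc hb hB hM hM_nonneg (hC τ hτ S p h M hM)
  exact sq_le.trans_lt (mul_lt_mul_of_pos_right ((le_abs_self _).trans_lt (lt_add_one _)) hτ)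

end Dissipation

/-! ### Limits in measure -/

section Measure

variable {α ι : Type*} [MeasurableSpace α] {μ : Measure α} {l : Filter ι}

theorem tendstoInMeasure_zero_of_integral_sq_le {f : ι → α → ℝ} {ε : ι → ℝ}
    (hf : ∀ i, MemLp (f i) 2 μ) (hle : ∀ i, ∫ x, f i x ^ 2 ∂μ ≤ ε i) (hε : Tendsto ε l (𝓝 0)) :
    TendstoInMeasure μ f l 0 := by
  refine tendstoInMeasure_of_tendsto_eLpNorm two_ne_zero (fun i => (hf i).1)
    aestronglyMeasurable_zero ?_
  have eLpNorm_eq (i : ι) :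
      eLpNorm (f i - 0) 2 μ = ENNReal.ofReal ((∫ x, f i x ^ 2 ∂μ) ^ (2 : ℝ)⁻¹) := by
    rw [sub_zero, (hf i).eLpNorm_eq_integral_rpow_norm two_ne_zero (by norm_num)]
    simp
  have integral_tendsto : Tendsto (fun i => ∫ x, f i x ^ 2 ∂μ) l (𝓝 0) :=
    squeeze_zero (fun _ => integral_nonneg fun _ => sq_nonneg _) hle hε
  simp only [eLpNorm_eq]
  simpa using ENNReal.tendsto_ofReal
    (integral_tendsto.rpow_const (p := (2 : ℝ)⁻¹) (Or.inr (by norm_num)))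

theorem tendstoInMeasure_prodMk {E F : Type*} [PseudoEMetricSpace E] [PseudoEMetricSpace F]
    {f : ι → α → E} {g : ι → α → F} {f' : α → E} {g' : α → F} (hf : TendstoInMeasure μ f l f')
    (hg : TendstoInMeasure μ g l g') :
    TendstoInMeasure μ (fun i x => (f i x, g i x)) l fun x => (f' x, g' x) := by
  intro ε hε
  refine tendsto_of_tendsto_of_tendsto_of_le_of_le tendsto_const_nhds
    (by simpa only [add_zero] using (hf ε hε).add (hg ε hε)) (fun _ => zero_le) fun i => ?_
  refine (measure_mono fun x hx => ?_).trans (measure_union_le _ _)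
  rwa [mem_ofPred_eq, Prod.edist_eq, le_max_iff] at hx

end Measure

section Hysteresis

variable {d : ℕ} {Ω : Set (EuclideanSpace ℝ (Fin d))} {T : ℝ} {pci pcd b k : ℝ → ℝ}
  {g : EuclideanSpace ℝ (Fin d)} {S₀ p₀ : EuclideanSpace ℝ (Fin d) → ℝ}

theorem rho_le_of_tendsto (hpc : CapillaryCurves pci pcd) (hb : ScanningFunction pci pcd b)
    {u v : ℕ → ℝ} {u' v' : ℝ} (hu : Tendsto u atTop (𝓝 u')) (hv : Tendsto v atTop (𝓝 v'))
    (hD : Tendsto (fun n => drainageExcess pcd b (u n) (v n)) atTop (𝓝 0))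
    (hI : Tendsto (fun n => imbibitionDeficit pci b (u n) (v n)) atTop (𝓝 0)) :
    rho pci b v' ≤ u' ∧ u' ≤ rho pcd b v' := by
  have hrho_i := ((hpc.isScanCurve_i hb).continuous_rho.tendsto v').comp hv
  have hrho_d := ((hpc.isScanCurve_d hb).continuous_rho.tendsto v').comp hv
  have hI_zero : posPart (rho pci b v' - u') = 0 :=
    tendsto_nhds_unique ((continuous_posPart.tendsto _).comp (hrho_i.sub hu)) hI
  have hD_zero : posPart (u' - rho pcd b v') = 0 :=
    tendsto_nhds_unique ((continuous_posPart.tendsto _).comp (hu.sub hrho_d)) hD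
  exact ⟨sub_nonpos.1 (max_eq_right_iff.1 hI_zero), sub_nonpos.1 (max_eq_right_iff.1 hD_zero)⟩

variable [IsFiniteMeasure (volume.restrict Ω)]

theorem tendstoInMeasure_excess_deficit (hΩ : IsOpen Ω) (hT : 0 < T)
    (hpc : CapillaryCurves pci pcd) (hk : Permeability k) (hb : ScanningFunction pci pcd b)
    (h₀ : InitialData Ω pci pcd S₀ p₀) {τ : ℕ → ℝ} {S p : ℕ → EuclideanSpace ℝ (Fin d) × ℝ → ℝ}
    (hτ : ∀ n, 0 < τ n) (hτ_tendsto : Tendsto τ atTop (𝓝 0))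
    (h : ∀ n, IsWeakSolution Ω T pci pcd b k g S₀ p₀ (τ n) (S n) (p n)) :
    TendstoInMeasure (volume.restrict (Q Ω T))
      (fun n z => (drainageExcess pcd b (b (p n z)) (S n z + b (p n z)),
        imbibitionDeficit pci b (b (p n z)) (S n z + b (p n z)))) atTop 0 := by
  obtain ⟨C, -, hC⟩ := exists_integral_sq_le (g := g) hΩ hT hpc hk hb h₀
  have estimate (n : ℕ) := hC (τ n) (hτ n) _ _ (h n)
  have bound_tendsto : Tendsto (fun n => C * τ n) atTop (𝓝 0) := by
    simpa only [mul_zero] using hτ_tendsto.const_mul C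
  refine tendstoInMeasure_prodMk
    (tendstoInMeasure_zero_of_integral_sq_le (fun n => (estimate n).1) (fun n => ?_) bound_tendsto)
    (tendstoInMeasure_zero_of_integral_sq_le (fun n => (estimate n).2.1) (fun n => ?_)
      bound_tendsto)
  · exact (le_add_of_nonneg_right (integral_nonneg fun _ => sq_nonneg _)).trans
      (estimate n).2.2.le
  · exact (le_add_of_nonneg_left (integral_nonneg fun _ => sq_nonneg _)).trans
      (estimate n).2.2.le

theorem ae_hysteresis_of_tendstoInMeasure (hΩ : IsOpen Ω) (hT : 0 < T)
    (hpc : CapillaryCurves pci pcd) (hk : Permeability k) (hb : ScanningFunction pci pcd b)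
    (h₀ : InitialData Ω pci pcd S₀ p₀) {τ : ℕ → ℝ} {S p : ℕ → EuclideanSpace ℝ (Fin d) × ℝ → ℝ}
    (hτ : ∀ n, 0 < τ n) (hτ_tendsto : Tendsto τ atTop (𝓝 0))
    (h : ∀ n, IsWeakSolution Ω T pci pcd b k g S₀ p₀ (τ n) (S n) (p n))
    {u v : EuclideanSpace ℝ (Fin d) × ℝ → ℝ}
    (hu : TendstoInMeasure (volume.restrict (Q Ω T)) (fun n z => b (p n z)) atTop u)
    (hv : TendstoInMeasure (volume.restrict (Q Ω T)) (fun n z => S n z + b (p n z)) atTop v) :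
    ∀ᵐ z ∂volume.restrict (Q Ω T), rho pci b (v z) ≤ u z ∧ u z ≤ rho pcd b (v z) := by
  obtain ⟨ns, -, hns⟩ := (tendstoInMeasure_prodMk (tendstoInMeasure_prodMk hu hv)
    (tendstoInMeasure_excess_deficit hΩ hT hpc hk hb h₀ hτ hτ_tendsto h)).exists_seq_tendsto_ae
  filter_upwards [hns] with z hz
  exact rho_le_of_tendsto hpc hb hz.fst_nhds.fst_nhds hz.fst_nhds.snd_nhds
    hz.snd_nhds.fst_nhds hz.snd_nhds.snd_nhds

end Hysteresis

/-! ### The lower bound for the pressure without gravity -/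

section Cutoff

theorem deriv_smoothTransition_of_nonpos {x : ℝ} (hx : x ≤ 0) :
    deriv Real.smoothTransition x = 0 := by
  refine IsLocalMin.deriv_eq_zero (Eventually.of_forall fun y => ?_)
  rw [Real.smoothTransition.zero_of_nonpos hx]
  exact Real.smoothTransition.nonneg y

theorem deriv_smoothTransition_of_one_le {x : ℝ} (hx : 1 ≤ x) :
    deriv Real.smoothTransition x = 0 := by
  refine IsLocalMax.deriv_eq_zero (Eventually.of_forall fun y => ?_)
  rw [Real.smoothTransition.one_of_one_le hx]
  exact Real.smoothTransition.le_one y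

theorem exists_abs_deriv_smoothTransition_le :
    ∃ L : NNReal, ∀ x, |deriv Real.smoothTransition x| ≤ L := by
  obtain ⟨C, hC⟩ := isCompact_Icc.exists_bound_of_continuousOn (s := Icc (0 : ℝ) 1)
    ((Real.smoothTransition.contDiff (n := 1)).continuous_deriv le_rfl).continuousOn
  refine ⟨C.toNNReal, fun x => ?_⟩
  rcases le_or_gt x 0 with hx | hx
  · rw [deriv_smoothTransition_of_nonpos hx, abs_zero]
    exact C.toNNReal.coe_nonneg
  · rcases le_or_gt 1 x with hx' | hx'
    · rw [deriv_smoothTransition_of_one_le hx', abs_zero]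
      exact C.toNNReal.coe_nonneg
    · exact (hC x ⟨hx.le, hx'.le⟩).trans C.le_coe_toNNReal

/-- A smooth nondecreasing function vanishing exactly on `[m, ∞)`; composed with the pressure it
is the test function that detects values below `m`. -/
noncomputable def cutoff (m s : ℝ) : ℝ := -Real.smoothTransition (m - s)

variable {m s : ℝ}

theorem contDiff_cutoff (m : ℝ) : ContDiff ℝ ∞ (cutoff m) :=
  (Real.smoothTransition.contDiff.comp (contDiff_const.sub contDiff_id)).neg

theorem monotone_cutoff (m : ℝ) : Monotone (cutoff m) := fun _ _ hs =>
  neg_le_neg (Real.smoothTransition.monotone (sub_le_sub_left hs m))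

theorem cutoff_of_le (hs : m ≤ s) : cutoff m s = 0 := by
  rw [cutoff, Real.smoothTransition.zero_of_nonpos (sub_nonpos.2 hs), neg_zero]

theorem cutoff_neg_of_lt (hs : s < m) : cutoff m s < 0 :=
  neg_lt_zero.2 (Real.smoothTransition.pos_of_pos (sub_pos.2 hs))

theorem deriv_cutoff (m s : ℝ) : deriv (cutoff m) s = deriv Real.smoothTransition (m - s) := by
  unfold cutoff
  rw [deriv.fun_neg, deriv_comp_const_sub, neg_neg]

theorem deriv_cutoff_of_le (hs : m ≤ s) : deriv (cutoff m) s = 0 := by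
  rw [deriv_cutoff, deriv_smoothTransition_of_nonpos (sub_nonpos.2 hs)]

theorem exists_abs_deriv_cutoff_le (m : ℝ) : ∃ L : NNReal, ∀ s, |deriv (cutoff m) s| ≤ L := by
  obtain ⟨L, hL⟩ := exists_abs_deriv_smoothTransition_le
  exact ⟨L, fun s => (deriv_cutoff m s).symm ▸ hL (m - s)⟩

end Cutoff

section Poincare

variable {d : ℕ} {Ω : Set (EuclideanSpace ℝ (Fin d))}

theorem fst_eq_zero_of_snd_eq_zero (hd : 0 < d) (hΩ : Bornology.IsBounded Ω) (w : H10 Ω)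
    (hw : (w : Pairs Ω).snd = 0) : (w : Pairs Ω).fst = 0 := by
  obtain ⟨C, hC⟩ := exists_poincare hd hΩ
  have hle := hC w w.2
  rw [hw, norm_zero, zero_pow two_ne_zero, mul_zero] at hle
  exact norm_eq_zero.1 ((pow_eq_zero_iff two_ne_zero).1 (hle.antisymm (sq_nonneg _)))

theorem restrict_eq_zero_of_one_le (hd : 0 < d) (hΩ : Bornology.IsBounded Ω) {w : H10 Ω}
    (hw : ∀ᵐ x ∂volume.restrict Ω, 1 ≤ (w : Pairs Ω).fst x) : volume.restrict Ω = 0 := by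
  obtain ⟨L, hL⟩ := exists_abs_deriv_smoothTransition_le
  set χ : H10 Ω := compH10 Real.smoothTransition.contDiff Real.smoothTransition.zero hL w
  have χ_snd : (χ : Pairs Ω).snd = 0 := by
    rw [Lp.eq_zero_iff_ae_eq_zero]
    filter_upwards [coeFn_compPair_snd Real.smoothTransition.contDiff Real.smoothTransition.zero hL
      (w : Pairs Ω), hw] with x hx hwx
    exact hx.trans (by rw [deriv_smoothTransition_of_one_le hwx, zero_smul, Pi.zero_apply])
  have χ_fst := (Lp.eq_zero_iff_ae_eq_zero).1 (fst_eq_zero_of_snd_eq_zero hd hΩ χ χ_snd)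
  rw [← ae_eq_bot, ← eventually_false_iff_eq_bot]
  filter_upwards [coeFn_compPair_fst Real.smoothTransition.contDiff Real.smoothTransition.zero hL
    (w : Pairs Ω), hw, χ_fst] with x hx hwx hχx
  rw [Real.smoothTransition.one_of_one_le hwx] at hx
  exact one_ne_zero (hx.symm.trans hχx)

theorem nonpos_of_le_memH10 (hd : 0 < d) (hΩ : Bornology.IsBounded Ω)
    (hΩ_ne : volume.restrict Ω ≠ 0) {f : EuclideanSpace ℝ (Fin d) → ℝ} (hf : MemH10 Ω f) {m : ℝ}
    (hm : ∀ᵐ x ∂volume.restrict Ω, m ≤ f x) : m ≤ 0 := by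
  obtain ⟨w, hw, hwf⟩ := hf
  by_contra! hm_pos
  refine hΩ_ne (restrict_eq_zero_of_one_le hd hΩ (w := m⁻¹ • ⟨w, hw⟩) ?_)
  filter_upwards [hm, hwf, Lp.coeFn_smul m⁻¹ w.fst] with x hmx hwx hx
  refine le_of_le_of_eq ?_ hx.symm
  rw [Pi.smul_apply, hwx, smul_eq_mul, ← div_eq_inv_mul]
  exact (one_le_div hm_pos).2 hmx

end Poincare

section ProductMeasure

variable {α β : Type*} [MeasurableSpace α] [MeasurableSpace β] {μ : Measure α} {ν : Measure β}

theorem ae_inner_eq_zero {E : Type*} [NormedAddCommGroup E] [InnerProductSpace ℝ E]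
    {A D : β → Lp E 2 μ} (hA : MemLp A 2 ν) (hD : MemLp D 2 ν)
    (hpos : ∀ᵐ t ∂ν, ∀ᵐ x ∂μ, 0 ≤ (inner ℝ (A t x) (D t x) : ℝ))
    (hle : ∫ t, ∫ x, inner ℝ (A t x) (D t x) ∂μ ∂ν ≤ 0) :
    ∀ᵐ t ∂ν, ∀ᵐ x ∂μ, (inner ℝ (A t x) (D t x) : ℝ) = 0 := by
  have inner_nonneg : 0 ≤ᵐ[ν] fun t => ∫ x, (inner ℝ (A t x) (D t x) : ℝ) ∂μ :=
    hpos.mono fun t ht => integral_nonneg_of_ae ht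
  have inner_integrable : Integrable (fun t => ∫ x, (inner ℝ (A t x) (D t x) : ℝ) ∂μ) ν := by
    simp only [← L2.inner_def]
    exact (hA.norm.integrable_mul hD.norm).mono' (hA.1.inner hD.1)
      (Eventually.of_forall fun t => norm_inner_le_norm (A t) (D t))
  have inner_zero := (integral_eq_zero_iff_of_nonneg_ae inner_nonneg inner_integrable).1
    (hle.antisymm (integral_nonneg_of_ae inner_nonneg))
  filter_upwards [inner_zero, hpos] with t ht hpos_t
  exact (integral_eq_zero_iff_of_nonneg_ae hpos_t (L2.integrable_inner (A t) (D t))).1 ht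

theorem ae_eq_zero_of_ae_ae_eq_zero [SFinite μ] [SFinite ν] {w : α × β → ℝ}
    (hw : MemLp w 2 (μ.prod ν)) (h : ∀ᵐ t ∂ν, ∀ᵐ x ∂μ, w (x, t) = 0) : w =ᵐ[μ.prod ν] 0 := by
  have integral_sq : ∫ z, w z ^ 2 ∂(μ.prod ν) = 0 := by
    rw [integral_prod_symm _ hw.integrable_sq]
    refine integral_eq_zero_of_ae (h.mono fun t ht => integral_eq_zero_of_ae ?_)
    exact ht.mono fun x hx => by simp only [hx, zero_pow two_ne_zero, Pi.zero_apply]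
  rw [integral_eq_zero_iff_of_nonneg (fun _ => sq_nonneg _) hw.integrable_sq] at integral_sq
  exact integral_sq.mono fun z hz => (pow_eq_zero_iff two_ne_zero).1 hz

end ProductMeasure

section CutoffBalance

variable {pci pcd b : ℝ → ℝ} {q s : ℝ}

theorem drainageExcess_eq_zero_of_le (hpc : CapillaryCurves pci pcd)
    (hb : ScanningFunction pci pcd b) (hq : q ≤ pci 1) (v : ℝ) :
    drainageExcess pcd b (b q) v = 0 := by
  refine posPart_of_nonpos (sub_nonpos.2 ?_)
  calc b q ≤ b (pci 1) := hb.mono hq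
    _ = Um pcd b := by rw [hpc.eq_one, Um]
    _ ≤ rho pcd b v := (hpc.isScanCurve_d hb).Um_le_rho v

theorem saturation_eq_one_of_lt (hpc : CapillaryCurves pci pcd) (hb : ScanningFunction pci pcd b)
    (hs : s ∈ Icc (0 : ℝ) 1) (hq : q < pci 1) (hq_rho : rho pci b (s + b q) ≤ b q) : s = 1 := by
  have hi := hpc.isScanCurve_i hb
  have hs_pos := hi.saturation_pos hs.1 hq_rho
  by_contra hs_ne
  have hs_lt : s < 1 := hs.2.lt_of_ne hs_ne
  exact hq.not_ge <|
    (hi.pc_one_le ⟨hs_pos, hs.2⟩).trans (hi.pc_le_of_rho_le ⟨hs_pos, hs_lt⟩ hq_rho)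

end CutoffBalance

namespace SolutionData

variable {d : ℕ} {Ω : Set (EuclideanSpace ℝ (Fin d))} {T : ℝ} {pci pcd b k : ℝ → ℝ}
  {g : EuclideanSpace ℝ (Fin d)} {S₀ p₀ : EuclideanSpace ℝ (Fin d) → ℝ} {τ : ℝ}
  {S p : EuclideanSpace ℝ (Fin d) × ℝ → ℝ}

section Flux

variable {β : ℝ → ℝ} {K : NNReal} (hβ : ContDiff ℝ ∞ β) (hβ_zero : β 0 = 0)
  (hK : ∀ s, |deriv β s| ≤ K)

theorem ae_compH10_fst_eq (h : SolutionData Ω T pci pcd b k g S₀ p₀ τ S p) :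
    ∀ᵐ t ∂volume.restrict (Ioc 0 T),
    (compH10 hβ hβ_zero hK (h.P t) : Pairs Ω).fst =ᵐ[volume.restrict Ω]
      fun x => β (p (x, t)) := by
  filter_upwards [h.P_ae] with t ht
  filter_upwards [coeFn_compPair_fst hβ hβ_zero hK (h.P t : Pairs Ω), ht] with x hx hpx
  exact hx.trans (by rw [hpx])

theorem ae_compH10_snd_eq (h : SolutionData Ω T pci pcd b k g S₀ p₀ τ S p) :
    ∀ᵐ t ∂volume.restrict (Ioc 0 T),
    (compH10 hβ hβ_zero hK (h.P t) : Pairs Ω).snd =ᵐ[volume.restrict Ω]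
      fun x => deriv β (p (x, t)) • (h.P t : Pairs Ω).snd x := by
  filter_upwards [h.P_ae] with t ht
  filter_upwards [coeFn_compPair_snd hβ hβ_zero hK (h.P t : Pairs Ω), ht] with x hx hpx
  exact hx.trans (by rw [hpx])

theorem exists_flux_curve (h : SolutionData Ω T pci pcd b k g S₀ p₀ τ S p)
    (hk : Permeability k) :
    ∃ A : ℝ → Lp (EuclideanSpace ℝ (Fin d)) 2 (volume.restrict Ω),
      MemLp A 2 (volume.restrict (Ioc 0 T)) ∧ ∀ᵐ t ∂volume.restrict (Ioc 0 T),
        A t =ᵐ[volume.restrict Ω] fun x => k (S (x, t)) • (h.P t : Pairs Ω).snd x := by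
  obtain ⟨s, hs, hs_ae⟩ := exists_L2_curve (restrict_Q Ω T ▸ h.memLp_S)
  have abs_k_le (s : ℝ) : |k s| ≤ k 1 :=
    (abs_of_nonneg (hk.mem_Icc s).1).trans_le (hk.mem_Icc s).2
  have gradient := (sndH10 Ω).comp_memLp' h.memLp_P
  refine ⟨fun t => smulComp hk.contDiff.continuous abs_k_le (s t) (h.P t : Pairs Ω).snd,
    gradient.of_le_mul ((continuous_smulComp hk.contDiff.continuous abs_k_le)
      |>.comp_aestronglyMeasurable (hs.1.prodMk gradient.1))
      (Eventually.of_forall fun t => norm_smulComp_le _ _ _ _), ?_⟩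
  filter_upwards [hs_ae] with t ht
  filter_upwards [ht, coeFn_smulComp hk.contDiff.continuous abs_k_le (s t)
    (h.P t : Pairs Ω).snd] with x hx hAx
  rw [hAx, hx]

theorem exists_flux_curve_eq (h : SolutionData Ω T pci pcd b k 0 S₀ p₀ τ S p)
    (hk : Permeability k) :
    ∃ A : ℝ → Lp (EuclideanSpace ℝ (Fin d)) 2 (volume.restrict Ω),
      MemLp A 2 (volume.restrict (Ioc 0 T)) ∧
      (∫ t in Ioc 0 T, h.R' t (compH10 hβ hβ_zero hK (h.P t)) = ∫ t in Ioc 0 T, ∫ x in Ω,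
        inner ℝ (A t x) ((compH10 hβ hβ_zero hK (h.P t) : Pairs Ω).snd x)) ∧
      ∀ᵐ t ∂volume.restrict (Ioc 0 T), ∀ᵐ x ∂volume.restrict Ω,
        inner ℝ (A t x) ((compH10 hβ hβ_zero hK (h.P t) : Pairs Ω).snd x)
          = k (S (x, t)) * (deriv β (p (x, t)) * ‖(h.P t : Pairs Ω).snd x‖ ^ 2) := by
  obtain ⟨A, hA, hA_ae⟩ := h.exists_flux_curve hk
  refine ⟨A, hA, ?_, ?_⟩
  · rw [h.flux_eq _ (memLp_compH10 hβ hβ_zero hK h.memLp_P)]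
    refine integral_congr_ae (hA_ae.mono fun t ht => integral_congr_ae (ht.mono fun x hx => ?_))
    simp only [hx, sub_zero]
  · filter_upwards [hA_ae, h.ae_compH10_snd_eq hβ hβ_zero hK] with t hAt ht
    filter_upwards [hAt, ht] with x hAx hx
    rw [hAx, hx, real_inner_smul_left, real_inner_smul_right, real_inner_self_eq_norm_sq]

theorem integral_flux_nonneg (h : SolutionData Ω T pci pcd b k 0 S₀ p₀ τ S p)
    (hk : Permeability k) (hβ_mono : Monotone β) :
    0 ≤ ∫ t in Ioc 0 T, h.R' t (compH10 hβ hβ_zero hK (h.P t)) := by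
  obtain ⟨A, -, hA, hA_ae⟩ := h.exists_flux_curve_eq hβ hβ_zero hK hk
  rw [hA]
  refine integral_nonneg_of_ae (hA_ae.mono fun t ht => integral_nonneg_of_ae
    (ht.mono fun x hx => ?_))
  simp only [hx, Pi.zero_apply]
  exact mul_nonneg (hk.mem_Icc _).1 (mul_nonneg hβ_mono.deriv_nonneg (sq_nonneg _))

theorem ae_flux_eq_zero (h : SolutionData Ω T pci pcd b k 0 S₀ p₀ τ S p)
    (hk : Permeability k) (hβ_mono : Monotone β)
    (hle : ∫ t in Ioc 0 T, h.R' t (compH10 hβ hβ_zero hK (h.P t)) ≤ 0) :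
    ∀ᵐ t ∂volume.restrict (Ioc 0 T), ∀ᵐ x ∂volume.restrict Ω,
      k (S (x, t)) * (deriv β (p (x, t)) * ‖(h.P t : Pairs Ω).snd x‖ ^ 2) = 0 := by
  obtain ⟨A, hA, hA_eq, hA_ae⟩ := h.exists_flux_curve_eq hβ hβ_zero hK hk
  have hpos : ∀ᵐ t ∂volume.restrict (Ioc 0 T), ∀ᵐ x ∂volume.restrict Ω,
      0 ≤ (inner ℝ (A t x) ((compH10 hβ hβ_zero hK (h.P t) : Pairs Ω).snd x) : ℝ) :=
    hA_ae.mono fun t ht => ht.mono fun x hx => hx ▸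
      mul_nonneg (hk.mem_Icc _).1 (mul_nonneg hβ_mono.deriv_nonneg (sq_nonneg _))
  filter_upwards [hA_ae, ae_inner_eq_zero hA
    ((sndH10 Ω).comp_memLp' (memLp_compH10 hβ hβ_zero hK h.memLp_P)) hpos (hA_eq ▸ hle)]
    with t ht hzero
  filter_upwards [ht, hzero] with x hx hzero_x
  exact hx.symm.trans hzero_x

end Flux

section PressureBound

variable [IsFiniteMeasure (volume.restrict Ω)]

theorem ae_mul_cutoff_nonpos (h : SolutionData Ω T pci pcd b k g S₀ p₀ τ S p) (hτ : 0 < τ)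
    (hpc : CapillaryCurves pci pcd) (hb : ScanningFunction pci pcd b) :
    ∀ᵐ z ∂volume.restrict (Q Ω T), h.v' z * cutoff (pci 1) (p z) ≤ 0 := by
  filter_upwards [h.ae_deriv_eq hpc hb] with z hz
  rcases le_or_gt (pci 1) (p z) with hp | hp
  · rw [cutoff_of_le hp, mul_zero]
  · rw [hz, drainageExcess_eq_zero_of_le hpc hb hp.le, sub_zero]
    exact mul_nonpos_of_nonneg_of_nonpos
      (mul_nonneg (one_div_pos.2 hτ).le (posPart_nonneg _)) (cutoff_neg_of_lt hp).le

theorem ae_eq_one_of_mul_cutoff_eq_zero (h : SolutionData Ω T pci pcd b k g S₀ p₀ τ S p)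
    (hτ : 0 < τ) (hpc : CapillaryCurves pci pcd) (hb : ScanningFunction pci pcd b) :
    ∀ᵐ z ∂volume.restrict (Q Ω T),
      p z < pci 1 → h.v' z * cutoff (pci 1) (p z) = 0 → S z = 1 := by
  filter_upwards [h.ae_deriv_eq hpc hb, h.S_mem] with z hz hS hp hzero
  have deriv_zero : h.v' z = 0 := (mul_eq_zero.1 hzero).resolve_right (cutoff_neg_of_lt hp).ne
  rw [hz, drainageExcess_eq_zero_of_le hpc hb hp.le, sub_zero] at deriv_zero
  have deficit_zero := (mul_eq_zero.1 deriv_zero).resolve_left (one_div_pos.2 hτ).ne'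
  exact saturation_eq_one_of_lt hpc hb hS hp (sub_nonpos.1 (max_eq_right_iff.1 deficit_zero))

theorem integral_flux_cutoff_le (h : SolutionData Ω T pci pcd b k g S₀ p₀ τ S p)
    {L : NNReal} (hL : ∀ s, |deriv (cutoff (pci 1)) s| ≤ L) (hm : pci 1 ≤ 0) (hT : 0 < T)
    (hpc : CapillaryCurves pci pcd) (hb : ScanningFunction pci pcd b)
    (h₀ : InitialData Ω pci pcd S₀ p₀) :
    ∫ t in Ioc 0 T, h.R' t (compH10 (contDiff_cutoff _) (cutoff_of_le hm) hL (h.P t))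
      ≤ ∫ z in Q Ω T, h.v' z * cutoff (pci 1) (p z) := by
  obtain ⟨B, -, hB⟩ := hb.exists_lipschitz
  have initial_energy : ∫ x in Ω, energy b (cutoff (pci 1)) (pci 1) (p₀ x) ≤ 0 :=
    integral_nonpos_of_ae <| (h₀.ae_pc_one_le hpc hb).mono fun x hx =>
      energy_nonpos_of_apply_eq_zero hb.contDiff hb.mono (monotone_cutoff _) _ (cutoff_of_le hx)
  exact sub_nonneg.1 <| (neg_nonneg.2 initial_energy).trans <|
    h.neg_integral_energy_le hT hb.contDiff hb.mono hB hb.zero (monotone_cutoff _)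
      (lipschitzWith_of_abs_deriv_le (contDiff_cutoff _) hL) (cutoff_of_le hm)
      (memLp_compH10 _ _ _ h.memLp_P) (h.ae_compH10_fst_eq _ _ hL) (cutoff_of_le le_rfl)

theorem mul_cutoff_ae_eq_zero (h : SolutionData Ω T pci pcd b k 0 S₀ p₀ τ S p) {L : NNReal}
    (hL : ∀ s, |deriv (cutoff (pci 1)) s| ≤ L) (hm : pci 1 ≤ 0) (hT : 0 < T) (hτ : 0 < τ)
    (hpc : CapillaryCurves pci pcd) (hk : Permeability k) (hb : ScanningFunction pci pcd b)
    (h₀ : InitialData Ω pci pcd S₀ p₀) :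
    (fun z => h.v' z * cutoff (pci 1) (p z)) =ᵐ[volume.restrict (Q Ω T)] 0 :=
  ae_eq_zero_of_nonpos_of_integral_nonneg
    (h.memLp_v'.integrable_mul <|
      (lipschitzWith_of_abs_deriv_le (contDiff_cutoff _) hL).comp_memLp (cutoff_of_le hm) h.memLp_p)
    (h.ae_mul_cutoff_nonpos hτ hpc hb)
    ((h.integral_flux_nonneg (contDiff_cutoff _) (cutoff_of_le hm) hL hk (monotone_cutoff _)).trans
      (h.integral_flux_cutoff_le hL hm hT hpc hb h₀))

theorem ae_cutoff_gradient_eq_zero (h : SolutionData Ω T pci pcd b k 0 S₀ p₀ τ S p)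
    {L : NNReal} (hL : ∀ s, |deriv (cutoff (pci 1)) s| ≤ L) (hm : pci 1 ≤ 0) (hT : 0 < T)
    (hτ : 0 < τ) (hpc : CapillaryCurves pci pcd) (hk : Permeability k)
    (hb : ScanningFunction pci pcd b) (h₀ : InitialData Ω pci pcd S₀ p₀) :
    ∀ᵐ t ∂volume.restrict (Ioc 0 T),
      (compH10 (contDiff_cutoff _) (cutoff_of_le hm) hL (h.P t) : Pairs Ω).snd = 0 := by
  have saturated : ∀ᵐ z ∂volume.restrict (Q Ω T), p z < pci 1 → S z = 1 := by
    filter_upwards [h.ae_eq_one_of_mul_cutoff_eq_zero hτ hpc hb,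
      h.mul_cutoff_ae_eq_zero hL hm hT hτ hpc hk hb h₀] with z hz hzero hp
    exact hz hp hzero
  rw [restrict_Q] at saturated
  have flux_nonpos := (h.integral_flux_cutoff_le hL hm hT hpc hb h₀).trans
    (integral_nonpos_of_ae (h.ae_mul_cutoff_nonpos hτ hpc hb))
  filter_upwards [h.ae_flux_eq_zero _ _ hL hk (monotone_cutoff _) flux_nonpos,
    h.ae_compH10_snd_eq (contDiff_cutoff _) (cutoff_of_le hm) hL,
    ae_ae_of_ae_prod_symm saturated] with t flux_zero snd_eq hS
  rw [Lp.eq_zero_iff_ae_eq_zero]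
  filter_upwards [flux_zero, snd_eq, hS] with x hx hsnd hSx
  rw [hsnd, Pi.zero_apply]
  rcases le_or_gt (pci 1) (p (x, t)) with hp | hp
  · rw [deriv_cutoff_of_le hp, zero_smul]
  · rw [hSx hp] at hx
    have k_ne : k 1 ≠ 0 := (hk.nonneg.trans_lt hk.lt_one).ne'
    rcases mul_eq_zero.1 ((mul_eq_zero.1 hx).resolve_left k_ne) with hderiv | hgrad
    · rw [hderiv, zero_smul]
    · rw [norm_eq_zero.1 ((pow_eq_zero_iff two_ne_zero).1 hgrad), smul_zero]

theorem ae_pc_one_le (h : SolutionData Ω T pci pcd b k 0 S₀ p₀ τ S p) (hm : pci 1 ≤ 0)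
    (hT : 0 < T) (hτ : 0 < τ) (hpc : CapillaryCurves pci pcd) (hk : Permeability k)
    (hb : ScanningFunction pci pcd b) (h₀ : InitialData Ω pci pcd S₀ p₀) (hd : 0 < d)
    (hΩ : Bornology.IsBounded Ω) :
    ∀ᵐ z ∂volume.restrict (Q Ω T), pci 1 ≤ p z := by
  obtain ⟨L, hL⟩ := exists_abs_deriv_cutoff_le (pci 1)
  have cutoff_memLp : MemLp (fun z => cutoff (pci 1) (p z)) 2 (volume.restrict (Q Ω T)) :=
    (lipschitzWith_of_abs_deriv_le (contDiff_cutoff _) hL).comp_memLp (cutoff_of_le hm) h.memLp_p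
  have cutoff_zero : ∀ᵐ t ∂volume.restrict (Ioc 0 T), ∀ᵐ x ∂volume.restrict Ω,
      cutoff (pci 1) (p (x, t)) = 0 := by
    filter_upwards [h.ae_cutoff_gradient_eq_zero hL hm hT hτ hpc hk hb h₀,
      h.ae_compH10_fst_eq (contDiff_cutoff _) (cutoff_of_le hm) hL] with t hsnd hfst
    filter_upwards [(Lp.eq_zero_iff_ae_eq_zero).1 (fst_eq_zero_of_snd_eq_zero hd hΩ _ hsnd), hfst]
      with x hzero hx
    exact hx.symm.trans hzero
  rw [restrict_Q] at cutoff_memLp ⊢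
  filter_upwards [ae_eq_zero_of_ae_ae_eq_zero cutoff_memLp cutoff_zero] with z hz
  by_contra! hlt
  exact (cutoff_neg_of_lt hlt).ne hz

end PressureBound

end SolutionData

section Limits

variable {d : ℕ} {Ω : Set (EuclideanSpace ℝ (Fin d))} {T : ℝ} {pci pcd b k : ℝ → ℝ}
  {g : EuclideanSpace ℝ (Fin d)} {S₀ p₀ : EuclideanSpace ℝ (Fin d) → ℝ}
  [IsFiniteMeasure (volume.restrict Ω)]

theorem IsWeakSolution.ae_pc_one_le {τ : ℝ} {S p : EuclideanSpace ℝ (Fin d) × ℝ → ℝ}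
    (h : IsWeakSolution Ω T pci pcd b k 0 S₀ p₀ τ S p) (hd : 0 < d) (hΩo : IsOpen Ω)
    (hΩb : Bornology.IsBounded Ω) (hT : 0 < T) (hτ : 0 < τ) (hpc : CapillaryCurves pci pcd)
    (hk : Permeability k) (hb : ScanningFunction pci pcd b)
    (h₀ : InitialData Ω pci pcd S₀ p₀) :
    ∀ᵐ z ∂volume.restrict (Q Ω T), pci 1 ≤ p z := by
  by_cases hΩ : volume.restrict Ω = 0
  · rw [restrict_Q, hΩ, Measure.zero_prod, ae_zero]
    exact eventually_bot
  · obtain ⟨data⟩ := h.nonempty_solutionData hΩo hT hb h₀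
    have hm : pci 1 ≤ 0 := nonpos_of_le_memH10 hd hΩb hΩ h₀.memH10 (h₀.ae_pc_one_le hpc hb)
    exact data.ae_pc_one_le hm hT hτ hpc hk hb h₀ hd hΩb

theorem capillary_bounds_of_rho_le (hpc : CapillaryCurves pci pcd)
    (hb : ScanningFunction pci pcd b) {s q : ℝ} (hs : s ∈ Icc (0 : ℝ) 1)
    (hi : rho pci b (s + b q) ≤ b q) (hd : b q ≤ rho pcd b (s + b q)) :
    0 < s ∧ s ≤ 1 ∧ q ≤ pcd s ∧ (s < 1 → pci s ≤ q) ∧ (s = 1 → b q = b (pci 1)) := by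
  have hi_curve := hpc.isScanCurve_i hb
  have s_pos := hi_curve.saturation_pos hs.1 hi
  have q_le := (hpc.isScanCurve_d hb).le_pc_of_b_le_rho ⟨s_pos, hs.2⟩ hd
  refine ⟨s_pos, hs.2, q_le, fun hs_lt => hi_curve.pc_le_of_rho_le ⟨s_pos, hs_lt⟩ hi, ?_⟩
  rintro rfl
  exact (hb.mono (hpc.eq_one ▸ q_le)).antisymm (hi_curve.b_pc_le_of_rho_le ⟨s_pos, le_rfl⟩ hi)

theorem ae_capillary_bounds_of_tendstoInMeasure (hd : 0 < d) (hΩo : IsOpen Ω)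
    (hΩb : Bornology.IsBounded Ω) (hT : 0 < T)
    (hpc : CapillaryCurves pci pcd) (hk : Permeability k) (hb : ScanningFunction pci pcd b)
    (h₀ : InitialData Ω pci pcd S₀ p₀) {τ : ℕ → ℝ} {S p : ℕ → EuclideanSpace ℝ (Fin d) × ℝ → ℝ}
    (hτ : ∀ n, 0 < τ n) (hτ_tendsto : Tendsto τ atTop (𝓝 0))
    (h : ∀ n, IsWeakSolution Ω T pci pcd b k g S₀ p₀ (τ n) (S n) (p n))
    {Slim plim : EuclideanSpace ℝ (Fin d) × ℝ → ℝ}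
    (hS : TendstoInMeasure (volume.restrict (Q Ω T)) S atTop Slim)
    (hp : TendstoInMeasure (volume.restrict (Q Ω T)) p atTop plim) :
    ∀ᵐ z ∂volume.restrict (Q Ω T),
      0 < Slim z ∧ Slim z ≤ 1 ∧ plim z ≤ pcd (Slim z) ∧
      (Slim z < 1 → pci (Slim z) ≤ plim z) ∧ (Slim z = 1 → b (plim z) = b (pci 1)) ∧
      (g = 0 → pci (Slim z) ≤ plim z) := by
  obtain ⟨ns, -, hns⟩ := (tendstoInMeasure_prodMk (tendstoInMeasure_prodMk hS hp)
    (tendstoInMeasure_excess_deficit hΩo hT hpc hk hb h₀ hτ hτ_tendsto h)).exists_seq_tendsto_ae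
  have S_mem : ∀ᵐ z ∂volume.restrict (Q Ω T), ∀ n, S n z ∈ Icc (0 : ℝ) 1 :=
    ae_all_iff.2 fun n => ((h n).nonempty_solutionData hΩo hT hb h₀).some.S_mem
  have pc_one_le : ∀ᵐ z ∂volume.restrict (Q Ω T), g = 0 → ∀ n, pci 1 ≤ p n z := by
    refine eventually_imp_distrib_left.2 fun hg => ae_all_iff.2 fun n => ?_
    subst hg
    exact (h n).ae_pc_one_le hd hΩo hΩb hT (hτ n) hpc hk hb h₀
  filter_upwards [hns, S_mem, pc_one_le] with z hz hSz hpz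
  have b_tendsto := (hb.contDiff.continuous.tendsto (plim z)).comp hz.fst_nhds.snd_nhds
  obtain ⟨hi, hd⟩ := rho_le_of_tendsto hpc hb b_tendsto (hz.fst_nhds.fst_nhds.add b_tendsto)
    hz.snd_nhds.fst_nhds hz.snd_nhds.snd_nhds
  have Slim_mem : Slim z ∈ Icc (0 : ℝ) 1 :=
    isClosed_Icc.mem_of_tendsto hz.fst_nhds.fst_nhds (Eventually.of_forall fun n => hSz (ns n))
  obtain ⟨S_pos, S_le, p_le, le_p, b_eq⟩ := capillary_bounds_of_rho_le hpc hb Slim_mem hi hd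
  refine ⟨S_pos, S_le, p_le, le_p, b_eq, fun hg => ?_⟩
  rcases S_le.lt_or_eq with S_lt | S_eq
  · exact le_p S_lt
  · rw [S_eq]
    exact ge_of_tendsto hz.fst_nhds.snd_nhds (Eventually.of_forall fun n => hpz hg (ns n))

end Limits

end EPH

theorem mainTheorem4_general {d : ℕ} (hd : 0 < d) (Ω : Set (EuclideanSpace ℝ (Fin d)))
    (hΩo : IsOpen Ω) (hΩb : Bornology.IsBounded Ω) (T : ℝ) (hT : 0 < T)
    (pci pcd b k : ℝ → ℝ) (g : EuclideanSpace ℝ (Fin d))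
    (S₀ p₀ : EuclideanSpace ℝ (Fin d) → ℝ)
    (hpc : EPH.CapillaryCurves pci pcd) (hk : EPH.Permeability k)
    (hb : EPH.ScanningFunction pci pcd b) (h₀ : EPH.InitialData Ω pci pcd S₀ p₀) :
    (∃ C > 0, ∀ τ > 0, ∀ S p : EuclideanSpace ℝ (Fin d) × ℝ → ℝ,
      EPH.IsWeakSolution Ω T pci pcd b k g S₀ p₀ τ S p →
      MemLp (fun z => EPH.posPart (b (p z) - EPH.rho pcd b (S z + b (p z)))) 2
        (volume.restrict (EPH.Q Ω T)) ∧
      MemLp (fun z => EPH.posPart (EPH.rho pci b (S z + b (p z)) - b (p z))) 2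
        (volume.restrict (EPH.Q Ω T)) ∧
      (∫ t in Ioc 0 T, ∫ x in Ω,
          EPH.posPart (b (p (x, t)) - EPH.rho pcd b (S (x, t) + b (p (x, t)))) ^ 2)
        + (∫ t in Ioc 0 T, ∫ x in Ω,
          EPH.posPart (EPH.rho pci b (S (x, t) + b (p (x, t))) - b (p (x, t))) ^ 2)
        < C * τ) ∧
    (∀ (τ : ℕ → ℝ) (S p : ℕ → EuclideanSpace ℝ (Fin d) × ℝ → ℝ),
      (∀ n, 0 < τ n) → Tendsto τ atTop (𝓝 0) →
      (∀ n, EPH.IsWeakSolution Ω T pci pcd b k g S₀ p₀ (τ n) (S n) (p n)) →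
      (∀ u v : EuclideanSpace ℝ (Fin d) × ℝ → ℝ,
        TendstoInMeasure (volume.restrict (EPH.Q Ω T)) (fun n z => b (p n z)) atTop u →
        TendstoInMeasure (volume.restrict (EPH.Q Ω T)) (fun n z => S n z + b (p n z)) atTop v →
        ∀ᵐ z ∂(volume.restrict (EPH.Q Ω T)),
          EPH.rho pci b (v z) ≤ u z ∧ u z ≤ EPH.rho pcd b (v z)) ∧
      (∀ Slim plim : EuclideanSpace ℝ (Fin d) × ℝ → ℝ,
        TendstoInMeasure (volume.restrict (EPH.Q Ω T)) S atTop Slim →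
        TendstoInMeasure (volume.restrict (EPH.Q Ω T)) p atTop plim →
        ∀ᵐ z ∂(volume.restrict (EPH.Q Ω T)),
          0 < Slim z ∧ Slim z ≤ 1 ∧
          plim z ≤ pcd (Slim z) ∧
          (Slim z < 1 → pci (Slim z) ≤ plim z) ∧
          (Slim z = 1 → b (plim z) = b (pci 1)) ∧
          (g = 0 → pci (Slim z) ≤ plim z))) := by
  have : IsFiniteMeasure (volume.restrict Ω) :=
    isFiniteMeasure_restrict.2 hΩb.measure_lt_top.ne
  constructor
  · obtain ⟨C, hC_pos, hC⟩ := EPH.exists_integral_sq_le (g := g) hΩo hT hpc hk hb h₀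
    refine ⟨C, hC_pos, fun τ hτ S p h => ?_⟩
    obtain ⟨hD, hI, hle⟩ := hC τ hτ S p h
    rw [EPH.integral_Q_eq hD.integrable_sq, EPH.integral_Q_eq hI.integrable_sq] at hle
    exact ⟨hD, hI, hle⟩
  · exact fun τ S p hτ hτ_tendsto h =>
      ⟨fun u v => EPH.ae_hysteresis_of_tendstoInMeasure hΩo hT hpc hk hb h₀ hτ hτ_tendsto h,
        fun Slim plim => EPH.ae_capillary_bounds_of_tendstoInMeasure hd hΩo hΩb hT hpc hk hb h₀
          hτ hτ_tendsto h⟩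

theorem mainTheorem4 {d : ℕ} (hd : 0 < d) (Ω : Set (EuclideanSpace ℝ (Fin d)))
    (hΩo : IsOpen Ω) (hΩb : Bornology.IsBounded Ω) (T : ℝ) (hT : 0 < T)
    (pci pcd b k : ℝ → ℝ) (g : EuclideanSpace ℝ (Fin d))
    (S₀ p₀ : EuclideanSpace ℝ (Fin d) → ℝ)
    (hpc : EPH.CapillaryCurves pci pcd) (hk : EPH.Permeability k)
    (hb : EPH.ScanningFunction pci pcd b) (h₀ : EPH.InitialData Ω pci pcd S₀ p₀)
    (hcase : 0 < k 0 ∨ (g = 0 ∧ k 0 = 0)) :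
    -- the estimate, with a constant independent of `τ`
    (∃ C > 0, ∀ τ > 0, ∀ S p : EuclideanSpace ℝ (Fin d) × ℝ → ℝ,
      EPH.IsWeakSolution Ω T pci pcd b k g S₀ p₀ τ S p →
      MemLp (fun z => EPH.posPart (b (p z) - EPH.rho pcd b (S z + b (p z)))) 2
        (volume.restrict (EPH.Q Ω T)) ∧
      MemLp (fun z => EPH.posPart (EPH.rho pci b (S z + b (p z)) - b (p z))) 2
        (volume.restrict (EPH.Q Ω T)) ∧
      (∫ t in Ioc 0 T, ∫ x in Ω,
          EPH.posPart (b (p (x, t)) - EPH.rho pcd b (S (x, t) + b (p (x, t)))) ^ 2)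
        + (∫ t in Ioc 0 T, ∫ x in Ω,
          EPH.posPart (EPH.rho pci b (S (x, t) + b (p (x, t))) - b (p (x, t))) ^ 2)
        < C * τ) ∧
    -- limits as `τ → 0`
    (∀ (τ : ℕ → ℝ) (S p : ℕ → EuclideanSpace ℝ (Fin d) × ℝ → ℝ),
      (∀ n, 0 < τ n) → Tendsto τ atTop (𝓝 0) →
      (∀ n, EPH.IsWeakSolution Ω T pci pcd b k g S₀ p₀ (τ n) (S n) (p n)) →
      -- in the variables `u = b(p)`, `v = S + b(p)`
      (∀ u v : EuclideanSpace ℝ (Fin d) × ℝ → ℝ,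
        TendstoInMeasure (volume.restrict (EPH.Q Ω T)) (fun n z => b (p n z)) atTop u →
        TendstoInMeasure (volume.restrict (EPH.Q Ω T)) (fun n z => S n z + b (p n z)) atTop v →
        ∀ᵐ z ∂(volume.restrict (EPH.Q Ω T)),
          EPH.rho pci b (v z) ≤ u z ∧ u z ≤ EPH.rho pcd b (v z)) ∧
      -- in the variables `S`, `p`
      (∀ Slim plim : EuclideanSpace ℝ (Fin d) × ℝ → ℝ,
        TendstoInMeasure (volume.restrict (EPH.Q Ω T)) S atTop Slim →
        TendstoInMeasure (volume.restrict (EPH.Q Ω T)) p atTop plim →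
        ∀ᵐ z ∂(volume.restrict (EPH.Q Ω T)),
          0 < Slim z ∧ Slim z ≤ 1 ∧
          plim z ≤ pcd (Slim z) ∧
          (Slim z < 1 → pci (Slim z) ≤ plim z) ∧
          (Slim z = 1 → b (plim z) = b (pci 1)) ∧
          (g = 0 → pci (Slim z) ≤ plim z))) :=
  mainTheorem4_general hd Ω hΩo hΩb T hT pci pcd b k g S₀ p₀ hpc hk hb h₀
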